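/- Let $\mathbb O_{\mathbb C}$ be the complexified octonions, let $G_2=\mathrm{Aut}(\mathbb O_{\mathbb C})$ be the complex group of its algebra automorphisms, and let $T\subset G_2$ be a two-dimensional (hence maximal) torus with Weyl group $W(G_2)=N_{G_2}(T)/T$. For $g\in G_2$ let $\Gamma_g=\{(x,gx)\}\subset\mathbb O_{\mathbb C}\oplus\mathbb O_{\mathbb C}$ be its graph, and let $S$ be the double Cayley Grassmannian, i.e. the Zariski closure of $\{\Gamma_g : g\in G_2\}$ in the Grassmannian of $8$-dimensional subspaces of $\mathbb O_{\mathbb C}\oplus\mathbb O_{\mathbb C}$; the group $G_2\times G_2$ acts on $S$. Let $o\in S$ be a point of the open orbit $\{\Gamma_g\}$ that is fixed by the diagonal (adjoint) action of $T$, for example $o=\Gamma_1$. Let $T.o$ be its orbit under $T=1\times T$ (left translation), let $\mathcal Y_t=\overline{T.o}\subset S$ be the closure of this orbit (this is the fibre over a point $t\neq 0$ of the family of surfaces under consideration, the corresponding fibre $\mathcal X_t$ being identified with $S$), and let $\partial\mathcal Y_t=\overline{T.o}\setminus T.o$. Then the diagonal action of $N_{G_2}(T)$ on $S$ induces an action of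 the Weyl group $W(G_2)$ on the set of irreducible components of $\partial\mathcal Y_t$, and this action is transitive. More precisely, there are characters $\epsilon_1,\epsilon_2,\epsilon_3$ of $T$ with $\epsilon_1+\epsilon_2+\epsilon_3=0$ such that the roots of $(G_2,T)$ are exactly the $\pm\epsilon_i$ and the $\epsilon_i-\epsilon_j$ $(i\ne j)$. For every such choice, with simple roots $-\epsilon_2$, $\epsilon_2-\epsilon_3$ and second fundamental weight $\varpi_2=\epsilon_1-\epsilon_3$, one has $W(G_2).\varpi_2=\{\epsilon_i-\epsilon_j : i\neq j\}$, and there is a $W(G_2)$-equivariant bijection between the set of irreducible components of $\partial\mathcal Y_t$ and $W(G_2).\varpi_2$. The component $D$ corresponding to $\epsilon_i-\epsilon_j$ is the toric divisor of the ray spanned by $\epsilon_i-\epsilon_j$: identify weights and cocharacters by the $W(G_2)$-invariant inner product with $(\epsilon_k,\epsilon_k)=\tfrac23$ and $(\epsilon_k,\epsilon_l)=-\tfrac13$ for $k\ne l$, and let $\lambda\colon\mathbb C^*\to T$ be the one-parameter subgroup corresponding to $\epsilon_i-\epsilon_j$; then $p=\lim_{s\to 0}\lambda(s).o$ exists and $D=\overline{T.p}$.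 -/

import Mathlib

open scoped Quaternion

noncomputable section

namespace DoubleCayley

/-! ### Complexified octonions and the group `G₂` -/

/-- The complexified octonions `𝕆_ℂ = ℂ ⊗ 𝕆`, as the Cayley–Dickson double of the complexified
quaternions `ℍ[ℂ]`.  (`star` on `ℍ[ℂ]` is the `ℂ`-linear quaternionic conjugation.) -/
def Octonion : Type := ℍ[ℂ] × ℍ[ℂ]

instance : AddCommGroup Octonion := inferInstanceAs (AddCommGroup (ℍ[ℂ] × ℍ[ℂ]))

instance : Module ℂ Octonion := inferInstanceAs (Module ℂ (ℍ[ℂ] × ℍ[ℂ]))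

instance : Module.Finite ℂ Octonion := inferInstanceAs (Module.Finite ℂ (ℍ[ℂ] × ℍ[ℂ]))

/-- Octonion multiplication: `(a, b) (c, d) = (a c - d̄ b, d a + b c̄)`. -/
instance : Mul Octonion :=
  ⟨fun x y => (x.1 * y.1 - star y.2 * x.2, y.2 * x.1 + x.2 * star y.1)⟩

theorem finrank_octonion : Module.finrank ℂ Octonion = 8 := by
  have h : Module.finrank ℂ (ℍ[ℂ] × ℍ[ℂ]) = 8 := by
    rw [Module.finrank_prod, Quaternion.finrank_eq_four]
  exact h

/-- The complex group `G₂`: the algebra automorphisms of the complexified octonions. -/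
def G2 : Subgroup (Octonion ≃ₗ[ℂ] Octonion) where
  carrier := {g | ∀ x y, g (x * y) = g x * g y}
  one_mem' := fun _ _ => rfl
  mul_mem' := fun {g h} hg hh x y => by
    change g (h (x * y)) = g (h x) * g (h y)
    rw [hh, hg]
  inv_mem' := fun {g} hg x y => by
    change g.symm (x * y) = g.symm x * g.symm y
    apply g.injective
    rw [hg]
    simp

/-- The Lie algebra `𝔤₂` of `G₂`: the derivations of the complexified octonions. -/
def derivations : Set (Module.End ℂ Octonion) :=
  {D | ∀ x y, D (x * y) = D x * y + x * D y}

/-! ### Tori in `G₂` and the root system -/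

/-- A homomorphism `𝔾ₘ^r → G₂` is algebraic if all matrix coefficients are Laurent polynomials in
the coordinates of `𝔾ₘ^r`. -/
def IsAlgebraicHom {r : ℕ} (φ : (Fin r → ℂˣ) →* G2) : Prop :=
  ∀ (l : Module.Dual ℂ Octonion) (x : Octonion), ∃ p : MvPolynomial (Fin r ⊕ Fin r) ℂ,
    ∀ s : Fin r → ℂˣ, l ((φ s : Octonion ≃ₗ[ℂ] Octonion) x) =
      MvPolynomial.eval (Sum.elim (fun i => (s i : ℂ)) (fun i => ((s i)⁻¹ : ℂˣ))) p

/-- `T` is an `r`-dimensional algebraic torus in `G₂`.  Since `G₂` has rank two, its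
two-dimensional tori are exactly its maximal tori. -/
def IsTorus (r : ℕ) (T : Subgroup G2) : Prop :=
  ∃ φ : (Fin r → ℂˣ) →* G2, IsAlgebraicHom φ ∧ Function.Injective φ ∧ φ.range = T

/-- The normalizer `N(T)` of `T` in `G₂`. -/
abbrev torusNormalizer (T : Subgroup G2) : Subgroup G2 := Subgroup.normalizer (T : Set G2)

/-- The Weyl group `W(G₂) = N(T) / T`. -/
abbrev WeylGroup (T : Subgroup G2) : Type :=
  torusNormalizer T ⧸ T.subgroupOf (torusNormalizer T)

/-- Characters of `T`, written multiplicatively (so the sum of weights is the product of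
characters, and `ε_i - ε_j` is `ε i / ε j`). -/
abbrev Char (T : Subgroup G2) : Type := T →* ℂˣ

/-- The action of `N(T)` on characters: `(n · χ)(t) = χ (n⁻¹ t n)`. -/
def conjChar {T : Subgroup G2} (n : torusNormalizer T) (χ : Char T) : Char T :=
  χ.comp (T.normalizerMonoidHom n⁻¹).toMonoidHom

/-- The orbit of a character under the Weyl group. -/
def weylOrbit {T : Subgroup G2} (χ : Char T) : Set (Char T) :=
  {ψ | ∃ n : torusNormalizer T, ψ = conjChar n χ}

/-- `χ` is a root of `(G₂, T)`: a nontrivial weight of the adjoint action of `T` on `𝔤₂`. -/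
def IsRoot (T : Subgroup G2) (χ : Char T) : Prop :=
  χ ≠ 1 ∧ ∃ D ∈ derivations, D ≠ 0 ∧
    ∀ t : T, LinearEquiv.conj ((t : G2) : Octonion ≃ₗ[ℂ] Octonion) D = (χ t : ℂ) • D

/-- The standard coordinates `ε₁, ε₂, ε₃` of the root system: `ε₁ + ε₂ + ε₃ = 0`, and the roots are
the `± ε_i` (short) and the `ε_i - ε_j`, `i ≠ j` (long).  Simple roots are `α₁ = -ε₂` and
`α₂ = ε₂ - ε₃`. -/
def IsEpsilonSystem (T : Subgroup G2) (ε : Fin 3 → Char T) : Prop :=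
  ∏ i, ε i = 1 ∧
    ∀ χ, IsRoot T χ ↔ (∃ i, χ = ε i ∨ χ = (ε i)⁻¹) ∨ ∃ i j, i ≠ j ∧ χ = ε i / ε j

/-- The second fundamental weight `ϖ₂ = ε₁ - ε₃` with respect to the simple roots `-ε₂` and
`ε₂ - ε₃`. -/
def fundamentalWeightTwo {T : Subgroup G2} (ε : Fin 3 → Char T) : Char T := ε 0 / ε 2

/-- The Weyl group invariant inner product, on the `ε_i`: `(ε_i, ε_i) = 2/3` and
`(ε_i, ε_j) = -1/3` for `i ≠ j` (compatible with `ε₁ + ε₂ + ε₃ = 0`). -/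
def epsilonForm (i j : Fin 3) : ℚ := if i = j then 2 / 3 else -1 / 3

/-- The one-parameter subgroup `lam` of `T` corresponds to `ε_i - ε_j` under the identification of
cocharacters with weights by the invariant inner product, i.e.
`⟨ε_k, lam⟩ = (ε_k, ε_i - ε_j)` for all `k`.  It generates the ray spanned by `ε_i - ε_j`. -/
def IsRayGenerator {T : Subgroup G2} (ε : Fin 3 → Char T) (i j : Fin 3) (lam : ℂˣ →* T) : Prop :=
  ∀ k, ∃ m : ℤ, (m : ℚ) = epsilonForm k i - epsilonForm k j ∧ ∀ s, ε k (lam s) = s ^ m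

/-! ### Grassmannians as algebraic varieties -/

section Grassmannian

variable (k : ℕ) (V : Type) [AddCommGroup V] [Module ℂ V]

/-- Linearly independent `k`-frames in `V`. -/
def Frame : Type := {v : Fin k → V // LinearIndependent ℂ v}

/-- The Zariski topology on frames, an open subset of the affine space `V^k`: the sets of
nonvanishing of a polynomial in the values of linear forms on the vectors of the frame form a
basis. -/
instance : TopologicalSpace (Frame k V) :=
  TopologicalSpace.generateFrom {U | ∃ p : MvPolynomial (Fin k × Module.Dual ℂ V) ℂ,
    U = {v | MvPolynomial.eval (fun x => x.2 (v.1 x.1)) p ≠ 0}}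

/-- The Grassmannian of `k`-dimensional subspaces of `V`. -/
def Grassmannian : Type := {L : Submodule ℂ V // Module.finrank ℂ L = k}

variable {k V}

/-- The subspace spanned by a frame. -/
def Frame.span (v : Frame k V) : Grassmannian k V :=
  ⟨Submodule.span ℂ (Set.range v.1), by
    rw [finrank_span_eq_card v.2, Fintype.card_fin]⟩

/-- The Zariski topology of the Grassmannian, as the quotient of the variety of frames by `GL_k`:
a set of subspaces is closed iff the set of frames spanning its members is Zariski closed. -/
instance : TopologicalSpace (Grassmannian k V) :=
  TopologicalSpace.coinduced Frame.span inferInstance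

/-- `p` is the limit at `0` of the map `c : 𝔾ₘ → Gr(k, V)`: it extends to a morphism `𝔸¹ → Gr(k, V)`
with value `p` at `0`.  A morphism from the affine line to the Grassmannian is the span of a
polynomial frame, since vector bundles on the affine line are trivial. -/
def IsLimitAtZero (c : ℂˣ → Grassmannian k V) (p : Grassmannian k V) : Prop :=
  ∃ f : ℂ → Frame k V,
    (∀ (i : Fin k) (l : Module.Dual ℂ V), ∃ q : Polynomial ℂ, ∀ s, l ((f s).1 i) = q.eval s) ∧
    (∀ s : ℂˣ, (f s).span = c s) ∧ (f 0).span = p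

end Grassmannian

/-! ### The double Cayley Grassmannian -/

/-- The Grassmannian of eight-dimensional subspaces of the complexified bi-octonions
`𝕆_ℂ ⊕ 𝕆_ℂ`. -/
abbrev Gr : Type := Grassmannian 8 (Octonion × Octonion)

/-- The action of `G₂ × G₂` on `Gr` induced by its action on `𝕆_ℂ ⊕ 𝕆_ℂ`. -/
instance : MulAction (G2 × G2) Gr where
  smul a L := ⟨L.1.map (LinearEquiv.prodCongr (a.1 : Octonion ≃ₗ[ℂ] Octonion)
      (a.2 : Octonion ≃ₗ[ℂ] Octonion) : (Octonion × Octonion) →ₗ[ℂ] (Octonion × Octonion)), by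
    rw [LinearEquiv.finrank_map_eq]; exact L.2⟩
  one_smul L := Subtype.ext (Submodule.map_id L.1)
  mul_smul a b L := Subtype.ext (Submodule.map_comp
    (LinearEquiv.prodCongr (b.1 : Octonion ≃ₗ[ℂ] Octonion)
      (b.2 : Octonion ≃ₗ[ℂ] Octonion) : (Octonion × Octonion) →ₗ[ℂ] (Octonion × Octonion))
    (LinearEquiv.prodCongr (a.1 : Octonion ≃ₗ[ℂ] Octonion)
      (a.2 : Octonion ≃ₗ[ℂ] Octonion) : (Octonion × Octonion) →ₗ[ℂ] (Octonion × Octonion)) L.1)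

/-- The graph `Γ_g = {(x, g x)}` of an element of `G₂`, as a point of `Gr`. -/
def graphPoint (g : G2) : Gr :=
  ⟨LinearMap.graph ((g : Octonion ≃ₗ[ℂ] Octonion) : Octonion →ₗ[ℂ] Octonion), by
    rw [LinearMap.graph_eq_range_prod, LinearMap.finrank_range_of_inj, finrank_octonion]
    intro x y h
    exact congrArg Prod.fst h⟩

/-- The double Cayley Grassmannian `S`: the Zariski closure of `G₂`, embedded by `g ↦ Γ_g`.
(Every `Γ_g` is the direct sum of the fixed line spanned by `(1, 1)` and the seven-dimensional
subspace of `Im 𝕆_ℂ ⊕ Im 𝕆_ℂ` that it cuts out, so this is the same variety as the closure in the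
Grassmannian of seven-dimensional isotropic subspaces of `Im 𝕆_ℂ ⊕ Im 𝕆_ℂ`.) -/
def doubleCayley : Set Gr := closure (Set.range graphPoint)

/-- The orbit `T.o` of a point under left translations by `T`, i.e. under `1 × T`
(`(1, t) • Γ_g = Γ_{t g}`). -/
def torusOrbit (T : Subgroup G2) (o : Gr) : Set Gr := {L | ∃ t ∈ T, L = ((1, t) : G2 × G2) • o}

/-- The closure of the torus orbit in the double Cayley Grassmannian. -/
def torusClosure (T : Subgroup G2) (o : Gr) : Set Gr :=
  doubleCayley ∩ closure (torusOrbit T o)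

/-- The boundary of the torus closure. -/
def torusBoundary (T : Subgroup G2) (o : Gr) : Set Gr := torusClosure T o \ torusOrbit T o

/-- The irreducible components of the boundary: its maximal irreducible subsets. -/
def BoundaryComponent (T : Subgroup G2) (o : Gr) : Type :=
  {D : Set Gr // Maximal (fun Z => Z ⊆ torusBoundary T o ∧ IsIrreducible Z) D}

/-- `D` is the toric divisor of the ray spanned by `ε_i - ε_j`: for the one-parameter
subgroup `lam` generating that ray, `D` is the closure of the `T`-orbit of the limit point
`lim_{s → 0} lam(s).o`. -/
def IsDivisorOfRay (T : Subgroup G2) (o : Gr) (ε : Fin 3 → Char T) (i j : Fin 3) (D : Set Gr) :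
    Prop :=
  ∃ lam : ℂˣ →* T, IsRayGenerator ε i j lam ∧
    ∃ p : Gr, IsLimitAtZero (fun s => ((1, (lam s : G2)) : G2 × G2) • o) p ∧
      D = closure (torusOrbit T p)

end DoubleCayley

end

/-!
The octonions have a basis adapted to the torus `T`, the vector matrix basis of Zorn: complementary
idempotents `e` and `1 - e`, vectors `x₁, x₂, x₃` of the Peirce space of `e` and dual vectors
`y₁, y₂, y₃` of the opposite Peirce space, such that `T` acts with weight `0` on the idempotents,
`ε_i` on `x_i` and `-ε_i` on `y_i`. To find it, one takes weight vectors `x`, `z` of opposite nonzero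
weights that are not orthogonal; a multiple of `x z` is a fixed idempotent `e`, and any weight basis
of its Peirce space can be rescaled to a part of a Zorn basis (`IsTorus.exists_torusFrame`). Since
the torus has dimension two, `(ε₁, ε₂, ε₃)` identifies it with the triples of product `1`. As all
Zorn bases are conjugate under `G₂`, permuting the `x_i` and exchanging the two Peirce spaces is
realized by the normalizer of `T` (`TorusFrame.exists_normalizer`). A derivation of weight `χ` moves
some basis vector to a vector whose weight differs by `χ`; this bounds the set of roots, and
explicit root vectors show that it consists of the `± ε_i` and the `ε_i - ε_j`. Any other choice of
coordinates of the root system differs from `ε` by a permutation and a sign, so it comes from a Zorn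
basis as well (`TorusFrame.ofIsEpsilonSystem`).

The base point is the graph of some `g ∈ T`, because `T` is its own centralizer, and the members of
`T.o` are the subspaces spanned by the `(e_s, e_s)`, `(a_i x_i, c_i x_i)` and `(c_i y_i, a_i y_i)`,
where the `a_i`, `c_i` do not vanish and `a₁ a₂ a₃ = c₁ c₂ c₃`. Dropping the condition that they do
not vanish one gets a del Pezzo surface of degree six in `ℙ¹ × ℙ¹ × ℙ¹`. It is Zariski closed in the
Grassmannian, as multilinear equations on the members of a subspace are closed conditions
(`mem_toricSurface_iff`), and it is contained in the closure of `T.o`, as its points are limits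
along polynomial curves. Its boundary is the union of the six lines `c_i = a_j = 0`, `i ≠ j`, which
are therefore the components (`maximal_irreducible_iff`). The one-parameter subgroup of `ε_i - ε_j`
multiplies `c_i` by `s` and `c_j` by `s⁻¹`, so that its limit lies on the line `c_i = a_j = 0`.

For the equivariance, the line `c_i = a_j = 0` is described without coordinates, as the set of all
subspaces in the closure that contain `(u, 0)` and `(0, w)` for weight vectors `u`, `w` whose
weights differ by `ε_i - ε_j` (`TorusFrame.weightDivisor_eq`). The normalizer permutes these sets in
the same way as the characters (`diagSMul_image_weightDivisor`), and `T` acts trivially because it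
fixes the surface pointwise. Transitivity is then that of the Weyl group on the long roots.
-/

open scoped Quaternion

noncomputable section

namespace DoubleCayley

open Module

/-! ### The composition algebra of complexified octonions -/

namespace Octonion

theorem ext {x y : Octonion} (h₁ : x.1 = y.1) (h₂ : x.2 = y.2) : x = y := Prod.ext h₁ h₂

theorem ext_coords {x y : Octonion} (h₁ : x.1.re = y.1.re) (h₂ : x.1.imI = y.1.imI)
    (h₃ : x.1.imJ = y.1.imJ) (h₄ : x.1.imK = y.1.imK) (h₅ : x.2.re = y.2.re)
    (h₆ : x.2.imI = y.2.imI) (h₇ : x.2.imJ = y.2.imJ) (h₈ : x.2.imK = y.2.imK) : x = y :=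
  ext (Quaternion.ext _ _ h₁ h₂ h₃ h₄) (Quaternion.ext _ _ h₅ h₆ h₇ h₈)

@[simp] theorem fst_mul (x y : Octonion) : (x * y).1 = x.1 * y.1 - star y.2 * x.2 := rfl
@[simp] theorem snd_mul (x y : Octonion) : (x * y).2 = y.2 * x.1 + x.2 * star y.1 := rfl
@[simp] theorem fst_add (x y : Octonion) : (x + y).1 = x.1 + y.1 := rfl
@[simp] theorem snd_add (x y : Octonion) : (x + y).2 = x.2 + y.2 := rfl
@[simp] theorem fst_sub (x y : Octonion) : (x - y).1 = x.1 - y.1 := rfl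
@[simp] theorem snd_sub (x y : Octonion) : (x - y).2 = x.2 - y.2 := rfl
@[simp] theorem fst_zero : (0 : Octonion).1 = 0 := rfl
@[simp] theorem snd_zero : (0 : Octonion).2 = 0 := rfl
@[simp] theorem fst_smul (c : ℂ) (x : Octonion) : (c • x).1 = c • x.1 := rfl
@[simp] theorem snd_smul (c : ℂ) (x : Octonion) : (c • x).2 = c • x.2 := rfl

instance : One Octonion := ⟨((1 : ℍ[ℂ]), (0 : ℍ[ℂ]))⟩

@[simp] theorem fst_one : (1 : Octonion).1 = 1 := rfl
@[simp] theorem snd_one : (1 : Octonion).2 = 0 := rfl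

instance : NonAssocRing Octonion :=
  { (inferInstance : AddCommGroup Octonion), (inferInstance : Mul Octonion),
    (inferInstance : One Octonion) with
    left_distrib := fun x y z => by apply ext_coords <;> simp <;> ring
    right_distrib := fun x y z => by apply ext_coords <;> simp <;> ring
    zero_mul := fun x => by apply ext_coords <;> simp
    mul_zero := fun x => by apply ext_coords <;> simp
    one_mul := fun x => by apply ext_coords <;> simp
    mul_one := fun x => by apply ext_coords <;> simp }

instance : IsScalarTower ℂ Octonion Octonion :=
  ⟨fun c x y => by apply ext_coords <;> simp <;> ring⟩

instance : SMulCommClass ℂ Octonion Octonion :=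
  ⟨fun c x y => by apply ext_coords <;> simp <;> ring⟩

/-- The trace `x + x̄` of an octonion, as a complex number. -/
def trace : Octonion →ₗ[ℂ] ℂ where
  toFun x := 2 * x.1.re
  map_add' x y := by simp [mul_add]
  map_smul' c x := by simp; ring

/-- The polar form of the norm of the octonions. -/
def polar : Octonion →ₗ[ℂ] Octonion →ₗ[ℂ] ℂ :=
  LinearMap.mk₂ ℂ (fun x y => 2 * (x.1.re * y.1.re + x.1.imI * y.1.imI + x.1.imJ * y.1.imJ +
      x.1.imK * y.1.imK + x.2.re * y.2.re + x.2.imI * y.2.imI + x.2.imJ * y.2.imJ +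
      x.2.imK * y.2.imK))
    (fun x y z => by simp; ring) (fun c x y => by simp; ring)
    (fun x y z => by simp; ring) (fun c x y => by simp; ring)

theorem trace_apply (x : Octonion) : trace x = 2 * x.1.re := rfl

theorem polar_apply (x y : Octonion) : polar x y =
    2 * (x.1.re * y.1.re + x.1.imI * y.1.imI + x.1.imJ * y.1.imJ +
      x.1.imK * y.1.imK + x.2.re * y.2.re + x.2.imI * y.2.imI + x.2.imJ * y.2.imJ +
      x.2.imK * y.2.imK) := rfl

theorem polar_comm (x y : Octonion) : polar x y = polar y x := by
  simp only [polar_apply]; ring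

@[simp] theorem trace_one : trace 1 = 2 := by simp [trace_apply]

/-- The polarization of the quadratic equation `x² = tr(x) x - n(x)`. -/
theorem mul_add_mul_comm (x y : Octonion) :
    x * y + y * x = trace x • y + trace y • x - polar x y • 1 := by
  apply ext_coords <;>
    simp [trace_apply, polar_apply] <;> ring

set_option maxHeartbeats 2000000 in
/-- The linearization of `x (x z) = (x x) z`. -/
theorem left_alternative (x y z : Octonion) :
    x * (y * z) + y * (x * z) = (x * y + y * x) * z := by
  apply ext_coords <;> simp <;> ring

set_option maxHeartbeats 2000000 in
/-- The linearization of `(z x) x = z (x x)`. -/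
theorem right_alternative (x y z : Octonion) :
    z * x * y + z * y * x = z * (x * y + y * x) := by
  apply ext_coords <;> simp <;> ring

theorem flexible (x y : Octonion) : x * y * x = x * (y * x) := by
  apply ext_coords <;> simp <;> ring

theorem trace_mul_comm (x y : Octonion) : trace (x * y) = trace (y * x) := by
  simp [trace_apply]; ring

theorem trace_mul_assoc (x y z : Octonion) : trace (x * y * z) = trace (x * (y * z)) := by
  simp [trace_apply]; ring

/-- The norm `polar x x / 2` is multiplicative. -/
theorem polar_mul_mul_self (x y : Octonion) :
    2 * polar (x * y) (x * y) = polar x x * polar y y := by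
  simp [polar_apply]; ring

theorem mul_self (x : Octonion) : x * x = trace x • x - (polar x x / 2) • 1 := by
  have h := mul_add_mul_comm x x
  have h2 : (2 : ℂ) • (x * x) = (2 : ℂ) • (trace x • x - (polar x x / 2) • 1) := by
    rw [two_smul, h, smul_sub, smul_smul _ (polar x x / 2), two_smul]; congr 2; ring
  exact smul_right_injective Octonion (two_ne_zero' ℂ) h2

/-- The polar form is nondegenerate. -/
theorem eq_zero_of_polar_eq_zero {x : Octonion} (h : ∀ y, polar x y = 0) : x = 0 := by
  have h1 := fun a b c d =>
    (polar_apply x ((⟨a, b, c, d⟩ : ℍ[ℂ]), (0 : ℍ[ℂ]))).symm.trans (h _)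
  have h2 := fun a b c d =>
    (polar_apply x ((0 : ℍ[ℂ]), (⟨a, b, c, d⟩ : ℍ[ℂ]))).symm.trans (h _)
  apply ext_coords
  · simpa using h1 1 0 0 0
  · simpa using h1 0 1 0 0
  · simpa using h1 0 0 1 0
  · simpa using h1 0 0 0 1
  · simpa using h2 1 0 0 0
  · simpa using h2 0 1 0 0
  · simpa using h2 0 0 1 0
  · simpa using h2 0 0 0 1

instance : Nontrivial Octonion :=
  ⟨⟨1, 0, fun h => by simpa using congrArg (fun x : Octonion => trace x) h⟩⟩

end Octonion

open Octonion

namespace G2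

theorem map_mul (g : G2) (x y : Octonion) : g.1 (x * y) = g.1 x * g.1 y := g.2 x y

@[simp] theorem map_one (g : G2) : g.1 1 = 1 := by
  obtain ⟨y, hy⟩ := g.1.surjective 1
  have := map_mul g 1 y
  rw [one_mul, hy, mul_one] at this
  exact this.symm

/-- The trace of an octonion that is not a scalar is determined by its quadratic equation. -/
theorem trace_map (g : G2) (x : Octonion) : trace (g.1 x) = trace x := by
  by_contra hne
  have h1 := congrArg g.1 (mul_self x)
  rw [map_mul, mul_self, map_sub, map_smul, map_smul, map_one] at h1
  have h2 : (trace (g.1 x) - trace x) • g.1 x =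
      (polar (g.1 x) (g.1 x) / 2 - polar x x / 2) • 1 := by
    rw [sub_smul, sub_smul]
    rw [sub_eq_sub_iff_add_eq_add] at h1 ⊢
    rw [h1]; abel
  -- `g x` is a scalar, hence so is `x`, and scalars are fixed by `g`
  have h3 : g.1 x = ((trace (g.1 x) - trace x)⁻¹ *
      (polar (g.1 x) (g.1 x) / 2 - polar x x / 2)) • (1 : Octonion) := by
    rw [mul_smul, ← h2, inv_smul_smul₀ (sub_ne_zero.2 hne)]
  set c := (trace (g.1 x) - trace x)⁻¹ * (polar (g.1 x) (g.1 x) / 2 - polar x x / 2)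
  have h4 : x = c • (1 : Octonion) := g.1.injective (by rw [map_smul, map_one]; exact h3)
  exact hne (by rw [h3, ← h4])

theorem polar_map (g : G2) (x y : Octonion) : polar (g.1 x) (g.1 y) = polar x y := by
  have h1 := congrArg g.1 (mul_add_mul_comm x y)
  have h2 := mul_add_mul_comm (g.1 x) (g.1 y)
  rw [map_add, map_mul, map_mul, h2, map_sub, map_add, map_smul, map_smul, map_smul, map_one,
    trace_map, trace_map, sub_right_inj] at h1
  exact smul_left_injective ℂ (one_ne_zero (α := Octonion)) h1

end G2

/-! ### Peirce decomposition with respect to an idempotent -/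

namespace Octonion

theorem polar_one_left (x : Octonion) : polar 1 x = trace x := by
  simp [polar_apply, trace_apply]

theorem polar_eq_trace (x y : Octonion) : polar x y = trace x * trace y - trace (x * y) := by
  have h := congrArg trace (mul_add_mul_comm x y)
  simp only [map_add, map_sub, map_smul, smul_eq_mul, trace_one, trace_mul_comm y x] at h
  linear_combination (1 / 2) * h

theorem mul_mul_self_left (x z : Octonion) : x * (x * z) = x * x * z := by
  have h := left_alternative x x z
  rw [← two_smul ℂ, ← two_smul ℂ (x * x), smul_mul_assoc] at h
  exact smul_right_injective Octonion (two_ne_zero' ℂ) h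

theorem mul_mul_self_right (x z : Octonion) : z * x * x = z * (x * x) := by
  have h := right_alternative x x z
  rw [← two_smul ℂ, ← two_smul ℂ (x * x), mul_smul_comm] at h
  exact smul_right_injective Octonion (two_ne_zero' ℂ) h

/-- An idempotent of trace one, i.e. one different from `0` and `1`. -/
structure IsPrimitiveIdempotent (e : Octonion) : Prop where
  mul_self : e * e = e
  trace_eq : trace e = 1

namespace IsPrimitiveIdempotent

variable {e : Octonion} (he : IsPrimitiveIdempotent e)
include he

theorem one_sub : IsPrimitiveIdempotent (1 - e) where
  mul_self := by rw [sub_mul, mul_sub, mul_sub, he.mul_self]; simp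
  trace_eq := by rw [map_sub, trace_one, he.trace_eq]; norm_num

theorem ne_zero : e ≠ 0 := by
  rintro rfl
  simpa using he.trace_eq

theorem polar_self : polar e e = 0 := by
  rw [polar_eq_trace, he.mul_self, he.trace_eq]; norm_num

theorem polar_one_sub : polar e (1 - e) = 1 := by
  rw [map_sub, he.polar_self, polar_comm, polar_one_left, he.trace_eq]; norm_num

end IsPrimitiveIdempotent

/-- The Peirce space of an idempotent `e` on which left multiplication by `e` is the identity and
right multiplication by `e` is zero.  The opposite Peirce space is that of `1 - e`. -/
def peirce (e : Octonion) : Submodule ℂ Octonion where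
  carrier := {v | e * v = v ∧ v * e = 0}
  zero_mem' := by simp
  add_mem' := fun {v w} hv hw =>
    ⟨by rw [mul_add, hv.1, hw.1], by rw [add_mul, hv.2, hw.2, add_zero]⟩
  smul_mem' := fun c v hv => ⟨by rw [mul_smul_comm, hv.1], by rw [smul_mul_assoc, hv.2, smul_zero]⟩

theorem mem_peirce_one_sub {e v : Octonion} : v ∈ peirce (1 - e) ↔ e * v = 0 ∧ v * e = v := by
  change (1 - e) * v = v ∧ v * (1 - e) = 0 ↔ _
  rw [sub_mul, mul_sub, one_mul, mul_one, sub_eq_self, sub_eq_zero, eq_comm (a := v)]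

/-- The projection onto the Peirce space of an idempotent. -/
def peirceProj (e : Octonion) : Octonion →ₗ[ℂ] Octonion where
  toFun v := e * v - e * v * e
  map_add' v w := by rw [mul_add, add_mul]; abel
  map_smul' c v := by simp [mul_smul_comm, smul_mul_assoc, smul_sub]

theorem peirceProj_apply (e v : Octonion) : peirceProj e v = e * v - e * v * e := rfl

theorem peirceProj_of_mem {e v : Octonion} (hv : v ∈ peirce e) : peirceProj e v = v := by
  rw [peirceProj_apply, hv.1, hv.2, sub_zero]

namespace IsPrimitiveIdempotent

variable {e : Octonion} (he : IsPrimitiveIdempotent e)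
include he

theorem peirceProj_mem (v : Octonion) : peirceProj e v ∈ peirce e := by
  constructor
  · rw [peirceProj_apply, mul_sub, ← flexible, mul_mul_self_left, he.mul_self]
  · rw [peirceProj_apply, sub_mul, mul_mul_self_right, he.mul_self, sub_self]

/-- The only fixed vectors of both multiplications by a primitive idempotent are its multiples. -/
theorem eq_smul_of_mul_eq {v : Octonion} (h1 : e * v = v) (h2 : v * e = v) :
    ∃ c : ℂ, v = c • e := by
  have h := mul_add_mul_comm e v
  rw [h1, h2, he.trace_eq, one_smul, add_sub_assoc] at h
  have h3 : v = trace v • e - polar e v • 1 := add_left_cancel h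
  refine ⟨trace v - polar e v, ?_⟩
  calc v = e * v := h1.symm
    _ = e * (trace v • e - polar e v • 1) := by rw [← h3]
    _ = _ := by rw [mul_sub, mul_smul_comm, mul_smul_comm, he.mul_self, mul_one, sub_smul]

theorem exists_decomposition (v : Octonion) :
    ∃ c d : ℂ, v = c • e + d • (1 - e) + peirceProj e v + peirceProj (1 - e) v := by
  obtain ⟨c, hc⟩ := he.eq_smul_of_mul_eq (v := e * v * e)
    (by rw [← flexible, mul_mul_self_left, he.mul_self]) (by rw [mul_mul_self_right, he.mul_self])
  obtain ⟨d, hd⟩ := he.one_sub.eq_smul_of_mul_eq (v := (1 - e) * v * (1 - e))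
    (by rw [← flexible, mul_mul_self_left, he.one_sub.mul_self])
    (by rw [mul_mul_self_right, he.one_sub.mul_self])
  refine ⟨c, d, ?_⟩
  rw [← hc, ← hd, peirceProj_apply, peirceProj_apply]
  simp only [sub_mul, mul_sub, one_mul, mul_one]
  abel

theorem polar_eq_zero_of_mem {v : Octonion} (hv : v ∈ peirce e) : polar e v = 0 ∧ trace v = 0 := by
  have h := mul_add_mul_comm e v
  rw [hv.1, hv.2, he.trace_eq, one_smul, add_sub_assoc] at h
  have h1 : trace v • e = polar e v • 1 := sub_eq_zero.1 (add_left_cancel h).symm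
  have h2 : polar e v • (1 - e) = 0 := by
    have h3 := congrArg (e * ·) h1
    simp only [mul_smul_comm, he.mul_self, mul_one] at h3
    rw [smul_sub, ← h1, h3, sub_self]
  have h4 : polar e v = 0 := (smul_eq_zero.1 h2).resolve_right he.one_sub.ne_zero
  rw [h4, zero_smul] at h1
  exact ⟨h4, (smul_eq_zero.1 h1).resolve_right he.ne_zero⟩

theorem polar_one_sub_eq_zero_of_mem {v : Octonion} (hv : v ∈ peirce e) : polar (1 - e) v = 0 := by
  rw [map_sub, LinearMap.sub_apply, polar_one_left, (he.polar_eq_zero_of_mem hv).1,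
    (he.polar_eq_zero_of_mem hv).2, sub_zero]

theorem polar_self_eq_zero {v : Octonion} (hv : v ∈ peirce e) : polar v v = 0 := by
  have h := polar_mul_mul_self e v
  rw [hv.1, he.polar_self, zero_mul] at h
  simpa using h

theorem polar_eq_zero {v w : Octonion} (hv : v ∈ peirce e) (hw : w ∈ peirce e) :
    polar v w = 0 := by
  have h := he.polar_self_eq_zero (add_mem hv hw)
  simp only [map_add, LinearMap.add_apply, he.polar_self_eq_zero hv, he.polar_self_eq_zero hw,
    polar_comm w v] at h
  linear_combination h / 2

omit he in
/-- The product of the octonions restricts to a product of a Peirce space with values in the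
opposite one. -/
theorem mul_mem {v w : Octonion} (hv : v ∈ peirce e) (hw : w ∈ peirce e) :
    v * w ∈ peirce (1 - e) := by
  have h1 := left_alternative e v w
  have h2 := right_alternative w e v
  rw [hv.1, hv.2, hw.1, add_zero] at h1
  rw [hv.2, hw.1, hw.2, zero_mul, zero_add, add_zero] at h2
  exact mem_peirce_one_sub.2 ⟨by simpa using h1, h2⟩

theorem mul_anticomm {v w : Octonion} (hv : v ∈ peirce e) (hw : w ∈ peirce e) :
    v * w = - (w * v) := by
  have h := mul_add_mul_comm v w
  rw [(he.polar_eq_zero_of_mem hv).2, (he.polar_eq_zero_of_mem hw).2, he.polar_eq_zero hv hw] at h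
  rw [eq_neg_iff_add_eq_zero, h]; simp

theorem mul_self_eq_zero {v : Octonion} (hv : v ∈ peirce e) : v * v = 0 := by
  rw [Octonion.mul_self, (he.polar_eq_zero_of_mem hv).2, he.polar_self_eq_zero hv]; simp

theorem mul_opposite {v w : Octonion} (hv : v ∈ peirce e) (hw : w ∈ peirce (1 - e)) :
    v * w = - polar v w • e := by
  have hw' := mem_peirce_one_sub.1 hw
  have key : ∀ {f a b : Octonion}, IsPrimitiveIdempotent f → a ∈ peirce f → f * b = 0 →
      b * f = b → ∃ c : ℂ, a * b = c • f := by
    intro f a b hf ha hb1 hb2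
    have h1 := left_alternative f a b
    have h2 := right_alternative b f a
    rw [ha.1, ha.2, hb1, mul_zero, add_zero, add_zero] at h1
    rw [ha.2, hb1, hb2, zero_mul, add_zero, add_zero] at h2
    exact hf.eq_smul_of_mul_eq h1 h2
  obtain ⟨c, hc⟩ := key he hv hw'.1 hw'.2
  have hv' := (mem_peirce_one_sub (e := 1 - e) (v := v)).1 (by rwa [sub_sub_cancel])
  obtain ⟨d, hd⟩ := key he.one_sub hw hv'.1 hv'.2
  have h := mul_add_mul_comm v w
  rw [(he.polar_eq_zero_of_mem hv).2, (he.one_sub.polar_eq_zero_of_mem hw).2, hc, hd] at h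
  have h3 := congrArg (e * ·) h
  simp only [mul_add, mul_sub, mul_smul_comm, he.mul_self, mul_one, sub_self, smul_zero, zero_smul,
    add_zero, zero_sub, mul_neg] at h3
  rw [hc, h3, neg_smul]

/-- The polar form identifies each Peirce space with the dual of the opposite one. -/
theorem exists_dual {κ : Type*} [Finite κ] {x : κ → Octonion} (hli : LinearIndependent ℂ x)
    (hx : Submodule.span ℂ (Set.range x) = peirce e) :
    ∃ y : κ → Octonion, (∀ i, y i ∈ peirce (1 - e)) ∧
      ∀ i j, polar (x i) (y j) = - (Finsupp.single i (1 : ℂ)) j := by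
  have hxm : ∀ i, x i ∈ peirce e := fun i => hx ▸ Submodule.subset_span ⟨i, rfl⟩
  have hinj : Function.Injective (polar : Octonion →ₗ[ℂ] Octonion →ₗ[ℂ] ℂ) :=
    (injective_iff_map_eq_zero _).2 fun x h => eq_zero_of_polar_eq_zero fun y => by rw [h]; rfl
  have hsurj : Function.Surjective (polar : Octonion →ₗ[ℂ] Octonion →ₗ[ℂ] ℂ) :=
    (LinearMap.injective_iff_surjective_of_finrank_eq_finrank
      (Subspace.dual_finrank_eq (K := ℂ) (V := Octonion)).symm).1 hinj
  have hex : ∀ j, ∃ w : Octonion, ∀ i, polar (x i) w = - (Finsupp.single i (1 : ℂ)) j := by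
    intro j
    obtain ⟨f, hf⟩ := LinearMap.exists_extend (-(Finsupp.lapply j ∘ₗ hli.repr :
      Submodule.span ℂ (Set.range x) →ₗ[ℂ] ℂ))
    obtain ⟨w, hw⟩ := hsurj f
    refine ⟨w, fun i => ?_⟩
    rw [polar_comm, hw]
    have := LinearMap.congr_fun hf ⟨x i, Submodule.subset_span ⟨i, rfl⟩⟩
    rw [LinearMap.comp_apply] at this
    refine this.trans ?_
    simp [hli.repr_eq_single i ⟨x i, Submodule.subset_span ⟨i, rfl⟩⟩ rfl]
  choose w hw using hex
  refine ⟨fun j => peirceProj (1 - e) (w j), fun j => he.one_sub.peirceProj_mem _, fun i j => ?_⟩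
  obtain ⟨c, d, hcd⟩ := he.exists_decomposition (w j)
  have h := hw j i
  rw [hcd] at h
  simp only [map_add, map_smul] at h
  rw [polar_comm _ e, polar_comm _ (1 - e), (he.polar_eq_zero_of_mem (hxm i)).1,
    he.polar_one_sub_eq_zero_of_mem (hxm i),
    he.polar_eq_zero (hxm i) (he.peirceProj_mem (w j))] at h
  simpa using h

theorem eq_zero_of_mem_opposite {v : Octonion} (hv : v ∈ peirce (1 - e))
    (h : ∀ w ∈ peirce e, polar w v = 0) : v = 0 := by
  refine eq_zero_of_polar_eq_zero fun w => ?_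
  obtain ⟨c, d, hcd⟩ := he.exists_decomposition w
  have h1 := he.one_sub.polar_one_sub_eq_zero_of_mem hv
  rw [sub_sub_cancel] at h1
  rw [hcd]
  simp only [map_add, map_smul]
  rw [polar_comm v e, h1, polar_comm v (1 - e), (he.one_sub.polar_eq_zero_of_mem hv).1,
    polar_comm v, h _ (he.peirceProj_mem w),
    he.one_sub.polar_eq_zero hv (he.one_sub.peirceProj_mem w)]
  simp

end IsPrimitiveIdempotent

/-- The family formed by an idempotent `e`, the complementary idempotent, a family in the Peirce
space of `e` and a family in the opposite Peirce space. -/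
def peirceFamily {κ : Type*} (e : Octonion) (x y : κ → Octonion) : Bool ⊕ Bool × κ → Octonion
  | .inl true => e
  | .inl false => 1 - e
  | .inr (true, i) => x i
  | .inr (false, i) => y i

/-- A basis of the Peirce space of `e`, with a basis of the opposite Peirce space which is dual to
it up to sign. -/
structure IsPeircePair {κ : Type*} (e : Octonion) (x y : κ → Octonion) : Prop where
  span_eq : Submodule.span ℂ (Set.range x) = peirce e
  mem : ∀ i, y i ∈ peirce (1 - e)
  polar_eq : ∀ i j, polar (x i) (y j) = - (Finsupp.single i (1 : ℂ)) j

namespace IsPeircePair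

variable {κ : Type*} {e : Octonion} {x y : κ → Octonion}

theorem mem_left (h : IsPeircePair e x y) (i : κ) : x i ∈ peirce e :=
  h.span_eq ▸ Submodule.subset_span ⟨i, rfl⟩

variable (he : IsPrimitiveIdempotent e) (h : IsPeircePair e x y)
include he h

theorem eq_sum_of_mem [Fintype κ] {v : Octonion} (hv : v ∈ peirce (1 - e)) :
    v = ∑ k, trace (x k * v) • y k := by
  have hp : ∀ k, trace (x k * v) = - polar (x k) v := fun k => by
    rw [polar_eq_trace, (he.polar_eq_zero_of_mem (h.mem_left k)).2]; ring
  refine sub_eq_zero.1 (he.eq_zero_of_mem_opposite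
    (sub_mem hv (Submodule.sum_mem _ fun k _ => Submodule.smul_mem _ _ (h.mem k))) ?_)
  intro w hw
  rw [← h.span_eq] at hw
  refine Submodule.span_induction ?_ (by simp) (fun a b _ _ ha hb => ?_) (fun c a _ ha => ?_) hw
  · rintro _ ⟨i, rfl⟩
    classical
    simp only [map_sub, map_sum, map_smul, hp, h.polar_eq, smul_eq_mul, Finsupp.single_apply]
    simp
  · rw [map_add, LinearMap.add_apply, ha, hb, add_zero]
  · rw [map_smul, LinearMap.smul_apply, ha, smul_zero]

theorem symm [Finite κ] : IsPeircePair (1 - e) y x where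
  span_eq := by
    have := Fintype.ofFinite κ
    refine le_antisymm (Submodule.span_le.2 ?_) fun v hv => ?_
    · rintro _ ⟨i, rfl⟩
      exact h.mem i
    · rw [h.eq_sum_of_mem he hv]
      exact Submodule.sum_mem _ fun k _ => Submodule.smul_mem _ _ (Submodule.subset_span ⟨k, rfl⟩)
  mem i := by rw [sub_sub_cancel]; exact h.mem_left i
  polar_eq i j := by
    classical
    rw [polar_comm, h.polar_eq, Finsupp.single_apply, Finsupp.single_apply]
    simp only [eq_comm]

theorem top_le_span [Finite κ] : ⊤ ≤ Submodule.span ℂ (Set.range (peirceFamily e x y)) := by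
  intro v _
  obtain ⟨c, d, hcd⟩ := he.exists_decomposition v
  have hsub : ∀ k, peirceFamily e x y k ∈ Submodule.span ℂ (Set.range (peirceFamily e x y)) :=
    fun k => Submodule.subset_span ⟨k, rfl⟩
  rw [hcd]
  refine add_mem (add_mem (add_mem (Submodule.smul_mem _ _ (hsub (.inl true)))
    (Submodule.smul_mem _ _ (hsub (.inl false)))) ?_) ?_
  · have := he.peirceProj_mem v
    rw [← h.span_eq] at this
    refine Submodule.span_mono ?_ this
    rintro _ ⟨i, rfl⟩
    exact ⟨.inr (true, i), rfl⟩
  · have := he.one_sub.peirceProj_mem v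
    rw [← (h.symm he).span_eq] at this
    refine Submodule.span_mono ?_ this
    rintro _ ⟨i, rfl⟩
    exact ⟨.inr (false, i), rfl⟩

theorem linearIndependent [Fintype κ] : LinearIndependent ℂ (peirceFamily e x y) := by
  classical
  -- The family is dual to itself, up to signs and a permutation, for the polar form.
  rw [Fintype.linearIndependent_iff]
  intro g hg
  have hx := h.mem_left
  have hsum : ∑ k, g k • peirceFamily e x y k = g (.inl true) • e + g (.inl false) • (1 - e) +
      (∑ i, g (.inr (true, i)) • x i + ∑ i, g (.inr (false, i)) • y i) := by
    rw [Fintype.sum_sum_type, Fintype.sum_prod_type]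
    simp [peirceFamily]
  rw [hsum] at hg
  have h1 : ∀ i, polar e (y i) = 0 := fun i => by
    have := he.one_sub.polar_one_sub_eq_zero_of_mem (h.mem i)
    rwa [sub_sub_cancel] at this
  have h2 : ∀ i, polar (1 - e) (y i) = 0 := fun i =>
    (he.one_sub.polar_eq_zero_of_mem (h.mem i)).1
  have h3 : ∀ i, polar e (x i) = 0 := fun i => (he.polar_eq_zero_of_mem (hx i)).1
  have h4 : ∀ i, polar (1 - e) (x i) = 0 := fun i => he.polar_one_sub_eq_zero_of_mem (hx i)
  have h5 : ∀ i j, polar (x i) (x j) = 0 := fun i j => he.polar_eq_zero (hx i) (hx j)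
  have h6 : ∀ i j, polar (y i) (y j) = 0 := fun i j => he.one_sub.polar_eq_zero (h.mem i) (h.mem j)
  rintro ((_ | _) | ⟨(_ | _), i⟩)
  · have := congrArg (polar e) hg
    simpa [-map_sub, h1, h3, he.polar_self, he.polar_one_sub] using this
  · have := congrArg (polar (1 - e)) hg
    simpa [-map_sub, h2, h4, he.one_sub.polar_self, polar_comm (1 - e) e, he.polar_one_sub]
      using this
  · have := congrArg (polar (x i)) hg
    simpa [-map_sub, h5, h.polar_eq, polar_comm (x i) e, polar_comm (x i) (1 - e), h3, h4,
      Finsupp.single_apply] using this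
  · have := congrArg (polar (y i)) hg
    simpa [-map_sub, h6, polar_comm (y i) (x _), h.polar_eq, polar_comm (y i) e,
      polar_comm (y i) (1 - e), h1, h2, Finsupp.single_apply] using this

/-- Both Peirce spaces have dimension three, as together with the two idempotents they span a space
of dimension eight. -/
theorem card_eq_three [Fintype κ] : Fintype.card κ = 3 := by
  have hb := Module.finrank_eq_card_basis (Basis.mk (h.linearIndependent he) (h.top_le_span he))
  rw [finrank_octonion] at hb
  simp only [Fintype.card_sum, Fintype.card_prod, Fintype.card_bool] at hb
  omega

end IsPeircePair

end Octonion

/-! ### Zorn bases -/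

/-- Indices of the basis vectors of the vector matrix algebra of Zorn: two complementary
idempotents and, for each of them, three vectors of its Peirce space. -/
abbrev ZornIndex : Type := Bool ⊕ Bool × Fin 3

/-- The Levi-Civita symbol on three letters. -/
def leviCivita (i j k : Fin 3) : ℤ :=
  if j = i + 1 ∧ k = i + 2 then 1 else if j = i + 2 ∧ k = i + 1 then -1 else 0

/-- The structure constants of the vector matrix algebra of Zorn: `zornCoeff i j k` is the
coefficient of the `k`-th basis vector in the product of the `i`-th and the `j`-th one. -/
def zornCoeff : ZornIndex → ZornIndex → ZornIndex → ℤ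
  | .inl s, .inl t, .inl r => if s = t ∧ t = r then 1 else 0
  | .inl s, .inr (t, i), .inr (r, k) => if s = t ∧ t = r ∧ i = k then 1 else 0
  | .inr (t, i), .inl s, .inr (r, k) => if s ≠ t ∧ t = r ∧ i = k then 1 else 0
  | .inr (s, i), .inr (t, j), .inr (r, k) =>
    if s = t ∧ r = !s then (if s then 1 else -1) * leviCivita i j k else 0
  | .inr (s, i), .inr (t, j), .inl r => if s ≠ t ∧ i = j ∧ r = s then 1 else 0
  | _, _, _ => 0

/-- A basis of the octonions with the multiplication table of the vector matrix algebra of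
Zorn. -/
def IsZornBasis (b : Basis ZornIndex ℂ Octonion) : Prop :=
  ∀ i j, b i * b j = ∑ k, (zornCoeff i j k : ℂ) • b k

namespace Octonion.IsPeircePair

variable {e : Octonion} {x y : Fin 3 → Octonion}
  (he : IsPrimitiveIdempotent e) (h : IsPeircePair e x y)
include he h

theorem mul_eq (i j : Fin 3) : x i * y j = (if i = j then (1 : ℂ) else 0) • e := by
  rw [he.mul_opposite (h.mem_left i) (h.mem j), h.polar_eq, Finsupp.single_apply, neg_neg]

/-- On a Peirce space the product is a cross product, scaled by the value of the alternating form
`trace (x y z)` on the basis. -/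
theorem mul_left_eq (i j : Fin 3) : x i * x j =
    (trace (x 0 * x 1 * x 2)) • ∑ k, (leviCivita i j k : ℂ) • y k := by
  have hx := h.mem_left
  have hcyc : ∀ i j k, trace (x i * x j * x k) = trace (x j * x k * x i) := fun i j k => by
    rw [trace_mul_assoc, trace_mul_comm]
  have halt : ∀ i j k, trace (x i * x j * x k) = - trace (x j * x i * x k) := fun i j k => by
    rw [he.mul_anticomm (hx i) (hx j), neg_mul, map_neg]
  have hself : ∀ i k, trace (x i * x i * x k) = 0 := fun i k => by
    rw [he.mul_self_eq_zero (hx i), zero_mul, map_zero]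
  have key : ∀ k, trace (x k * (x i * x j)) = trace (x 0 * x 1 * x 2) * leviCivita i j k := by
    intro k
    rw [trace_mul_comm]
    fin_cases i <;> fin_cases j <;> fin_cases k <;>
      simp [leviCivita, hself] <;>
      first
      | rw [hcyc, hself]
      | rw [hcyc, hcyc, hself]
      | (rw [hcyc]; done)
      | (rw [hcyc, hcyc]; done)
      | (rw [halt]; done)
      | (rw [halt, hcyc]; done)
      | rw [halt, hcyc, hcyc]
  rw [h.eq_sum_of_mem he (IsPrimitiveIdempotent.mul_mem (hx i) (hx j)), Finset.smul_sum]
  exact Finset.sum_congr rfl fun k _ => by rw [key, mul_smul]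

/-- The alternating forms on dual bases of the two Peirce spaces are inverse up to sign. -/
theorem trace_mul_trace : trace (x 0 * x 1 * x 2) * trace (y 0 * y 1 * y 2) = -1 := by
  have h1 := left_alternative (y 0) (x 0) (x 1)
  have h' := h.symm he
  have h2 : y 0 * x 0 = 1 - e := by simpa using h'.mul_eq he.one_sub 0 0
  have h3 : x 0 * y 0 = e := by simpa using h.mul_eq he 0 0
  have h4 : y 0 * x 1 = 0 := by simpa using h'.mul_eq he.one_sub 0 1
  rw [h2, h3, h4, h.mul_left_eq he, mul_zero, add_zero, sub_add_cancel, one_mul] at h1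
  have h5 : ∑ k, (leviCivita 0 1 k : ℂ) • y k = y 2 := by
    simp [leviCivita]
  have h6 : ∑ k, (leviCivita 0 2 k : ℂ) • x k = - x 1 := by
    simp [leviCivita]
  rw [h5, mul_smul_comm, h'.mul_left_eq he.one_sub, h6, smul_smul, smul_neg, ← neg_smul] at h1
  have h7 : x 1 ≠ 0 := fun h0 => by simpa [h0] using h.polar_eq 1 1
  have h8 : (-(trace (x 0 * x 1 * x 2) * trace (y 0 * y 1 * y 2)) - 1) • x 1 = 0 := by
    rw [sub_smul, h1, one_smul, sub_self]
  have := (smul_eq_zero.1 h8).resolve_right h7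
  linear_combination -this

/-- A Peirce pair, normalized so that the trace form takes the value `1` on the first family, is
part of a Zorn basis. -/
theorem exists_isZornBasis (ht : trace (x 0 * x 1 * x 2) = 1) :
    ∃ b : Basis ZornIndex ℂ Octonion, IsZornBasis b ∧ b (.inl true) = e ∧
      ∀ i, b (.inr (true, i)) = x i := by
  refine ⟨Basis.mk (h.linearIndependent he) (h.top_le_span he), ?_, ?_, fun i => ?_⟩
  · have h' := h.symm he
    have ht' : trace (y 0 * y 1 * y 2) = -1 := by
      have := h.trace_mul_trace he
      rwa [ht, one_mul] at this
    have e1 := he.mul_self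
    have x1 := fun i => (h.mem_left i).1
    have x2 := fun i => (h.mem_left i).2
    have y1 := fun i => (mem_peirce_one_sub.1 (h.mem i)).1
    have y2 := fun i => (mem_peirce_one_sub.1 (h.mem i)).2
    have xx : ∀ i j, x i * x j = ∑ k, (leviCivita i j k : ℂ) • y k := fun i j => by
      rw [h.mul_left_eq he, ht, one_smul]
    have yy : ∀ i j, y i * y j = - ∑ k, (leviCivita i j k : ℂ) • x k := fun i j => by
      rw [h'.mul_left_eq he.one_sub, ht', neg_one_smul]
    have xy := h.mul_eq he
    have yx := h'.mul_eq he.one_sub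
    intro i j
    simp only [Basis.mk_apply]
    rw [Fintype.sum_sum_type, Fintype.sum_prod_type]
    obtain ((_ | _) | ⟨(_ | _), i⟩) := i <;> obtain ((_ | _) | ⟨(_ | _), j⟩) := j <;>
      simp [peirceFamily, zornCoeff, mul_sub, sub_mul, e1, x1, x2, y1, y2, xx, yy, xy, yx]
  · rw [Basis.mk_apply]; rfl
  · rw [Basis.mk_apply]; rfl

end Octonion.IsPeircePair

/-- Every basis of the Peirce space of a primitive idempotent is, up to scalars, part of a Zorn
basis. -/
theorem exists_isZornBasis {κ : Type*} [Fintype κ] {e : Octonion} (he : IsPrimitiveIdempotent e)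
    {x : κ → Octonion} (hli : LinearIndependent ℂ x)
    (hx : Submodule.span ℂ (Set.range x) = peirce e) :
    ∃ b : Basis ZornIndex ℂ Octonion, IsZornBasis b ∧ b (.inl true) = e ∧
      ∀ i, ∃ c : ℂ, ∃ k, b (.inr (true, i)) = c • x k := by
  obtain ⟨y, hy, hxy⟩ := he.exists_dual hli hx
  have h : IsPeircePair e x y := ⟨hx, hy, hxy⟩
  let σ : Fin 3 ≃ κ := (Fintype.equivFinOfCardEq (h.card_eq_three he)).symm
  have hσ : IsPeircePair e (x ∘ σ) (y ∘ σ) := by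
    classical
    refine ⟨by rw [EquivLike.range_comp, hx], fun i => hy _, fun i j => ?_⟩
    simp [hxy, Finsupp.single_apply]
  set c := trace (x (σ 0) * x (σ 1) * x (σ 2)) with hc
  have hc0 : c ≠ 0 := left_ne_zero_of_mul_eq_one (b := -trace (y (σ 0) * y (σ 1) * y (σ 2)))
    (by
      have := hσ.trace_mul_trace he
      simp only [Function.comp_apply] at this
      rw [mul_neg, this, neg_neg])
  let u : Fin 3 → ℂˣ := ![(Units.mk0 c hc0)⁻¹, 1, 1]
  have hu : IsPeircePair e (fun i => u i • x (σ i)) (fun i => (u i)⁻¹ • y (σ i)) := by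
    refine ⟨?_, fun i => Submodule.smul_mem _ _ (hy _), fun i j => ?_⟩
    · rw [← hσ.span_eq]
      refine le_antisymm (Submodule.span_le.2 ?_) (Submodule.span_le.2 ?_)
      · rintro _ ⟨i, rfl⟩
        exact Submodule.smul_mem _ (u i : ℂ) (Submodule.subset_span ⟨i, rfl⟩)
      · rintro _ ⟨i, rfl⟩
        rw [← inv_smul_smul (u i) ((x ∘ σ) i)]
        exact Submodule.smul_mem _ ((u i)⁻¹ : ℂˣ).1 (Submodule.subset_span ⟨i, rfl⟩)
    · classical
      have : ∀ (a : ℂˣ) (v : Octonion), a • v = (a : ℂ) • v := fun _ _ => rfl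
      simp only [this, map_smul, LinearMap.smul_apply, hxy, Finsupp.single_apply,
        smul_eq_mul, EmbeddingLike.apply_eq_iff_eq]
      split_ifs with hij
      · subst hij; simp
      · simp
  obtain ⟨b, hb, hbe, hbx⟩ := hu.exists_isZornBasis he (by
    simp [u, smul_mul_assoc, Units.smul_def, ← hc, hc0])
  exact ⟨b, hb, hbe, fun i => ⟨u i, σ i, hbx i⟩⟩

/-! ### Existence of a Zorn basis adapted to a torus -/

/-- The weights of the basis vectors of a Zorn basis for the torus with coordinates `ε`. -/
def zornWeight {G : Type*} [Group G] (ε : Fin 3 → G) : ZornIndex → G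
  | .inl _ => 1
  | .inr (true, i) => ε i
  | .inr (false, i) => (ε i)⁻¹

/-- A Zorn basis on which the torus `T` acts diagonally, through the characters `ε₁, ε₂, ε₃` with
trivial product on one of the Peirce spaces; every triple of numbers with product `1` is
attained. -/
structure TorusFrame (T : Subgroup G2) (ε : Fin 3 → Char T) where
  /-- The underlying Zorn basis. -/
  basis : Basis ZornIndex ℂ Octonion
  isZorn : IsZornBasis basis
  apply_basis : ∀ (t : T) k, (t : G2).1 (basis k) = ((zornWeight ε k t : ℂˣ) : ℂ) • basis k
  prod_eq_one : ∏ i, ε i = 1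
  exists_eq : ∀ a : Fin 3 → ℂˣ, ∏ i, a i = 1 → ∃ t : T, ∀ i, ε i t = a i

namespace IsZornBasis

variable {b : Basis ZornIndex ℂ Octonion} (hb : IsZornBasis b)
include hb

theorem vec_mul_opposite (s : Bool) (i : Fin 3) :
    b (.inr (s, i)) * b (.inr (!s, i)) = b (.inl s) := by
  rw [hb, Finset.sum_eq_single (.inl s)]
  · simp [zornCoeff]
  · rintro (r | ⟨r, k⟩) _ h <;> simp_all [zornCoeff]
  · simp

theorem vec_mul_vec (i : Fin 3) :
    b (.inr (true, i)) * b (.inr (true, i + 1)) = b (.inr (false, i + 2)) := by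
  rw [hb, Finset.sum_eq_single (.inr (false, i + 2))]
  · simp [zornCoeff, leviCivita]
  · rintro (r | ⟨r, k⟩) _ h
    · simp [zornCoeff]
    · have : ¬ ((1 : Fin 3) = 2) := by decide
      cases r <;> simp_all [zornCoeff, leviCivita]
  · simp

theorem sum_idem : b (.inl true) + b (.inl false) = 1 := by
  have key : ∀ k, (b (.inl true) + b (.inl false)) * b k = b k := by
    intro k
    rw [add_mul, hb, hb, ← Finset.sum_add_distrib, Finset.sum_eq_single k]
    · obtain ((_ | _) | ⟨(_ | _), j⟩) := k <;> simp [zornCoeff]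
    · rintro l _ h
      obtain ((_ | _) | ⟨(_ | _), i⟩) := l <;> obtain ((_ | _) | ⟨(_ | _), j⟩) := k <;>
        simp_all [zornCoeff, eq_comm]
    · simp
  have h : LinearMap.mulLeft ℂ (b (.inl true) + b (.inl false)) = LinearMap.id :=
    b.ext fun k => by simpa using key k
  simpa using LinearMap.congr_fun h 1

/-- An automorphism that scales the vectors of one Peirce space of a Zorn basis, and fixes the
idempotent, scales the vectors of the other Peirce space by the inverse factors, and the product of
these is `1`. -/
theorem apply_of_apply_vec {g : G2} {a : Fin 3 → ℂˣ} (h1 : g.1 (b (.inl true)) = b (.inl true))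
    (h2 : ∀ i, g.1 (b (.inr (true, i))) = (a i : ℂ) • b (.inr (true, i))) :
    ∏ i, a i = 1 ∧ ∀ k, g.1 (b k) = ((zornWeight a k : ℂˣ) : ℂ) • b k := by
  have h3 : ∀ i, g.1 (b (.inr (false, i + 2))) =
      ((a i : ℂ) * a (i + 1)) • b (.inr (false, i + 2)) := fun i => by
    rw [← hb.vec_mul_vec, G2.map_mul, h2, h2, smul_mul_assoc, mul_smul_comm, smul_smul]
  have h4 : ∀ i, (a i : ℂ) * a (i + 1) * a (i + 2) = 1 := fun i => by
    have := congrArg g.1 (hb.vec_mul_opposite true (i + 2))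
    rw [G2.map_mul, h1, h2, Bool.not_true, h3, smul_mul_assoc, mul_smul_comm, smul_smul,
      ← Bool.not_true, hb.vec_mul_opposite] at this
    have h5 : ((a (i + 2) : ℂ) * (a i * a (i + 1)) - 1) • b (.inl true) = 0 := by
      rw [sub_smul, this, one_smul, sub_self]
    have := (smul_eq_zero.1 h5).resolve_right (b.ne_zero _)
    linear_combination this
  refine ⟨?_, ?_⟩
  · rw [Fin.prod_univ_three]
    exact Units.ext (by simpa using h4 0)
  · rintro ((_ | _) | ⟨(_ | _), i⟩)
    · have := congrArg g.1 hb.sum_idem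
      rw [map_add, h1, G2.map_one, ← hb.sum_idem] at this
      simpa [zornWeight] using add_left_cancel this
    · simpa [zornWeight] using h1
    · have h6 : i = i + 1 + 2 := by revert i; decide
      have h7 := h3 (i + 1)
      have h8 := h4 (i + 1)
      rw [← h6] at h7 h8
      rw [h7]
      congr 1
      simp only [zornWeight, Units.val_inv_eq_inv_val]
      exact eq_inv_of_mul_eq_one_left h8
    · exact h2 i

end IsZornBasis

/-- If a vector moves under a commutative group by a linear combination of characters, then the
coefficients are weight vectors. -/
theorem apply_eq_smul_of_apply_eq_sum {G V : Type*} [CommGroup G] [AddCommGroup V] [Module ℂ V]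
    (ρ : G → V →ₗ[ℂ] V) (hρ : ∀ s t v, ρ (s * t) v = ρ s (ρ t v)) {x : V}
    (C : Finset (G →* ℂˣ)) (v : (G →* ℂˣ) → V)
    (h : ∀ s, ρ s x = ∑ χ ∈ C, (χ s : ℂ) • v χ) {χ : G →* ℂˣ} (hχ : χ ∈ C) (s : G) :
    ρ s (v χ) = (χ s : ℂ) • v χ := by
  rw [← sub_eq_zero, ← Module.forall_dual_apply_eq_zero_iff ℂ]
  intro l
  have hli : LinearIndependent ℂ (fun χ : G →* ℂˣ => ((fun t => (χ t : ℂ)) : G → ℂ)) :=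
    (linearIndependent_monoidHom G ℂ).comp (fun χ : G →* ℂˣ => (Units.coeHom ℂ).comp χ)
      fun χ₁ χ₂ h => by
        ext t
        exact DFunLike.congr_fun h t
  refine linearIndependent_iff'.1 hli C (fun χ => l (ρ s (v χ) - (χ s : ℂ) • v χ)) ?_ χ hχ
  ext t
  have h1 : ∑ χ ∈ C, (χ t : ℂ) • (ρ s (v χ) - (χ s : ℂ) • v χ) = 0 := by
    have h2 := hρ s t x
    rw [h, h, map_sum] at h2
    simp only [smul_sub, Finset.sum_sub_distrib]
    rw [sub_eq_zero]
    simp only [map_smul] at h2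
    rw [← h2]
    refine Finset.sum_congr rfl fun χ _ => ?_
    rw [map_mul, Units.val_mul, mul_comm, mul_smul]
  have h3 := congrArg l h1
  rw [map_sum, map_zero] at h3
  simp only [map_smul, smul_eq_mul] at h3
  simp only [Finset.sum_apply, Pi.smul_apply, smul_eq_mul, Pi.zero_apply]
  rw [← h3]
  exact Finset.sum_congr rfl fun χ _ => mul_comm _ _

/-- The monomial character of `𝔾ₘ^r` with exponents `m`. -/
def monomialChar {r : ℕ} (m : Fin r → ℤ) : (Fin r → ℂˣ) →* ℂˣ where
  toFun s := ∏ i, s i ^ m i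
  map_one' := by simp
  map_mul' s t := by simp [mul_zpow, Finset.prod_mul_distrib]

theorem monomialChar_apply {r : ℕ} (m : Fin r → ℤ) (s : Fin r → ℂˣ) :
    monomialChar m s = ∏ i, s i ^ m i := rfl

/-- The vectors that are weight vectors for some monomial character. -/
def weightVectors {r : ℕ} (φ : (Fin r → ℂˣ) →* G2) : Set Octonion :=
  {v | ∃ m : Fin r → ℤ, ∀ s, (φ s).1 v = (monomialChar m s : ℂ) • v}

/-- The octonions are spanned by weight vectors: the monomials in the matrix coefficients of `φ s x`
collect to weight vectors with sum `x`, by independence of characters. -/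
theorem span_weightVectors {r : ℕ} {φ : (Fin r → ℂˣ) →* G2} (hφ : IsAlgebraicHom φ) :
    Submodule.span ℂ (weightVectors φ) = ⊤ := by
  classical
  refine eq_top_iff.2 fun x _ => ?_
  let B := Module.finBasis ℂ Octonion
  choose p hp using fun k => hφ (B.coord k) x
  let D := Finset.univ.biUnion fun k => (p k).support
  let e : (Fin r ⊕ Fin r →₀ ℕ) → Fin r → ℤ := fun d i => (d (.inl i) : ℤ) - d (.inr i)
  let X : (Fin r ⊕ Fin r →₀ ℕ) → Octonion := fun d => ∑ k, (p k).coeff d • B k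
  have hmon : ∀ (d : Fin r ⊕ Fin r →₀ ℕ) (s : Fin r → ℂˣ),
      (monomialChar (e d) s : ℂ) = ∏ i, (Sum.elim (fun i => (s i : ℂ))
        (fun i => ((s i)⁻¹ : ℂˣ)) : Fin r ⊕ Fin r → ℂ) i ^ d i := by
    intro d s
    rw [Fintype.prod_sum_type, ← Finset.prod_mul_distrib, monomialChar_apply, Units.coe_prod]
    refine Finset.prod_congr rfl fun i _ => ?_
    simp only [Sum.elim_inl, Sum.elim_inr, e]
    rw [zpow_sub, zpow_natCast, zpow_natCast, ← inv_pow]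
    simp
  have h1 : ∀ s, (φ s).1 x = ∑ d ∈ D, (monomialChar (e d) s : ℂ) • X d := by
    intro s
    rw [← B.sum_repr ((φ s).1 x)]
    simp only [X, Finset.smul_sum]
    rw [Finset.sum_comm]
    refine Finset.sum_congr rfl fun k _ => ?_
    simp only [smul_smul]
    rw [← Finset.sum_smul]
    congr 1
    have := hp k s
    rw [Basis.coord_apply] at this
    rw [this, MvPolynomial.eval_eq']
    rw [Finset.sum_subset (Finset.subset_biUnion_of_mem (fun k => (p k).support)
      (Finset.mem_univ k))]
    · exact Finset.sum_congr rfl fun d _ => by rw [hmon, mul_comm]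
    · intro d _ hd
      rw [MvPolynomial.notMem_support_iff.1 hd, zero_mul]
  let C := D.image fun d => monomialChar (e d)
  let v : ((Fin r → ℂˣ) →* ℂˣ) → Octonion := fun χ =>
    ∑ d ∈ D with monomialChar (e d) = χ, X d
  have h2 : ∀ s, (φ s).1 x = ∑ χ ∈ C, (χ s : ℂ) • v χ := by
    intro s
    rw [h1, ← Finset.sum_fiberwise_of_maps_to (s := D) (t := C)
      (fun d hd => Finset.mem_image_of_mem _ hd)]
    refine Finset.sum_congr rfl fun χ _ => ?_
    rw [Finset.smul_sum]
    refine Finset.sum_congr rfl fun d hd => ?_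
    rw [(Finset.mem_filter.1 hd).2]
  have h3 := h2 1
  rw [map_one] at h3
  change x = _ at h3
  rw [h3]
  refine Submodule.sum_mem _ fun χ hχ => Submodule.smul_mem _ _ (Submodule.subset_span ?_)
  obtain ⟨d, _, rfl⟩ := Finset.mem_image.1 hχ
  exact ⟨e d, fun s => apply_eq_smul_of_apply_eq_sum
    (fun s => ((φ s).1 : Octonion →ₗ[ℂ] Octonion)) (fun s t w => by rw [map_mul]; rfl)
    C v h2 hχ s⟩

theorem exists_sq_eq {r : ℕ} (s : Fin r → ℂˣ) : ∃ u : Fin r → ℂˣ, u ^ 2 = s := by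
  have : ∀ i, ∃ z : ℂˣ, z ^ 2 = s i := fun i => by
    obtain ⟨z, hz⟩ := IsAlgClosed.exists_pow_nat_eq (s i : ℂ) (n := 2) (by norm_num)
    have hz0 : z ≠ 0 := by rintro rfl; exact (s i).ne_zero (by simpa using hz.symm)
    exact ⟨Units.mk0 z hz0, Units.ext (by simpa using hz)⟩
  choose u hu using this
  exact ⟨u, funext hu⟩

/-- A nontrivial torus fixes some primitive idempotent: the product of two weight vectors of
opposite nonzero weights, scaled to have trace one. -/
theorem exists_fixed_idempotent {r : ℕ} {φ : (Fin r → ℂˣ) →* G2} (hφ : IsAlgebraicHom φ)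
    (h1 : ∃ s, φ s ≠ 1) :
    ∃ e, IsPrimitiveIdempotent e ∧ ∀ s, (φ s).1 e = e := by
  have hspan := span_weightVectors hφ
  obtain ⟨x, m, hx, hm, hx0⟩ : ∃ (x : Octonion) (m : Fin r → ℤ),
      (∀ s, (φ s).1 x = (monomialChar m s : ℂ) • x) ∧ monomialChar m ≠ 1 ∧ x ≠ 0 := by
    by_contra! hcon
    obtain ⟨s, hs⟩ := h1
    apply hs
    have : ((φ s).1 : Octonion →ₗ[ℂ] Octonion) = LinearMap.id := by
      refine LinearMap.ext_on hspan ?_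
      rintro v ⟨m, hv⟩
      by_cases h : monomialChar m = 1
      · simpa [h] using hv s
      · simp [hcon v m hv h]
    exact Subtype.ext (LinearEquiv.toLinearMap_injective this)
  obtain ⟨s₀, hs₀⟩ : ∃ s, monomialChar m s ≠ 1 := by
    by_contra! h
    exact hm (MonoidHom.ext h)
  obtain ⟨u, rfl⟩ := exists_sq_eq s₀
  rw [map_pow] at hs₀
  -- Both a weight vector for `χ` and one for `χ⁻¹` are isotropic and of trace zero, as `χ² ≠ 1`.
  have hiso : ∀ {v : Octonion} {c : ℂˣ}, (φ u).1 v = (c : ℂ) • v → c ^ 2 ≠ 1 →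
      polar v v = 0 ∧ trace v = 0 := by
    intro v c hv hc
    have hc1 : (c : ℂ) ^ 2 - 1 ≠ 0 := fun h => hc (Units.ext (by simpa using sub_eq_zero.1 h))
    have hc2 : (c : ℂ) - 1 ≠ 0 := fun h => hc1 (by linear_combination ((c : ℂ) + 1) * h)
    have e1 := G2.polar_map (φ u) v v
    have e2 := G2.trace_map (φ u) v
    rw [hv] at e1 e2
    simp only [map_smul, LinearMap.smul_apply, smul_eq_mul] at e1 e2
    exact ⟨(mul_eq_zero.1 (show ((c : ℂ) ^ 2 - 1) * polar v v = 0 by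
        linear_combination e1)).resolve_left hc1,
      (mul_eq_zero.1 (show ((c : ℂ) - 1) * trace v = 0 by
        linear_combination e2)).resolve_left hc2⟩
  obtain ⟨z, ⟨m', hz⟩, hxz⟩ : ∃ z ∈ weightVectors φ, polar x z ≠ 0 := by
    by_contra! hcon
    refine hx0 (eq_zero_of_polar_eq_zero fun y => ?_)
    have : polar x = 0 := LinearMap.ext_on hspan fun z hz => hcon z hz
    rw [this, LinearMap.zero_apply]
  have hmm : ∀ s, (monomialChar m s : ℂ) * monomialChar m' s = 1 := fun s => by
    have e1 := G2.polar_map (φ s) x z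
    rw [hx, hz] at e1
    simp only [map_smul, LinearMap.smul_apply, smul_eq_mul] at e1
    have e2 : ((monomialChar m s : ℂ) * monomialChar m' s - 1) * polar x z = 0 := by
      linear_combination e1
    exact sub_eq_zero.1 ((mul_eq_zero.1 e2).resolve_right hxz)
  have hm'u : monomialChar m' u ^ 2 ≠ 1 := by
    have : monomialChar m' u = (monomialChar m u)⁻¹ :=
      eq_inv_of_mul_eq_one_right (Units.ext (by simpa using hmm u))
    rw [this, inv_pow]
    simpa using hs₀
  obtain ⟨hx1, hx2⟩ := hiso (hx u) hs₀
  obtain ⟨hz1, hz2⟩ := hiso (hz u) hm'u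
  have htr : trace (-(polar x z)⁻¹ • (x * z)) = 1 := by
    have := polar_eq_trace x z
    rw [hx2, zero_mul, zero_sub] at this
    rw [map_smul, ← neg_eq_iff_eq_neg.2 this, smul_eq_mul, neg_mul_neg, inv_mul_cancel₀ hxz]
  have hN : polar (x * z) (x * z) = 0 := by
    have := polar_mul_mul_self x z
    rw [hx1, zero_mul] at this
    simpa using this
  refine ⟨-(polar x z)⁻¹ • (x * z), ⟨?_, htr⟩, fun s => ?_⟩
  · rw [mul_self, htr, map_smul, LinearMap.map_smul₂, hN]
    simp
  · rw [map_smul, G2.map_mul, hx, hz, smul_mul_assoc, mul_smul_comm,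
      smul_smul (monomialChar m s : ℂ), hmm, one_smul]

/-- An injective endomorphism of `𝔾ₘ²` given by monomials is surjective: the matrix of exponents is
nonsingular, since an integer vector in its kernel gives a one-parameter subgroup on which both
monomials are trivial. -/
theorem monomialChar_surjective {m₁ m₂ : Fin 2 → ℤ}
    (hinj : ∀ s, monomialChar m₁ s = 1 → monomialChar m₂ s = 1 → s = 1) (a₁ a₂ : ℂˣ) :
    ∃ s, monomialChar m₁ s = a₁ ∧ monomialChar m₂ s = a₂ := by
  have hdet : m₁ 0 * m₂ 1 - m₁ 1 * m₂ 0 ≠ 0 := by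
    intro h
    obtain ⟨v, hv0, hv⟩ := (Matrix.exists_mulVec_eq_zero_iff (M := Matrix.of ![m₁, m₂])).2
      (by simpa [Matrix.det_fin_two] using h)
    let c : ℂˣ := Units.mk0 2 two_ne_zero
    have hc : ∀ n : ℤ, c ^ n = 1 → n = 0 := fun n hn => by
      have h1 : ((2 : ℝ)) ^ n = 1 := by
        have h2 := congrArg (fun z : ℂˣ => ‖(z : ℂ)‖) hn
        simpa [c] using h2
      exact (zpow_eq_one_iff_right₀ (by norm_num) (by norm_num)).1 h1
    have hs : ∀ m : Fin 2 → ℤ, m 0 * v 0 + m 1 * v 1 = 0 →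
        monomialChar m (fun i => c ^ v i) = 1 := fun m hm => by
      rw [monomialChar_apply, Fin.prod_univ_two, ← zpow_mul, ← zpow_mul, ← zpow_add]
      rw [mul_comm (v 0), mul_comm (v 1), hm, zpow_zero]
    have h1 := congrFun hv 0
    have h2 := congrFun hv 1
    simp [Matrix.mulVec, dotProduct, Fin.sum_univ_two] at h1 h2
    have h3 := hinj _ (hs m₁ h1) (hs m₂ h2)
    exact hv0 (funext fun i => hc _ (congrFun h3 i))
  have hroot : ∀ a : ℂˣ, ∃ r : ℂˣ, r ^ (m₁ 0 * m₂ 1 - m₁ 1 * m₂ 0) = a := by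
    generalize m₁ 0 * m₂ 1 - m₁ 1 * m₂ 0 = d at hdet
    intro a
    obtain ⟨z, hz⟩ := IsAlgClosed.exists_pow_nat_eq (a : ℂ) (Int.natAbs_pos.2 hdet)
    have hz0 : z ≠ 0 := by
      rintro rfl
      rw [zero_pow (Int.natAbs_pos.2 hdet).ne'] at hz
      exact a.ne_zero hz.symm
    have hz' : (Units.mk0 z hz0) ^ d.natAbs = a := Units.ext (by simpa using hz)
    rcases Int.natAbs_eq d with h | h
    · exact ⟨Units.mk0 z hz0, by rw [h, zpow_natCast, hz']⟩
    · exact ⟨(Units.mk0 z hz0)⁻¹, by rw [h, inv_zpow', neg_neg, zpow_natCast, hz']⟩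
  obtain ⟨r₁, hr₁⟩ := hroot a₁
  obtain ⟨r₂, hr₂⟩ := hroot a₂
  -- The exponents are the entries of the adjugate of the matrix with rows `m₁` and `m₂`.
  refine ⟨![r₁ ^ m₂ 1 * r₂ ^ (-m₁ 1), r₁ ^ (-m₂ 0) * r₂ ^ m₁ 0], ?_, ?_⟩
  · simp only [monomialChar_apply, Fin.prod_univ_two, Matrix.cons_val_zero, Matrix.cons_val_one,
      mul_zpow, ← zpow_mul]
    rw [mul_mul_mul_comm, ← zpow_add, ← zpow_add, ← hr₁]
    have e1 : m₂ 1 * m₁ 0 + -m₂ 0 * m₁ 1 = m₁ 0 * m₂ 1 - m₁ 1 * m₂ 0 := by ring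
    have e2 : -m₁ 1 * m₁ 0 + m₁ 0 * m₁ 1 = 0 := by ring
    rw [e1, e2, zpow_zero, mul_one]
  · simp only [monomialChar_apply, Fin.prod_univ_two, Matrix.cons_val_zero, Matrix.cons_val_one,
      mul_zpow, ← zpow_mul]
    rw [mul_mul_mul_comm, ← zpow_add, ← zpow_add, ← hr₂]
    have e1 : m₂ 1 * m₂ 0 + -m₂ 0 * m₂ 1 = 0 := by ring
    have e2 : -m₁ 1 * m₂ 0 + m₁ 0 * m₂ 1 = m₁ 0 * m₂ 1 - m₁ 1 * m₂ 0 := by ring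
    rw [e1, e2, zpow_zero, one_mul]

theorem G2.ext_basis {ι : Type*} (b : Basis ι ℂ Octonion) {g h : G2}
    (H : ∀ i, g.1 (b i) = h.1 (b i)) : g = h :=
  Subtype.ext (LinearEquiv.toLinearMap_injective (b.ext H))

/-- A maximal torus acts diagonally on some Zorn basis. -/
theorem IsTorus.exists_torusFrame {T : Subgroup G2} (hT : IsTorus 2 T) :
    ∃ ε : Fin 3 → Char T, Nonempty (TorusFrame T ε) := by
  obtain ⟨φ, hφ, hinj, rfl⟩ := hT
  obtain ⟨e, he, hfix⟩ := exists_fixed_idempotent hφ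
    ⟨fun _ => -1, fun h => by
      have := congrFun (hinj (h.trans (map_one φ).symm)) 0
      exact absurd (congrArg Units.val this) (by norm_num)⟩
  obtain ⟨κ, hκ, hκspan, hκli⟩ := exists_linearIndependent ℂ
    {v | v ∈ weightVectors φ ∧ v ∈ peirce e}
  have hspan : Submodule.span ℂ (Set.range ((↑) : κ → Octonion)) = peirce e := by
    rw [Subtype.range_coe, hκspan]
    refine le_antisymm (Submodule.span_le.2 fun v hv => hv.2) fun v hv => ?_
    have h1 : peirceProj e v ∈ (Submodule.span ℂ (weightVectors φ)).map (peirceProj e) :=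
      Submodule.mem_map_of_mem (by rw [span_weightVectors hφ]; trivial)
    rw [peirceProj_of_mem hv, Submodule.map_span] at h1
    refine Submodule.span_mono ?_ h1
    rintro _ ⟨w, ⟨m, hm⟩, rfl⟩
    refine ⟨⟨m, fun s => ?_⟩, he.peirceProj_mem w⟩
    rw [← map_smul, ← hm, peirceProj_apply, peirceProj_apply, map_sub, G2.map_mul, G2.map_mul,
      G2.map_mul, hfix]
  have : Finite κ := hκli.finite
  have := Fintype.ofFinite κ
  obtain ⟨b, hb, hbe, hbx⟩ := exists_isZornBasis he hκli hspan
  have hw : ∀ i, ∃ m : Fin 2 → ℤ, ∀ s, (φ s).1 (b (.inr (true, i))) =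
      (monomialChar m s : ℂ) • b (.inr (true, i)) := fun i => by
    obtain ⟨c, k, hck⟩ := hbx i
    obtain ⟨m, hm⟩ := (hκ k.2).1
    exact ⟨m, fun s => by rw [hck, map_smul, hm, smul_comm]⟩
  choose m hm using hw
  have hact := fun s => hb.apply_of_apply_vec (g := φ s) (a := fun i => monomialChar (m i) s)
    (by rw [hbe, hfix]) (fun i => hm i s)
  have hinj' : ∀ s, monomialChar (m 0) s = 1 → monomialChar (m 1) s = 1 → s = 1 := by
    intro s h0 h1
    have h2 : monomialChar (m 2) s = 1 := by
      simpa [Fin.prod_univ_three, h0, h1] using (hact s).1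
    refine hinj ((G2.ext_basis b fun k => ?_).trans (map_one φ).symm)
    rw [(hact s).2 k]
    obtain (_ | ⟨(_ | _), i⟩) := k
    · simp [zornWeight]
    · fin_cases i <;> simp [zornWeight, h0, h1, h2]
    · fin_cases i <;> simp [zornWeight, h0, h1, h2]
  let E := MonoidHom.ofInjective hinj
  have hE : ∀ t : φ.range, φ (E.symm t) = t := fun t =>
    congrArg Subtype.val (E.apply_symm_apply t)
  refine ⟨fun i => (monomialChar (m i)).comp E.symm.toMonoidHom, ⟨⟨b, hb, fun t k => ?_, ?_, ?_⟩⟩⟩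
  · rw [← hE t, (hact (E.symm t)).2 k]
    obtain (_ | ⟨(_ | _), i⟩) := k <;> simp [zornWeight]
  · ext t
    simpa using congrArg Units.val (hact (E.symm t)).1
  · intro a ha
    obtain ⟨s, h0, h1⟩ := monomialChar_surjective hinj' (a 0) (a 1)
    have h2 := (hact s).1
    rw [Fin.prod_univ_three] at h2 ha
    rw [h0, h1, ← ha] at h2
    have h2 := mul_left_cancel h2
    refine ⟨E s, fun i => ?_⟩
    fin_cases i <;> simp [h0, h1, h2]

/-! ### Symmetries of Zorn bases and the normalizer of the torus -/

/-- The permutation of the indices of a Zorn basis induced by a permutation of the three vectors in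
both Peirce spaces. -/
def permIndex (σ : Equiv.Perm (Fin 3)) : Equiv.Perm ZornIndex :=
  Equiv.sumCongr (Equiv.refl _) (Equiv.prodCongr (Equiv.refl _) σ)

/-- The permutation of the indices of a Zorn basis that exchanges the two Peirce spaces. -/
def flipIndex : Equiv.Perm ZornIndex :=
  Equiv.sumCongr Equiv.boolNot (Equiv.prodCongr Equiv.boolNot (Equiv.refl _))

/-- The signs which make a permutation of the indices of a Zorn basis compatible with products:
`1` on the idempotents and a given sign on the Peirce spaces. -/
def vecSign (u : ℤˣ) : ZornIndex → ℤˣ := Sum.elim (fun _ => 1) (fun _ => u)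

theorem zornCoeff_permIndex (σ : Equiv.Perm (Fin 3)) (i j k : ZornIndex) :
    zornCoeff (permIndex σ i) (permIndex σ j) (permIndex σ k) * vecSign σ.sign i *
      vecSign σ.sign j * vecSign σ.sign k = zornCoeff i j k := by
  revert σ i j k; decide +kernel

theorem zornCoeff_flipIndex (i j k : ZornIndex) :
    zornCoeff (flipIndex i) (flipIndex j) (flipIndex k) * vecSign (-1) i *
      vecSign (-1) j * vecSign (-1) k = zornCoeff i j k := by
  revert i j k; decide +kernel

/-- A signed permutation of a Zorn basis that preserves the structure constants gives a Zorn
basis. -/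
theorem IsZornBasis.exists_signed_perm {b : Basis ZornIndex ℂ Octonion} (hb : IsZornBasis b)
    (π : Equiv.Perm ZornIndex) (u : ZornIndex → ℤˣ)
    (h : ∀ i j k, zornCoeff (π i) (π j) (π k) * u i * u j * u k = zornCoeff i j k) :
    ∃ b' : Basis ZornIndex ℂ Octonion, IsZornBasis b' ∧
      ∀ k, b' k = ((u k : ℤ) : ℂ) • b (π k) := by
  have hb' : ∀ k, ((b.reindex π.symm).unitsSMul fun i =>
      Units.map (Int.castRingHom ℂ).toMonoidHom (u i)) k = ((u k : ℤ) : ℂ) • b (π k) := fun k => by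
    rw [Basis.unitsSMul_apply, Basis.reindex_apply, Equiv.symm_symm]
    rfl
  refine ⟨_, fun i j => ?_, hb'⟩
  simp only [hb']
  rw [smul_mul_assoc, mul_smul_comm, hb, smul_smul, ← Equiv.sum_comp π,
    Finset.smul_sum]
  refine Finset.sum_congr rfl fun k _ => ?_
  rw [smul_smul, smul_smul, ← h i j k]
  congr 1
  have hu : ((u k : ℤ) : ℂ) * (u k : ℤ) = 1 := by
    rw [← Int.cast_mul, ← Units.val_mul, Int.units_mul_self]; simp
  push_cast
  linear_combination (-((zornCoeff (π i) (π j) (π k) : ℤ) : ℂ) * (u i : ℤ) * (u j : ℤ)) * hu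

theorem zornWeight_apply {G H : Type*} [Group G] [CommGroup H] (ε : Fin 3 → G →* H) (k : ZornIndex)
    (t : G) : zornWeight ε k t = zornWeight (fun i => ε i t) k := by
  obtain (_ | ⟨(_ | _), i⟩) := k <;> rfl

/-- Two Zorn bases are related by an automorphism of the octonions. -/
theorem IsZornBasis.exists_map_eq {b b' : Basis ZornIndex ℂ Octonion} (hb : IsZornBasis b)
    (hb' : IsZornBasis b') : ∃ g : G2, ∀ k, g.1 (b k) = b' k := by
  let f : Octonion ≃ₗ[ℂ] Octonion := b.equiv b' (Equiv.refl _)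
  have hf : ∀ k, f (b k) = b' k := fun k => by simp [f]
  refine ⟨⟨f, fun x y => ?_⟩, hf⟩
  have h : (LinearMap.mul ℂ Octonion).compr₂ f.toLinearMap =
      (LinearMap.mul ℂ Octonion).compl₁₂ f.toLinearMap f.toLinearMap := by
    refine LinearMap.ext_basis b b fun i j => ?_
    change f (b i * b j) = f (b i) * f (b j)
    rw [hf, hf, hb, hb']
    simp only [map_sum, map_smul, hf]
  exact LinearMap.congr_fun₂ h x y

theorem conjChar_apply {T : Subgroup G2} (n : torusNormalizer T) (χ : Char T) (t : T) :
    conjChar n χ t =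
      χ ⟨(n : G2)⁻¹ * t * n, by
        simpa using (Subgroup.mem_normalizer_iff.1 (n⁻¹).2 t).1 t.2⟩ := by
  refine congrArg χ (Subtype.ext ?_)
  change ((n⁻¹ : torusNormalizer T) : G2) * t * ((n⁻¹ : torusNormalizer T) : G2)⁻¹ = _
  simp

theorem conjChar_div_char {T : Subgroup G2} (n : torusNormalizer T) (χ ψ : Char T) :
    conjChar n (χ / ψ) = conjChar n χ / conjChar n ψ := rfl

theorem conjChar_one {T : Subgroup G2} (χ : Char T) : conjChar 1 χ = χ := by
  ext t
  rw [conjChar_apply]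
  simp

theorem conjChar_mul {T : Subgroup G2} (n m : torusNormalizer T) (χ : Char T) :
    conjChar (n * m) χ = conjChar n (conjChar m χ) := by
  ext t
  simp only [conjChar_apply, Subgroup.coe_mul, mul_inv_rev, mul_assoc]

namespace TorusFrame

variable {T : Subgroup G2} {ε ε' : Fin 3 → Char T}

/-- Permuting the vectors of an adapted Zorn basis permutes the characters. -/
theorem perm (F : TorusFrame T ε) (σ : Equiv.Perm (Fin 3)) :
    Nonempty (TorusFrame T (fun i => ε (σ i))) := by
  obtain ⟨b', hb', hbb'⟩ := F.isZorn.exists_signed_perm (permIndex σ) (vecSign σ.sign)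
    (zornCoeff_permIndex σ)
  refine ⟨⟨b', hb', fun t k => ?_, ?_, fun a ha => ?_⟩⟩
  · rw [hbb', map_smul, F.apply_basis, smul_comm]
    obtain (_ | ⟨(_ | _), i⟩) := k <;> rfl
  · rw [← F.prod_eq_one]
    exact Equiv.prod_comp σ ε
  · obtain ⟨t, ht⟩ := F.exists_eq (fun i => a (σ.symm i))
      (by rw [← ha]; exact Equiv.prod_comp σ.symm a)
    exact ⟨t, fun i => by rw [ht, Equiv.symm_apply_apply]⟩

/-- Exchanging the two Peirce spaces of an adapted Zorn basis inverts the characters. -/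
theorem flip (F : TorusFrame T ε) : Nonempty (TorusFrame T (fun i => (ε i)⁻¹)) := by
  obtain ⟨b', hb', hbb'⟩ := F.isZorn.exists_signed_perm flipIndex (vecSign (-1))
    zornCoeff_flipIndex
  refine ⟨⟨b', hb', fun t k => ?_, ?_, fun a ha => ?_⟩⟩
  · rw [hbb', map_smul, F.apply_basis, smul_comm]
    obtain (_ | ⟨(_ | _), i⟩) := k <;> simp [flipIndex, zornWeight]
  · exact (Finset.prod_inv_distrib ε).trans (inv_eq_one.2 F.prod_eq_one)
  · obtain ⟨t, ht⟩ := F.exists_eq (fun i => (a i)⁻¹)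
      (by rw [Finset.prod_inv_distrib, ha, inv_one])
    exact ⟨t, fun i => by rw [MonoidHom.inv_apply, ht, inv_inv]⟩

theorem apply_prod (F : TorusFrame T ε) (t : T) : ∏ i, ε i t = 1 := by
  simpa using DFunLike.congr_fun F.prod_eq_one t

/-- Any two adapted Zorn bases of a torus are related by an element of its normalizer. -/
theorem exists_normalizer (F : TorusFrame T ε) (F' : TorusFrame T ε') :
    ∃ n : torusNormalizer T, ∀ i, conjChar n (ε i) = ε' i := by
  obtain ⟨g, hg⟩ := F.isZorn.exists_map_eq F'.isZorn
  have hginv : ∀ k, (g⁻¹).1 (F'.basis k) = F.basis k := fun k =>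
    g.1.symm_apply_eq.2 (hg k).symm
  have key : ∀ t t' : T, (∀ i, ε' i t' = ε i t) → g * t * g⁻¹ = (t' : G2) := by
    intro t t' h
    refine G2.ext_basis F'.basis fun k => ?_
    change g.1 (t.1.1 ((g⁻¹).1 (F'.basis k))) = t'.1.1 (F'.basis k)
    rw [hginv, F.apply_basis, map_smul, hg, F'.apply_basis, zornWeight_apply, zornWeight_apply]
    simp only [h]
  have hn : g ∈ torusNormalizer T := by
    refine Subgroup.mem_normalizer_iff.2 fun h => ⟨fun hh => ?_, fun hh => ?_⟩
    · obtain ⟨t', ht'⟩ := F'.exists_eq (fun i => ε i ⟨h, hh⟩) (F.apply_prod _)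
      rw [key ⟨h, hh⟩ t' ht']
      exact t'.2
    · obtain ⟨t, ht⟩ := F.exists_eq (fun i => ε' i ⟨_, hh⟩) (F'.apply_prod _)
      have h1 := key t ⟨_, hh⟩ fun i => (ht i).symm
      have h2 : h = t := by simpa using h1.symm
      exact h2 ▸ t.2
  refine ⟨⟨g, hn⟩, fun i => ?_⟩
  ext t'
  obtain ⟨t, ht⟩ := F.exists_eq (fun i => ε' i t') (F'.apply_prod _)
  have h1 := key t t' fun i => (ht i).symm
  rw [conjChar_apply, ← ht i]
  congr 3
  simp [← h1, mul_assoc]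

/-- The image of an adapted Zorn basis under an element of the normalizer. -/
def map (F : TorusFrame T ε) (n : torusNormalizer T) :
    TorusFrame T (fun i => conjChar n (ε i)) where
  basis := F.basis.map n.1.1
  isZorn i j := by
    simp only [Basis.map_apply, ← G2.map_mul, F.isZorn i j, map_sum, map_smul]
  apply_basis t k := by
    have h : ∀ k, (zornWeight (fun i => conjChar n (ε i)) k) = conjChar n (zornWeight ε k) := by
      rintro (_ | ⟨(_ | _), i⟩) <;> rfl
    rw [h, conjChar_apply, Basis.map_apply]
    have h1 := congrArg n.1.1 (F.apply_basis ⟨(n : G2)⁻¹ * t * n, by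
        simpa using (Subgroup.mem_normalizer_iff.1 (n⁻¹).2 t).1 t.2⟩ k)
    rw [map_smul] at h1
    rw [← h1]
    change t.1.1 (n.1.1 _) = n.1.1 (n.1.1.symm (t.1.1 (n.1.1 _)))
    rw [LinearEquiv.apply_symm_apply]
  prod_eq_one := by
    have := congrArg (conjChar n) F.prod_eq_one
    rw [Fin.prod_univ_three] at this ⊢
    exact this
  exists_eq a ha := by
    obtain ⟨t, ht⟩ := F.exists_eq a ha
    refine ⟨⟨n * t * (n : G2)⁻¹, (Subgroup.mem_normalizer_iff.1 n.2 t).1 t.2⟩, fun i => ?_⟩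
    rw [conjChar_apply, ← ht]
    congr 2
    simp [mul_assoc]

/-! ### Weights -/

/-- The exponents of `ε₁` and `ε₂` in the weights of a Zorn basis, after elimination of `ε₃`. -/
def epsilonExp : Fin 3 → ℤ × ℤ := ![(1, 0), (0, 1), (-1, -1)]

/-- The exponents of `ε₁` and `ε₂` in the weight of a vector of a Zorn basis. -/
def zornExp : ZornIndex → ℤ × ℤ
  | .inl _ => 0
  | .inr (true, i) => epsilonExp i
  | .inr (false, i) => -epsilonExp i

/-- The character of the torus with given exponents of `ε₁` and `ε₂`. -/
def latticeChar {H : Type*} [CommGroup H] (ε : Fin 3 → H) : Multiplicative (ℤ × ℤ) →* H where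
  toFun p := ε 0 ^ p.toAdd.1 * ε 1 ^ p.toAdd.2
  map_one' := by simp
  map_mul' p q := by
    simp only [toAdd_mul, Prod.fst_add, Prod.snd_add, zpow_add]
    exact mul_mul_mul_comm _ _ _ _

theorem latticeChar_ofAdd_epsilonExp {H : Type*} [CommGroup H] {ε : Fin 3 → H}
    (h : ∏ i, ε i = 1) (i : Fin 3) : latticeChar ε (.ofAdd (epsilonExp i)) = ε i := by
  fin_cases i
  · simp [latticeChar, epsilonExp]
  · simp [latticeChar, epsilonExp]
  · rw [Fin.prod_univ_three] at h
    simp only [latticeChar, epsilonExp, MonoidHom.coe_mk, OneHom.coe_mk, toAdd_ofAdd]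
    simp only [Fin.reduceFinMk, Matrix.cons_val, zpow_neg, zpow_one]
    rw [← mul_inv]
    exact inv_eq_of_mul_eq_one_right h

/-- The characters `ε₁` and `ε₂` are independent. -/
theorem latticeChar_injective (F : TorusFrame T ε) : Function.Injective (latticeChar ε) := by
  refine (injective_iff_map_eq_one _).2 fun p hp => ?_
  let c : ℂˣ := Units.mk0 2 two_ne_zero
  have hc : ∀ n : ℤ, c ^ n = 1 → n = 0 := fun n hn => by
    have h1 : ((2 : ℝ)) ^ n = 1 := by
      have h2 := congrArg (fun z : ℂˣ => ‖(z : ℂ)‖) hn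
      simpa [c] using h2
    exact (zpow_eq_one_iff_right₀ (by norm_num) (by norm_num)).1 h1
  obtain ⟨t, ht⟩ := F.exists_eq ![c, 1, c⁻¹] (by simp [Fin.prod_univ_three])
  obtain ⟨t', ht'⟩ := F.exists_eq ![1, c, c⁻¹] (by simp [Fin.prod_univ_three])
  have h1 := DFunLike.congr_fun hp t
  have h2 := DFunLike.congr_fun hp t'
  simp only [latticeChar, MonoidHom.coe_mk, OneHom.coe_mk, MonoidHom.mul_apply,
    MonoidHom.zpow_apply, MonoidHom.one_apply, ht, ht', Matrix.cons_val_zero,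
    Matrix.cons_val_one, one_zpow, mul_one, one_mul] at h1 h2
  exact congrArg Multiplicative.ofAdd (Prod.ext (hc _ h1) (hc _ h2))

theorem latticeChar_epsilonExp (F : TorusFrame T ε) (i : Fin 3) :
    latticeChar ε (.ofAdd (epsilonExp i)) = ε i :=
  latticeChar_ofAdd_epsilonExp F.prod_eq_one i

theorem latticeChar_zornExp (F : TorusFrame T ε) (k : ZornIndex) :
    latticeChar ε (.ofAdd (zornExp k)) = zornWeight ε k := by
  obtain (_ | ⟨(_ | _), i⟩) := k
  · exact map_one _
  · rw [zornExp, ofAdd_neg, map_inv, F.latticeChar_epsilonExp]; rfl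
  · exact F.latticeChar_epsilonExp i

theorem repr_apply (F : TorusFrame T ε) (t : T) (v : Octonion) (k : ZornIndex) :
    F.basis.repr ((t : G2).1 v) k = ((zornWeight ε k t : ℂˣ) : ℂ) * F.basis.repr v k := by
  have h : F.basis.coord k ∘ₗ ((t : G2).1 : Octonion →ₗ[ℂ] Octonion) =
      ((zornWeight ε k t : ℂˣ) : ℂ) • F.basis.coord k := by
    classical
    refine F.basis.ext fun l => ?_
    rw [LinearMap.comp_apply, LinearEquiv.coe_coe, F.apply_basis, map_smul, LinearMap.smul_apply,
      Basis.coord_apply, Basis.repr_self, Finsupp.single_apply]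
    split_ifs with hlk
    · rw [hlk]
    · simp
  exact LinearMap.congr_fun h v

/-- A vector has only components of the same weight as its own. -/
theorem eq_zornWeight_of_repr_ne_zero (F : TorusFrame T ε) {ψ : Char T} {v : Octonion}
    (hv : ∀ t : T, (t : G2).1 v = (ψ t : ℂ) • v) {k : ZornIndex} (hk : F.basis.repr v k ≠ 0) :
    ψ = zornWeight ε k := by
  ext t
  have h1 := F.repr_apply t v k
  rw [hv, map_smul, Finsupp.smul_apply, smul_eq_mul] at h1
  exact mul_right_cancel₀ hk h1

theorem exists_eq_zornWeight (F : TorusFrame T ε) {ψ : Char T} {v : Octonion}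
    (hv : ∀ t : T, (t : G2).1 v = (ψ t : ℂ) • v) (hv0 : v ≠ 0) :
    ∃ k, F.basis.repr v k ≠ 0 ∧ ψ = zornWeight ε k := by
  obtain ⟨k, hk⟩ : ∃ k, F.basis.repr v k ≠ 0 := by
    by_contra! h
    exact hv0 (F.basis.repr.map_eq_zero_iff.1 (Finsupp.ext h))
  exact ⟨k, hk, F.eq_zornWeight_of_repr_ne_zero hv hk⟩

theorem zornExp_inr_injective {s : Bool} {i : Fin 3} {k : ZornIndex}
    (h : zornExp k = zornExp (.inr (s, i))) : k = .inr (s, i) := by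
  revert s i k; decide +kernel

theorem zornWeight_inr_injective (F : TorusFrame T ε) {s : Bool} {i : Fin 3} {k : ZornIndex}
    (h : zornWeight ε k = zornWeight ε (.inr (s, i))) : k = .inr (s, i) := by
  rw [← F.latticeChar_zornExp, ← F.latticeChar_zornExp] at h
  exact zornExp_inr_injective (congrArg Multiplicative.toAdd (F.latticeChar_injective h))

/-- The nontrivial weight spaces of a maximal torus are lines. -/
theorem eq_smul_of_weight (F : TorusFrame T ε) {s : Bool} {i : Fin 3} {v : Octonion}
    (hv : ∀ t : T, (t : G2).1 v = ((zornWeight ε (.inr (s, i)) t : ℂˣ) : ℂ) • v) :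
    v = F.basis.repr v (.inr (s, i)) • F.basis (.inr (s, i)) := by
  conv_lhs => rw [← F.basis.sum_repr v]
  refine Finset.sum_eq_single _ (fun k _ hk => ?_) (by simp)
  by_contra h
  have h1 : F.basis.repr v k ≠ 0 := fun h0 => h (by rw [h0, zero_smul])
  exact hk (F.zornWeight_inr_injective (F.eq_zornWeight_of_repr_ne_zero hv h1).symm)

/-- The torus is its own centralizer. -/
theorem mem_of_forall_commute (F : TorusFrame T ε) {g : G2} (hg : ∀ t : T, (t : G2) * g = g * t) :
    g ∈ T := by
  have hw : ∀ (t : T) v, (t : G2).1 (g.1 v) = g.1 ((t : G2).1 v) := fun t v =>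
    LinearEquiv.congr_fun (congrArg Subtype.val (hg t)) v
  have h1 : ∀ s i, g.1 (F.basis (.inr (s, i))) =
      F.basis.repr (g.1 (F.basis (.inr (s, i)))) (.inr (s, i)) • F.basis (.inr (s, i)) :=
    fun s i => F.eq_smul_of_weight fun t => by rw [hw, F.apply_basis, map_smul]
  generalize hc : (fun s i => F.basis.repr (g.1 (F.basis (.inr (s, i)))) (.inr (s, i))) = c at *
  replace h1 : ∀ s i, g.1 (F.basis (.inr (s, i))) = c s i • F.basis (.inr (s, i)) := by
    subst hc; exact h1
  have h2 : ∀ s i, g.1 (F.basis (.inl s)) = (c s i * c (!s) i) • F.basis (.inl s) := by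
    intro s i
    rw [← F.isZorn.vec_mul_opposite s i, G2.map_mul, h1, h1, smul_mul_assoc, mul_smul_comm,
      smul_smul]
  have h3 : c true 0 * c false 0 = 1 := by
    have h := congrArg (F.basis.coord (.inl true)) (congrArg g.1 F.isZorn.sum_idem)
    rw [map_add, h2 true 0, h2 false 0, G2.map_one, ← F.isZorn.sum_idem] at h
    simpa using h
  have h4 : g.1 (F.basis (.inl true)) = F.basis (.inl true) := by
    rw [h2 true 0, Bool.not_true, h3, one_smul]
  have h5 : ∀ i, c true i ≠ 0 := fun i h0 => F.basis.ne_zero (.inr (true, i))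
    (g.1.map_eq_zero_iff.1 (by rw [h1, h0, zero_smul]))
  obtain ⟨h6, h7⟩ := F.isZorn.apply_of_apply_vec (g := g) (a := fun i => Units.mk0 _ (h5 i)) h4
    (fun i => h1 true i)
  obtain ⟨t, ht⟩ := F.exists_eq _ h6
  have : g = t := G2.ext_basis F.basis fun k => by
    rw [h7, F.apply_basis, zornWeight_apply]
    simp only [ht]
  exact this ▸ t.2

end TorusFrame

/-! ### The root system -/

/-- A matrix that satisfies the Leibniz rule with respect to the structure constants of a Zorn basis
defines a derivation. -/
theorem IsZornBasis.exists_derivation {b : Basis ZornIndex ℂ Octonion} (hb : IsZornBasis b)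
    (d : ZornIndex → ZornIndex → ℤ)
    (hd : ∀ i j l, ∑ k, zornCoeff i j k * d k l =
      ∑ k, d i k * zornCoeff k j l + ∑ k, d j k * zornCoeff i k l) :
    ∃ D ∈ derivations, ∀ i, D (b i) = ∑ k, (d i k : ℂ) • b k := by
  let D : Octonion →ₗ[ℂ] Octonion := b.constr ℂ fun i => ∑ k, (d i k : ℂ) • b k
  have hD : ∀ i, D (b i) = ∑ k, (d i k : ℂ) • b k := fun i => b.constr_basis ℂ _ i
  refine ⟨D, fun x y => ?_, hD⟩
  have h : (LinearMap.mul ℂ Octonion).compr₂ D =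
      (LinearMap.mul ℂ Octonion).comp D + (LinearMap.mul ℂ Octonion).compl₂ D := by
    refine LinearMap.ext_basis b b fun i j => ?_
    change D (b i * b j) = D (b i) * b j + b i * D (b j)
    have e1 : D (b i * b j) = ∑ l, ((∑ k, zornCoeff i j k * d k l : ℤ) : ℂ) • b l := by
      rw [hb, map_sum]
      simp only [map_smul, hD, Finset.smul_sum, smul_smul]
      rw [Finset.sum_comm]
      refine Finset.sum_congr rfl fun l _ => ?_
      rw [← Finset.sum_smul]
      push_cast; rfl
    have e2 : D (b i) * b j = ∑ l, ((∑ k, d i k * zornCoeff k j l : ℤ) : ℂ) • b l := by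
      rw [hD, Finset.sum_mul]
      simp only [smul_mul_assoc, hb _ j, Finset.smul_sum, smul_smul]
      rw [Finset.sum_comm]
      refine Finset.sum_congr rfl fun l _ => ?_
      rw [← Finset.sum_smul]
      push_cast; rfl
    have e3 : b i * D (b j) = ∑ l, ((∑ k, d j k * zornCoeff i k l : ℤ) : ℂ) • b l := by
      rw [hD, Finset.mul_sum]
      simp only [mul_smul_comm, hb i, Finset.smul_sum, smul_smul]
      rw [Finset.sum_comm]
      refine Finset.sum_congr rfl fun l _ => ?_
      rw [← Finset.sum_smul]
      push_cast; rfl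
    rw [e1, e2, e3, ← Finset.sum_add_distrib]
    refine Finset.sum_congr rfl fun l _ => ?_
    rw [hd, Int.cast_add, add_smul]
  exact LinearMap.congr_fun₂ h x y

/-- The matrix of a root vector for the short root `ε₁`. -/
def shortRootMatrix : ZornIndex → ZornIndex → ℤ
  | .inl s, .inr (true, i) => if i = 0 then (if s then 1 else -1) else 0
  | .inr (false, i), .inl s => if i = 0 then (if s then -1 else 1) else 0
  | .inr (true, i), .inr (false, j) => leviCivita 0 i j
  | _, _ => 0

/-- The matrix of a root vector for the long root `ε₁ - ε₂`. -/
def longRootMatrix : ZornIndex → ZornIndex → ℤ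
  | .inr (true, i), .inr (true, j) => if i = 1 ∧ j = 0 then 1 else 0
  | .inr (false, i), .inr (false, j) => if i = 0 ∧ j = 1 then -1 else 0
  | _, _ => 0

theorem shortRootMatrix_leibniz (i j l : ZornIndex) :
    ∑ k, zornCoeff i j k * shortRootMatrix k l =
      ∑ k, shortRootMatrix i k * zornCoeff k j l + ∑ k, shortRootMatrix j k * zornCoeff i k l := by
  revert i j l; decide +kernel

theorem longRootMatrix_leibniz (i j l : ZornIndex) :
    ∑ k, zornCoeff i j k * longRootMatrix k l =
      ∑ k, longRootMatrix i k * zornCoeff k j l + ∑ k, longRootMatrix j k * zornCoeff i k l := by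
  revert i j l; decide +kernel

/-- The exponents of `ε₁` and `ε₂` in the roots of `G₂`. -/
def rootExps : Finset (ℤ × ℤ) :=
  {(1, 0), (0, 1), (-1, -1), (-1, 0), (0, -1), (1, 1),
    (1, -1), (-1, 1), (2, 1), (-2, -1), (1, 2), (-1, -2)}

open TorusFrame

theorem mem_rootExps {r : ℤ × ℤ} : r ∈ rootExps ↔
    (∃ i, r = epsilonExp i ∨ r = -epsilonExp i) ∨
      ∃ i j, i ≠ j ∧ r = epsilonExp i - epsilonExp j := by
  constructor
  · revert r; decide +kernel
  · rintro (⟨i, rfl | rfl⟩ | ⟨i, j, hij, rfl⟩)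
    · revert i; decide +kernel
    · revert i; decide +kernel
    · revert i j; decide +kernel

/-- A difference of weights of the octonions is zero, a root or twice a short root. -/
theorem zornExp_sub_mem (k l : ZornIndex) : zornExp l - zornExp k = 0 ∨
    zornExp l - zornExp k ∈ rootExps ∨ ∃ s i, k = .inr (!s, i) ∧ l = .inr (s, i) := by
  revert k l; decide +kernel

/-- Twice a short root is not a weight of the octonions. -/
theorem two_mul_zornExp_ne (s : Bool) (i : Fin 3) (r : Bool) (k : ZornIndex) :
    zornExp (.inr (s, i)) - zornExp (.inr (!s, i)) + zornExp (.inl r) ≠ zornExp k := by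
  revert s i r k; decide +kernel

/-- The only triples of roots with sum zero whose differences are roots are those of the short roots
in `{ε₁, ε₂, ε₃}` or in `{-ε₁, -ε₂, -ε₃}`. -/
theorem eq_signed_perm_of_mem_rootExps : ∀ r₀ ∈ rootExps, ∀ r₁ ∈ rootExps,
    -(r₀ + r₁) ∈ rootExps → r₀ - r₁ ∈ rootExps → r₀ + (r₀ + r₁) ∈ rootExps →
    ∃ σ : Equiv.Perm (Fin 3),
      (r₀ = epsilonExp (σ 0) ∧ r₁ = epsilonExp (σ 1) ∧ -(r₀ + r₁) = epsilonExp (σ 2)) ∨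
      (r₀ = -epsilonExp (σ 0) ∧ r₁ = -epsilonExp (σ 1) ∧ -(r₀ + r₁) = -epsilonExp (σ 2)) := by
  decide +kernel

theorem latticeChar_ofAdd_sub {H : Type*} [CommGroup H] (ε : Fin 3 → H) (p q : ℤ × ℤ) :
    latticeChar ε (.ofAdd (p - q)) = latticeChar ε (.ofAdd p) / latticeChar ε (.ofAdd q) := by
  rw [ofAdd_sub, map_div]

namespace TorusFrame

variable {T : Subgroup G2} {ε : Fin 3 → Char T}

/-- A derivation whose matrix is homogeneous of degree `r` is a root vector. -/
theorem isRoot_of_matrix (F : TorusFrame T ε) (d : ZornIndex → ZornIndex → ℤ)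
    (hd : ∀ i j l, ∑ k, zornCoeff i j k * d k l =
      ∑ k, d i k * zornCoeff k j l + ∑ k, d j k * zornCoeff i k l)
    {r : ℤ × ℤ} (hr0 : r ≠ 0) (hr : ∀ k l, d k l ≠ 0 → zornExp l = r + zornExp k)
    (hd0 : ∃ k l, d k l ≠ 0) : IsRoot T (latticeChar ε (.ofAdd r)) := by
  obtain ⟨D, hD, hDb⟩ := F.isZorn.exists_derivation d hd
  refine ⟨fun h => hr0 (congrArg Multiplicative.toAdd
    (F.latticeChar_injective (h.trans (map_one _).symm))), D, hD, fun h => ?_, fun t => ?_⟩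
  · obtain ⟨k, l, hkl⟩ := hd0
    have h1 := congrArg (fun v => F.basis.repr v l) (hDb k)
    simp only [h, LinearMap.zero_apply, map_zero, map_sum, map_smul, Basis.repr_self] at h1
    classical
    simp only [Finsupp.coe_zero, Pi.zero_apply, Finsupp.finsetSum_apply, Finsupp.smul_apply,
      Finsupp.single_apply, smul_eq_mul, mul_ite, mul_one, mul_zero, Finset.sum_ite_eq',
      Finset.mem_univ, if_true] at h1
    exact hkl (by exact_mod_cast h1.symm)
  · have key : (t : G2).1.toLinearMap ∘ₗ D =
        ((latticeChar ε (.ofAdd r) t : ℂˣ) : ℂ) • (D ∘ₗ (t : G2).1.toLinearMap) := by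
      refine F.basis.ext fun k => ?_
      change (t : G2).1 (D (F.basis k)) =
        ((latticeChar ε (.ofAdd r) t : ℂˣ) : ℂ) • D ((t : G2).1 (F.basis k))
      rw [F.apply_basis, map_smul, hDb, map_sum, Finset.smul_sum, Finset.smul_sum]
      refine Finset.sum_congr rfl fun l _ => ?_
      rw [map_smul, F.apply_basis]
      by_cases hkl : d k l = 0
      · simp [hkl]
      · rw [← F.latticeChar_zornExp, ← F.latticeChar_zornExp, hr k l hkl, ofAdd_add, map_mul]
        simp only [smul_smul, MonoidHom.mul_apply, Units.val_mul]
        congr 1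
        ring
    rw [LinearEquiv.conj_apply]
    ext1 v
    have := LinearMap.congr_fun key ((t : G2).1.symm v)
    simpa using this

/-- The `ε_i` are roots. -/
theorem isRoot_short (F : TorusFrame T ε) (i : Fin 3) : IsRoot T (ε i) := by
  obtain ⟨F'⟩ := F.perm (Equiv.swap 0 i)
  have h := F'.isRoot_of_matrix shortRootMatrix shortRootMatrix_leibniz
    (r := epsilonExp 0) (by decide) (by decide +kernel) (by decide +kernel)
  rwa [F'.latticeChar_epsilonExp, Equiv.swap_apply_left] at h

theorem isRoot_long (F : TorusFrame T ε) {i j : Fin 3} (hij : i ≠ j) : IsRoot T (ε i / ε j) := by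
  obtain ⟨σ, rfl, rfl⟩ : ∃ σ : Equiv.Perm (Fin 3), σ 0 = i ∧ σ 1 = j := by
    revert i j; decide +kernel
  obtain ⟨F'⟩ := F.perm σ
  have h := F'.isRoot_of_matrix longRootMatrix longRootMatrix_leibniz
    (r := epsilonExp 0 - epsilonExp 1) (by decide) (by decide +kernel) (by decide +kernel)
  rwa [ofAdd_sub, map_div, F'.latticeChar_epsilonExp, F'.latticeChar_epsilonExp] at h

/-- There are no other roots than the `± ε_i` and the `ε_i - ε_j`: a root is a difference of weights
of the octonions, and twice a short root does not occur. -/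
theorem exists_mem_rootExps_of_isRoot (F : TorusFrame T ε) {χ : Char T} (hχ : IsRoot T χ) :
    ∃ r ∈ rootExps, χ = latticeChar ε (.ofAdd r) := by
  obtain ⟨hχ1, D, hD, hD0, hDt⟩ := hχ
  have hw : ∀ (k : ZornIndex) (t : T),
      (t : G2).1 (D (F.basis k)) = (((χ * zornWeight ε k) t : ℂˣ) : ℂ) • D (F.basis k) := by
    intro k t
    have h1 := LinearMap.congr_fun (hDt t) ((t : G2).1 (F.basis k))
    rw [LinearEquiv.conj_apply_apply, LinearEquiv.symm_apply_apply, LinearMap.smul_apply,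
      F.apply_basis, map_smul] at h1
    rw [h1, smul_smul]
    rfl
  obtain ⟨k, hk⟩ : ∃ k, D (F.basis k) ≠ 0 := by
    by_contra! h
    exact hD0 (F.basis.ext fun k => by rw [h, LinearMap.zero_apply])
  obtain ⟨l, -, hl⟩ := F.exists_eq_zornWeight (hw k) hk
  have hχl : χ = latticeChar ε (.ofAdd (zornExp l - zornExp k)) := by
    rw [ofAdd_sub, map_div, F.latticeChar_zornExp, F.latticeChar_zornExp, ← hl]
    exact eq_div_of_mul_eq' rfl
  rcases zornExp_sub_mem k l with h | h | ⟨s, i, rfl, rfl⟩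
  · rw [h] at hχl
    exact absurd (hχl.trans (map_one _)) hχ1
  · exact ⟨_, h, hχl⟩
  · exfalso
    -- Here `χ` is twice a short root, and `0 = D (e_s y) = e_s D y = D y`.
    have h0 : D (F.basis (.inl s)) = 0 := by
      by_contra hne
      obtain ⟨m, -, hm⟩ := F.exists_eq_zornWeight (hw (.inl s)) hne
      rw [hχl, ← F.latticeChar_zornExp, ← F.latticeChar_zornExp] at hm
      have hm := (map_mul (latticeChar ε) _ _).trans hm
      exact two_mul_zornExp_ne s i s m (congrArg Multiplicative.toAdd (F.latticeChar_injective hm))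
    have h1 : F.basis (.inl s) * F.basis (.inr (!s, i)) = 0 := by
      rw [F.isZorn]
      refine Finset.sum_eq_zero fun m _ => ?_
      obtain (m | ⟨m, j⟩) := m <;> simp [zornCoeff]
    have h2 : F.basis (.inl s) * F.basis (.inr (s, i)) = F.basis (.inr (s, i)) := by
      rw [F.isZorn, Finset.sum_eq_single (.inr (s, i))]
      · simp [zornCoeff]
      · rintro (m | ⟨m, j⟩) _ hm
        · simp [zornCoeff]
        · simp only [zornCoeff, true_and]
          rw [if_neg, Int.cast_zero, zero_smul]
          rintro ⟨rfl, rfl⟩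
          exact hm rfl
      · simp
    have h3 := hD (F.basis (.inl s)) (F.basis (.inr (!s, i)))
    rw [h1, h0, map_zero, zero_mul, zero_add, F.eq_smul_of_weight (s := s) (i := i)
      (fun t => (hw (.inr (!s, i)) t).trans (by rw [hl])), mul_smul_comm, h2,
      ← F.eq_smul_of_weight (s := s) (i := i)
      (fun t => (hw (.inr (!s, i)) t).trans (by rw [hl]))] at h3
    exact hk h3.symm

theorem isEpsilonSystem (F : TorusFrame T ε) : IsEpsilonSystem T ε := by
  refine ⟨F.prod_eq_one, fun χ => ⟨fun h => ?_, ?_⟩⟩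
  · obtain ⟨r, hr, rfl⟩ := F.exists_mem_rootExps_of_isRoot h
    rcases mem_rootExps.1 hr with ⟨i, rfl | rfl⟩ | ⟨i, j, hij, rfl⟩
    · exact .inl ⟨i, .inl (F.latticeChar_epsilonExp i)⟩
    · exact .inl ⟨i, .inr (by rw [ofAdd_neg, map_inv, F.latticeChar_epsilonExp])⟩
    · exact .inr ⟨i, j, hij, by
        rw [ofAdd_sub, map_div, F.latticeChar_epsilonExp, F.latticeChar_epsilonExp]⟩
  · rintro (⟨i, rfl | rfl⟩ | ⟨i, j, hij, rfl⟩)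
    · exact F.isRoot_short i
    · obtain ⟨F'⟩ := F.flip
      exact F'.isRoot_short i
    · exact F.isRoot_long hij

/-- The coordinates of the root system are unique up to sign and permutation. -/
theorem exists_perm_of_isEpsilonSystem (F : TorusFrame T ε) {ε' : Fin 3 → Char T}
    (h : IsEpsilonSystem T ε') :
    ∃ σ : Equiv.Perm (Fin 3), (∀ i, ε' i = ε (σ i)) ∨ ∀ i, ε' i = (ε (σ i))⁻¹ := by
  have hroot : ∀ i, ∃ r ∈ rootExps, ε' i = latticeChar ε (.ofAdd r) := fun i =>
    F.exists_mem_rootExps_of_isRoot ((h.2 _).2 (.inl ⟨i, .inl rfl⟩))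
  have hdiff : ∀ i j, i ≠ j → ∀ p q : ℤ × ℤ, ε' i = latticeChar ε (.ofAdd p) →
      ε' j = latticeChar ε (.ofAdd q) → p - q ∈ rootExps := by
    intro i j hij p q hp hq
    obtain ⟨r, hr, hr'⟩ := F.exists_mem_rootExps_of_isRoot ((h.2 _).2 (.inr ⟨i, j, hij, rfl⟩))
    rw [hp, hq] at hr'
    have h1 : latticeChar ε (.ofAdd (p - q)) = latticeChar ε (.ofAdd r) :=
      (latticeChar_ofAdd_sub ε p q).trans hr'
    have h2 : p - q = r := congrArg Multiplicative.toAdd (F.latticeChar_injective h1)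
    rwa [h2]
  obtain ⟨r₀, hr₀, h₀⟩ := hroot 0
  obtain ⟨r₁, hr₁, h₁⟩ := hroot 1
  obtain ⟨r₂, hr₂, h₂⟩ := hroot 2
  have hr₂' : r₂ = -(r₀ + r₁) := by
    have h3 : ε' 0 * ε' 1 * ε' 2 = 1 := (Fin.prod_univ_three ε').symm.trans h.1
    rw [h₀, h₁, h₂, ← map_mul, ← map_mul, ← ofAdd_add, ← ofAdd_add] at h3
    have h4 : r₀ + r₁ + r₂ = 0 :=
      congrArg Multiplicative.toAdd (F.latticeChar_injective (h3.trans (map_one _).symm))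
    exact (neg_eq_of_add_eq_zero_right h4).symm
  subst hr₂'
  obtain ⟨σ, ⟨e0, e1, e2⟩ | ⟨e0, e1, e2⟩⟩ := eq_signed_perm_of_mem_rootExps r₀ hr₀ r₁ hr₁ hr₂
    (hdiff 0 1 (by decide) _ _ h₀ h₁)
    (by simpa only [sub_neg_eq_add] using hdiff 0 2 (by decide) _ _ h₀ h₂)
  · refine ⟨σ, .inl fun i => ?_⟩
    match i with
    | 0 => exact h₀.trans (by rw [e0, F.latticeChar_epsilonExp])
    | 1 => exact h₁.trans (by rw [e1, F.latticeChar_epsilonExp])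
    | 2 => exact h₂.trans (by rw [e2, F.latticeChar_epsilonExp])
  · refine ⟨σ, .inr fun i => ?_⟩
    match i with
    | 0 => exact h₀.trans (by rw [e0, ofAdd_neg, map_inv, F.latticeChar_epsilonExp])
    | 1 => exact h₁.trans (by rw [e1, ofAdd_neg, map_inv, F.latticeChar_epsilonExp])
    | 2 => exact h₂.trans (by rw [e2, ofAdd_neg, map_inv, F.latticeChar_epsilonExp])

/-- All coordinates of the root system come from adapted Zorn bases. -/
theorem ofIsEpsilonSystem (F : TorusFrame T ε) {ε' : Fin 3 → Char T}
    (h : IsEpsilonSystem T ε') : Nonempty (TorusFrame T ε') := by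
  obtain ⟨σ, hσ | hσ⟩ := F.exists_perm_of_isEpsilonSystem h
  · rw [show ε' = _ from funext hσ]
    exact F.perm σ
  · rw [show ε' = _ from funext hσ]
    obtain ⟨F'⟩ := F.perm σ
    exact F'.flip

/-- The orbit of the second fundamental weight is the set of long roots. -/
theorem weylOrbit_eq (F : TorusFrame T ε) :
    weylOrbit (fundamentalWeightTwo ε) = {χ | ∃ i j, i ≠ j ∧ χ = ε i / ε j} := by
  refine Set.Subset.antisymm ?_ ?_
  · rintro _ ⟨n, rfl⟩
    obtain ⟨σ, hσ | hσ⟩ := F.exists_perm_of_isEpsilonSystem (F.map n).isEpsilonSystem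
    · exact ⟨σ 0, σ 2, by simp, by
        rw [fundamentalWeightTwo, conjChar_div_char, hσ, hσ]⟩
    · refine ⟨σ 2, σ 0, by simp, ?_⟩
      rw [fundamentalWeightTwo, conjChar_div_char, hσ, hσ]
      exact inv_div_inv (ε (σ 0)) (ε (σ 2))
  · rintro _ ⟨i, j, hij, rfl⟩
    obtain ⟨σ, rfl, rfl⟩ : ∃ σ : Equiv.Perm (Fin 3), σ 0 = i ∧ σ 2 = j := by
      revert i j; decide +kernel
    obtain ⟨F'⟩ := F.perm σ
    obtain ⟨n, hn⟩ := F.exists_normalizer F'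
    exact ⟨n, by rw [fundamentalWeightTwo, conjChar_div_char, hn, hn]⟩

end TorusFrame

/-! ### The Zariski topology of a Grassmannian -/

section Grassmannian

variable {k : ℕ} {V : Type} [AddCommGroup V] [Module ℂ V]

theorem Frame.isClosed_setOf_eval_eq_zero (p : MvPolynomial (Fin k × Dual ℂ V) ℂ) :
    IsClosed {v : Frame k V | MvPolynomial.eval (fun x => x.2 (v.1 x.1)) p = 0} :=
  ⟨TopologicalSpace.isOpen_generateFrom_of_mem ⟨p, rfl⟩⟩

theorem prod_apply_eq_of_mem_span {n : ℕ} {l l' : Fin n → Dual ℂ V} {v : Fin k → V}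
    (hv : LinearIndependent ℂ v)
    (h : ∀ c : Fin n → Fin k, ∏ i, l i (v (c i)) = ∏ i, l' i (v (c i)))
    {u : Fin n → V} (hu : ∀ i, u i ∈ Submodule.span ℂ (Set.range v)) :
    ∏ i, l i (u i) = ∏ i, l' i (u i) := by
  let M : (Fin n → Dual ℂ V) → MultilinearMap ℂ (fun _ : Fin n =>
      Submodule.span ℂ (Set.range v)) ℂ := fun l =>
    (MultilinearMap.mkPiAlgebra ℂ (Fin n) ℂ).compLinearMap fun i =>
      l i ∘ₗ (Submodule.span ℂ (Set.range v)).subtype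
  have hM : M l = M l' := by
    refine Basis.ext_multilinear (fun _ => Basis.span hv) fun c => ?_
    simpa [M, Basis.span_apply] using h c
  simpa [M] using congrArg (fun f => f fun i => ⟨u i, hu i⟩) hM

/-- An equality between products of linear forms, required for all tuples of vectors of a subspace,
is a closed condition on the subspace: by multilinearity it can be tested on a frame. -/
theorem Grassmannian.isClosed_setOf_prod_eq {n : ℕ} (l l' : Fin n → Dual ℂ V) :
    IsClosed {L : Grassmannian k V | ∀ u : Fin n → V, (∀ i, u i ∈ L.1) →
      ∏ i, l i (u i) = ∏ i, l' i (u i)} := by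
  refine isClosed_coinduced.2 ?_
  have h : Frame.span ⁻¹' {L : Grassmannian k V | ∀ u : Fin n → V, (∀ i, u i ∈ L.1) →
      ∏ i, l i (u i) = ∏ i, l' i (u i)} = ⋂ c : Fin n → Fin k, {v : Frame k V |
        MvPolynomial.eval (fun x : Fin k × Dual ℂ V => x.2 (v.1 x.1))
          (∏ i, MvPolynomial.X (c i, l i) - ∏ i, MvPolynomial.X (c i, l' i)) = 0} := by
    ext v
    simp only [Set.mem_preimage, Set.mem_ofPred_eq, Set.mem_iInter, map_sub, map_prod,
      MvPolynomial.eval_X, sub_eq_zero]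
    refine ⟨fun h c => h _ fun i => Submodule.subset_span ⟨c i, rfl⟩, fun h u hu => ?_⟩
    exact prod_apply_eq_of_mem_span v.2 h hu
  rw [h]
  exact isClosed_iInter fun c => Frame.isClosed_setOf_eval_eq_zero _

/-- A frame depending polynomially on a parameter. -/
def IsPolynomialCurve (f : ℂ → Frame k V) : Prop :=
  ∀ (i : Fin k) (l : Dual ℂ V), ∃ q : Polynomial ℂ, ∀ s, l ((f s).1 i) = q.eval s

namespace IsPolynomialCurve

variable {f : ℂ → Frame k V} (hf : IsPolynomialCurve f)
include hf

/-- A polynomial curve that meets an open set leaves it for finitely many parameters only. -/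
theorem finite_setOf_notMem {U : Set (Frame k V)} (hU : IsOpen U) {s₀ : ℂ} (h : f s₀ ∈ U) :
    {s | f s ∉ U}.Finite := by
  induction hU with
  | basic U hU =>
    obtain ⟨p, rfl⟩ := hU
    choose q hq using hf
    have hp : ∀ s, MvPolynomial.eval (fun x : Fin k × Dual ℂ V => x.2 ((f s).1 x.1)) p =
        (MvPolynomial.aeval (fun x : Fin k × Dual ℂ V => q x.1 x.2) p).eval s := by
      intro s
      rw [← Polynomial.coe_evalRingHom, MvPolynomial.aeval_def, MvPolynomial.hom_eval₂]
      simp only [hq]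
      rw [← MvPolynomial.eval₂_id]
      congr 1
      ext c
      simp
    set Q := MvPolynomial.aeval (fun x : Fin k × Dual ℂ V => q x.1 x.2) p with hQ
    have hQ0 : Q ≠ 0 := by
      rintro h0
      apply h
      rw [hp, h0, Polynomial.eval_zero]
    refine (Q.roots.toFinset.finite_toSet).subset fun s hs => ?_
    simp only [Set.mem_ofPred_eq, hp, not_not] at hs
    simpa [hQ0] using hs
  | univ => simp
  | inter U₁ U₂ _ _ h₁ h₂ =>
    refine ((h₁ h.1).union (h₂ h.2)).subset fun s hs => ?_
    by_contra hcon
    simp only [Set.mem_union, Set.mem_ofPred_eq, not_or, not_not] at hcon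
    exact hs hcon
  | sUnion S _ ih =>
    obtain ⟨U, hUS, hU⟩ := h
    exact (ih U hUS hU).subset fun s hs hsU => hs ⟨U, hUS, hsU⟩

theorem finite_setOf_span_notMem {U : Set (Grassmannian k V)} (hU : IsOpen U) {s₀ : ℂ}
    (h : (f s₀).span ∈ U) : {s | (f s).span ∉ U}.Finite :=
  hf.finite_setOf_notMem (isOpen_coinduced.1 hU) h

/-- The closure of a set that contains all but finitely many points of a polynomial curve contains
the whole curve. -/
theorem span_mem_closure {Z : Set (Grassmannian k V)} (hZ : {s | (f s).span ∉ Z}.Finite) (s₀ : ℂ) :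
    (f s₀).span ∈ closure Z := by
  refine mem_closure_iff.2 fun U hU hs₀ => ?_
  obtain ⟨s, hs⟩ := ((hf.finite_setOf_span_notMem hU hs₀).union hZ).exists_notMem
  simp only [Set.mem_union, Set.mem_ofPred_eq, not_or, not_not] at hs
  exact ⟨_, hs⟩

theorem isIrreducible_image {S : Set ℂ} (hS : Sᶜ.Finite) :
    IsIrreducible ((fun s => (f s).span) '' S) := by
  refine ⟨?_, ?_⟩
  · obtain ⟨s, hs⟩ := hS.exists_notMem
    exact ⟨_, s, not_not.1 hs, rfl⟩
  · rintro U₁ U₂ hU₁ hU₂ ⟨_, ⟨s₁, _, rfl⟩, h₁⟩ ⟨_, ⟨s₂, _, rfl⟩, h₂⟩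
    obtain ⟨s, hs⟩ := ((hS.union (hf.finite_setOf_span_notMem hU₁ h₁)).union
      (hf.finite_setOf_span_notMem hU₂ h₂)).exists_notMem
    simp only [Set.mem_union, Set.mem_compl_iff, Set.mem_ofPred_eq, not_or, not_not] at hs
    exact ⟨_, ⟨s, hs.1.1, rfl⟩, hs.1.2, hs.2⟩

end IsPolynomialCurve

end Grassmannian

/-! ### The action on the Grassmannian -/

theorem smul_val (g : G2 × G2) (L : Gr) : (g • L).1 =
    L.1.map (LinearEquiv.prodCongr (g.1 : Octonion ≃ₗ[ℂ] Octonion)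
      (g.2 : Octonion ≃ₗ[ℂ] Octonion) : (Octonion × Octonion) →ₗ[ℂ] (Octonion × Octonion)) := rfl

theorem mem_smul_iff (g : G2 × G2) (L : Gr) (u : Octonion × Octonion) :
    u ∈ (g • L).1 ↔ ((g.1⁻¹).1 u.1, (g.2⁻¹).1 u.2) ∈ L.1 := by
  rw [smul_val]
  exact Submodule.mem_map_equiv (e := LinearEquiv.prodCongr (g.1 : Octonion ≃ₗ[ℂ] Octonion)
    (g.2 : Octonion ≃ₗ[ℂ] Octonion)) L.1

theorem smul_graphPoint (g h : G2) (x : G2) :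
    (g, h) • graphPoint x = graphPoint (h * x * g⁻¹) := by
  refine Subtype.ext (Submodule.ext fun u => ?_)
  rw [mem_smul_iff]
  change (h⁻¹).1 u.2 = x.1 ((g⁻¹).1 u.1) ↔ u.2 = h.1 (x.1 ((g⁻¹).1 u.1))
  exact h.1.symm_apply_eq

theorem graphPoint_injective : Function.Injective graphPoint := by
  intro g h hgh
  refine Subtype.ext (LinearEquiv.ext fun x => ?_)
  have h1 : (x, g.1 x) ∈ (graphPoint g).1 := rfl
  rw [hgh] at h1
  exact h1

theorem continuous_smul_gr (g : G2 × G2) : Continuous fun L : Gr => g • L := by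
  let e := LinearEquiv.prodCongr (g.1 : Octonion ≃ₗ[ℂ] Octonion) (g.2 : Octonion ≃ₗ[ℂ] Octonion)
  let A : Frame 8 (Octonion × Octonion) → Frame 8 (Octonion × Octonion) := fun v =>
    ⟨fun i => e (v.1 i), v.2.map' e.toLinearMap e.ker⟩
  have hA : Continuous A := by
    refine continuous_generateFrom_iff.2 ?_
    rintro _ ⟨p, rfl⟩
    refine TopologicalSpace.isOpen_generateFrom_of_mem
      ⟨MvPolynomial.rename (fun x => (x.1, x.2 ∘ₗ e.toLinearMap)) p, ?_⟩
    ext v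
    rw [Set.mem_preimage, Set.mem_ofPred_eq, Set.mem_ofPred_eq, MvPolynomial.eval_rename]
    rfl
  refine continuous_coinduced_dom.2 ?_
  have h : (fun L : Gr => g • L) ∘ Frame.span = Frame.span ∘ A := by
    funext v
    refine Subtype.ext ?_
    change Submodule.map e.toLinearMap (Submodule.span ℂ (Set.range v.1)) = Submodule.span ℂ _
    rw [Submodule.map_span, ← Set.range_comp]
    rfl
  rw [h]
  exact continuous_coinduced_rng.comp hA

/-! ### The toric surface in coordinates -/

/-- The subspaces of `𝕆 ⊕ 𝕆` compatible with the decomposition of `𝕆` given by a basis `b`: the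
direct sum of the lines spanned by the vectors `(α k • b k, β k • b k)`, given here by its
equations. -/
def pairSubmodule (b : Basis ZornIndex ℂ Octonion) (α β : ZornIndex → ℂ) :
    Submodule ℂ (Octonion × Octonion) where
  carrier := {u | ∀ k, β k * b.repr u.1 k = α k * b.repr u.2 k}
  zero_mem' := by simp
  add_mem' := fun {u v} hu hv k => by
    simp only [Prod.fst_add, Prod.snd_add, map_add, Finsupp.add_apply, mul_add, hu k, hv k]
  smul_mem' := fun c u hu k => by
    simp only [Prod.smul_fst, Prod.smul_snd, map_smul, Finsupp.smul_apply, smul_eq_mul]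
    linear_combination c * hu k

section

variable {b : Basis ZornIndex ℂ Octonion} {α β α' β' : ZornIndex → ℂ}

theorem mem_pairSubmodule {u : Octonion × Octonion} :
    u ∈ pairSubmodule b α β ↔ ∀ k, β k * b.repr u.1 k = α k * b.repr u.2 k := Iff.rfl

theorem pair_mem_pairSubmodule (k : ZornIndex) :
    (α k • b k, β k • b k) ∈ pairSubmodule b α β := by
  classical
  intro l
  simp only [map_smul, Basis.repr_self, Finsupp.smul_apply, Finsupp.single_apply, smul_eq_mul]
  split_ifs with h
  · subst h; ring
  · simp

theorem pairSubmodule_le (h : ∀ k, α k ≠ 0 ∨ β k ≠ 0) (h' : ∀ k, α k * β' k = β k * α' k) :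
    pairSubmodule b α β ≤ pairSubmodule b α' β' := by
  intro u hu k
  have h1 := hu k
  rcases h k with h0 | h0
  · refine mul_left_cancel₀ h0 ?_
    linear_combination (α' k) * h1 + b.repr u.1 k * h' k
  · refine mul_left_cancel₀ h0 ?_
    linear_combination (β' k) * h1 + b.repr u.2 k * h' k

theorem pairSubmodule_congr (h : ∀ k, α k ≠ 0 ∨ β k ≠ 0) (h₂ : ∀ k, α' k ≠ 0 ∨ β' k ≠ 0)
    (h' : ∀ k, α k * β' k = β k * α' k) : pairSubmodule b α β = pairSubmodule b α' β' :=
  le_antisymm (pairSubmodule_le h h')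
    (pairSubmodule_le h₂ fun k => by linear_combination -h' k)

/-- An enumeration of the indices of a Zorn basis. -/
def zornEnum : Fin 8 ≃ ZornIndex := (Fintype.equivFinOfCardEq (by decide)).symm

/-- The frame of a subspace `pairSubmodule b α β`. -/
def pairFrame (b : Basis ZornIndex ℂ Octonion) (h : ∀ k, α k ≠ 0 ∨ β k ≠ 0) :
    Frame 8 (Octonion × Octonion) :=
  ⟨fun i => (α (zornEnum i) • b (zornEnum i), β (zornEnum i) • b (zornEnum i)), by
    refine LinearIndependent.comp (v := fun k => (α k • b k, β k • b k)) ?_ _ zornEnum.injective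
    rw [Fintype.linearIndependent_iff]
    intro g hg k
    have h1 := congrArg Prod.fst hg
    have h2 := congrArg Prod.snd hg
    simp only [Prod.fst_sum, Prod.snd_sum, Prod.smul_mk, smul_smul, Prod.fst_zero,
      Prod.snd_zero] at h1 h2
    have h3 := Fintype.linearIndependent_iff.1 b.linearIndependent _ h1 k
    have h4 := Fintype.linearIndependent_iff.1 b.linearIndependent _ h2 k
    rcases h k with h0 | h0
    · exact (mul_eq_zero.1 h3).resolve_right h0
    · exact (mul_eq_zero.1 h4).resolve_right h0⟩

theorem span_pairFrame (h : ∀ k, α k ≠ 0 ∨ β k ≠ 0) :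
    (pairFrame b h).span.1 = pairSubmodule b α β := by
  change Submodule.span ℂ _ = _
  refine le_antisymm (Submodule.span_le.2 ?_) fun u hu => ?_
  · rintro _ ⟨i, rfl⟩
    exact pair_mem_pairSubmodule _
  · have hc : ∀ k, ∃ c : ℂ, b.repr u.1 k = c * α k ∧ b.repr u.2 k = c * β k := by
      intro k
      have h1 := hu k
      rcases h k with h0 | h0
      · refine ⟨b.repr u.1 k / α k, by field_simp, ?_⟩
        rw [div_mul_eq_mul_div, eq_div_iff h0]
        linear_combination -h1
      · refine ⟨b.repr u.2 k / β k, ?_, by field_simp⟩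
        rw [div_mul_eq_mul_div, eq_div_iff h0]
        linear_combination h1
    choose c hc1 hc2 using hc
    have hu' : u = ∑ k, c k • (α k • b k, β k • b k) := by
      refine Prod.ext ?_ ?_
      · rw [Prod.fst_sum, ← b.sum_repr u.1]
        exact Finset.sum_congr rfl fun k _ => by rw [hc1, mul_smul]; rfl
      · rw [Prod.snd_sum, ← b.sum_repr u.2]
        exact Finset.sum_congr rfl fun k _ => by rw [hc2, mul_smul]; rfl
    rw [hu']
    refine Submodule.sum_mem _ fun k _ => Submodule.smul_mem _ _ (Submodule.subset_span
      ⟨zornEnum.symm k, ?_⟩)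
    simp [pairFrame]

/-- A subspace whose projection to each `b k ⊕ b k` has dimension at most one is one of the
subspaces `pairSubmodule b α β`. -/
theorem exists_eq_pairSubmodule (L : Gr) (hL : ∀ k, ∀ u ∈ L.1, ∀ v ∈ L.1,
      b.repr u.1 k * b.repr v.2 k = b.repr u.2 k * b.repr v.1 k) :
    ∃ α β : ZornIndex → ℂ, (∀ k, α k ≠ 0 ∨ β k ≠ 0) ∧ L.1 = pairSubmodule b α β := by
  have hex : ∀ k, ∃ x : ℂ × ℂ, (x.1 ≠ 0 ∨ x.2 ≠ 0) ∧
      ∀ u ∈ L.1, x.2 * b.repr u.1 k = x.1 * b.repr u.2 k := by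
    intro k
    by_cases h : ∃ v ∈ L.1, b.repr v.1 k ≠ 0 ∨ b.repr v.2 k ≠ 0
    · obtain ⟨v, hv, hv0⟩ := h
      exact ⟨(b.repr v.1 k, b.repr v.2 k), hv0, fun u hu => by
        linear_combination hL k u hu v hv⟩
    · push Not at h
      exact ⟨(1, 0), by simp, fun u hu => by simp [h u hu]⟩
  choose x hx0 hx using hex
  refine ⟨fun k => (x k).1, fun k => (x k).2, hx0, ?_⟩
  refine Submodule.eq_of_le_of_finrank_eq (fun u hu k => hx k u hu) ?_
  rw [L.2, ← span_pairFrame hx0, (pairFrame b hx0).span.2]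

/-- Write `e_s`, `x_i` and `y_i` for the vectors of a Zorn basis with indices `.inl s`,
`.inr (true, i)` and `.inr (false, i)`. The homogeneous coordinates `[a i : c i]` of three lines
`L_i` in `x_i ⊕ x_i` determine a subspace of `𝕆 ⊕ 𝕆`: it is the sum of the `L_i`, of the lines with
coordinates `[c i : a i]` in `y_i ⊕ y_i`, and of the diagonals in `e_s ⊕ e_s`. -/
def toricCoord (a c : Fin 3 → ℂ) : ZornIndex → ℂ
  | .inl _ => 1
  | .inr (true, i) => a i
  | .inr (false, i) => c i

/-- The subspace with homogeneous coordinates `[a i : c i]`. -/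
def toricSubmodule (b : Basis ZornIndex ℂ Octonion) (a c : Fin 3 → ℂ) :
    Submodule ℂ (Octonion × Octonion) :=
  pairSubmodule b (toricCoord a c) (toricCoord c a)

variable {a c a' c' : Fin 3 → ℂ}

theorem toricCoord_ne_zero (h : ∀ i, a i ≠ 0 ∨ c i ≠ 0) (k : ZornIndex) :
    toricCoord a c k ≠ 0 ∨ toricCoord c a k ≠ 0 := by
  obtain (_ | ⟨(_ | _), i⟩) := k
  · simp [toricCoord]
  · exact (h i).symm
  · exact h i

theorem toricSubmodule_congr (h : ∀ i, a i ≠ 0 ∨ c i ≠ 0) (h₂ : ∀ i, a' i ≠ 0 ∨ c' i ≠ 0)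
    (h' : ∀ i, a i * c' i = c i * a' i) : toricSubmodule b a c = toricSubmodule b a' c' := by
  refine pairSubmodule_congr (toricCoord_ne_zero h) (toricCoord_ne_zero h₂) ?_
  rintro (_ | ⟨(_ | _), i⟩)
  · rfl
  · exact (h' i).symm
  · exact h' i

theorem toric_vec_mem (i : Fin 3) :
    (a i • b (.inr (true, i)), c i • b (.inr (true, i))) ∈ toricSubmodule b a c :=
  pair_mem_pairSubmodule (α := toricCoord a c) (β := toricCoord c a) (.inr (true, i))

theorem apply_vec_of_mem {u : Octonion × Octonion} (hu : u ∈ toricSubmodule b a c) (i : Fin 3) :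
    c i * b.repr u.1 (.inr (true, i)) = a i * b.repr u.2 (.inr (true, i)) :=
  hu (.inr (true, i))

/-- The homogeneous coordinates of a toric subspace are well defined. -/
theorem toricSubmodule_inj (h : toricSubmodule b a c = toricSubmodule b a' c') (i : Fin 3) :
    c' i * a i = a' i * c i := by
  have h1 := toric_vec_mem (b := b) (a := a) (c := c) i
  rw [h] at h1
  simpa using apply_vec_of_mem h1 i

/-- The frame of a toric subspace. -/
def toricFrame (b : Basis ZornIndex ℂ Octonion) (h : ∀ i, a i ≠ 0 ∨ c i ≠ 0) :
    Frame 8 (Octonion × Octonion) := pairFrame b (toricCoord_ne_zero h)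

theorem span_toricFrame (h : ∀ i, a i ≠ 0 ∨ c i ≠ 0) :
    (toricFrame b h).span.1 = toricSubmodule b a c := span_pairFrame _

/-- If the homogeneous coordinates are polynomials in a parameter, then so is the frame. -/
theorem isPolynomialCurve_toricFrame {p q : Fin 3 → Polynomial ℂ}
    (h : ∀ s i, (p i).eval s ≠ 0 ∨ (q i).eval s ≠ 0) :
    IsPolynomialCurve fun s => toricFrame b (h s) := by
  have hcoord : ∀ (p q : Fin 3 → Polynomial ℂ) (k : ZornIndex), ∃ r : Polynomial ℂ, ∀ s,
      toricCoord (fun i => (p i).eval s) (fun i => (q i).eval s) k = r.eval s := by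
    rintro p q (_ | ⟨(_ | _), i⟩)
    · exact ⟨1, fun s => by simp [toricCoord]⟩
    · exact ⟨q i, fun s => rfl⟩
    · exact ⟨p i, fun s => rfl⟩
  intro j l
  obtain ⟨r₁, h₁⟩ := hcoord p q (zornEnum j)
  obtain ⟨r₂, h₂⟩ := hcoord q p (zornEnum j)
  refine ⟨r₁ * Polynomial.C (l (b (zornEnum j), 0)) + r₂ * Polynomial.C (l (0, b (zornEnum j))),
    fun s => ?_⟩
  change l (toricCoord (fun i => (p i).eval s) (fun i => (q i).eval s) (zornEnum j) •
    b (zornEnum j), toricCoord (fun i => (q i).eval s) (fun i => (p i).eval s) (zornEnum j) •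
    b (zornEnum j)) = _
  rw [h₁, h₂]
  have : (r₁.eval s • b (zornEnum j), r₂.eval s • b (zornEnum j)) =
      r₁.eval s • (b (zornEnum j), (0 : Octonion)) +
      r₂.eval s • ((0 : Octonion), b (zornEnum j)) := by simp
  rw [this, map_add, map_smul, map_smul]
  simp

/-- The surface `a₁ a₂ a₃ = c₁ c₂ c₃` in `ℙ¹ × ℙ¹ × ℙ¹`, a del Pezzo surface of degree six, embedded
in the Grassmannian. -/
def toricSurface (b : Basis ZornIndex ℂ Octonion) : Set Gr :=
  {L | ∃ a c : Fin 3 → ℂ, (∀ i, a i ≠ 0 ∨ c i ≠ 0) ∧ ∏ i, a i = ∏ i, c i ∧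
    L.1 = toricSubmodule b a c}

/-- One of the six lines `c i = a j = 0` on the surface. -/
def toricDivisor (b : Basis ZornIndex ℂ Octonion) (i j : Fin 3) : Set Gr :=
  {L | ∃ a c : Fin 3 → ℂ, (∀ k, a k ≠ 0 ∨ c k ≠ 0) ∧ c i = 0 ∧ a j = 0 ∧
    L.1 = toricSubmodule b a c}

/-- The open torus orbit in the surface. -/
def toricOrbit (b : Basis ZornIndex ℂ Octonion) : Set Gr :=
  {L | ∃ a c : Fin 3 → ℂ, (∀ i, a i ≠ 0) ∧ (∀ i, c i ≠ 0) ∧ ∏ i, a i = ∏ i, c i ∧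
    L.1 = toricSubmodule b a c}

/-- The coordinate of the first component with respect to a basis vector, as a linear form. -/
def coordFst (b : Basis ZornIndex ℂ Octonion) (k : ZornIndex) : Dual ℂ (Octonion × Octonion) :=
  b.coord k ∘ₗ LinearMap.fst ℂ _ _

/-- The coordinate of the second component with respect to a basis vector, as a linear form. -/
def coordSnd (b : Basis ZornIndex ℂ Octonion) (k : ZornIndex) : Dual ℂ (Octonion × Octonion) :=
  b.coord k ∘ₗ LinearMap.snd ℂ _ _

theorem coordFst_apply (k : ZornIndex) (u : Octonion × Octonion) :
    coordFst b k u = b.repr u.1 k := rfl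

theorem coordSnd_apply (k : ZornIndex) (u : Octonion × Octonion) :
    coordSnd b k u = b.repr u.2 k := rfl

theorem isClosed_linear (l l' : Dual ℂ (Octonion × Octonion)) :
    IsClosed {L : Gr | ∀ u ∈ L.1, l u = l' u} := by
  convert Grassmannian.isClosed_setOf_prod_eq (k := 8) (V := Octonion × Octonion) ![l] ![l'] using 1
  ext L
  simp only [Set.mem_ofPred_eq, Fin.prod_univ_one, Matrix.cons_val_zero]
  exact ⟨fun h u hu => h _ (hu 0), fun h u hu => h (fun _ => u) fun _ => hu⟩

theorem isClosed_bilinear (l₁ l₂ l₁' l₂' : Dual ℂ (Octonion × Octonion)) :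
    IsClosed {L : Gr | ∀ u ∈ L.1, ∀ v ∈ L.1, l₁ u * l₂ v = l₁' u * l₂' v} := by
  convert Grassmannian.isClosed_setOf_prod_eq (k := 8) (V := Octonion × Octonion)
    ![l₁, l₂] ![l₁', l₂'] using 1
  ext L
  simp only [Set.mem_ofPred_eq, Fin.prod_univ_two, Matrix.cons_val_zero, Matrix.cons_val_one]
  refine ⟨fun h u hu => h _ (hu 0) _ (hu 1), fun h u hu v hv => h ![u, v] fun i => ?_⟩
  fin_cases i
  · exact hu
  · exact hv

theorem isClosed_trilinear (l l' : Fin 3 → Dual ℂ (Octonion × Octonion)) :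
    IsClosed {L : Gr | ∀ u ∈ L.1, ∀ v ∈ L.1, ∀ w ∈ L.1,
      l 0 u * l 1 v * l 2 w = l' 0 u * l' 1 v * l' 2 w} := by
  convert Grassmannian.isClosed_setOf_prod_eq (k := 8) (V := Octonion × Octonion) l l' using 1
  ext L
  simp only [Set.mem_ofPred_eq, Fin.prod_univ_three]
  refine ⟨fun h u hu => h _ (hu 0) _ (hu 1) _ (hu 2),
    fun h u hu v hv w hw => h ![u, v, w] fun i => ?_⟩
  fin_cases i
  · exact hu
  · exact hv
  · exact hw

/-- The surface is cut out by multilinear equations: those of the diagonals in `e_s ⊕ e_s`, the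
condition that the projections to the other summands are at most one-dimensional, isotropy for the
difference of the norms of the two components, and `a₁ a₂ a₃ = c₁ c₂ c₃`. -/
theorem mem_toricSurface_iff (L : Gr) : L ∈ toricSurface b ↔
    (∀ s, ∀ u ∈ L.1, coordFst b (.inl s) u = coordSnd b (.inl s) u) ∧
    (∀ x, ∀ u ∈ L.1, ∀ v ∈ L.1, coordFst b (.inr x) u * coordSnd b (.inr x) v =
      coordSnd b (.inr x) u * coordFst b (.inr x) v) ∧
    (∀ i, ∀ u ∈ L.1, ∀ v ∈ L.1, coordFst b (.inr (true, i)) u * coordFst b (.inr (false, i)) v =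
      coordSnd b (.inr (true, i)) u * coordSnd b (.inr (false, i)) v) ∧
    (∀ u ∈ L.1, ∀ v ∈ L.1, ∀ w ∈ L.1,
      coordFst b (.inr (true, 0)) u * coordFst b (.inr (true, 1)) v *
        coordFst b (.inr (true, 2)) w =
      coordSnd b (.inr (true, 0)) u * coordSnd b (.inr (true, 1)) v *
        coordSnd b (.inr (true, 2)) w) := by
  simp only [coordFst_apply, coordSnd_apply]
  constructor
  · rintro ⟨a, c, h0, hac, hL⟩
    rw [hL]
    have hx : ∀ u ∈ toricSubmodule b a c, ∀ i,
        c i * b.repr u.1 (.inr (true, i)) = a i * b.repr u.2 (.inr (true, i)) :=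
      fun u hu i => hu (.inr (true, i))
    have hy : ∀ u ∈ toricSubmodule b a c, ∀ i,
        a i * b.repr u.1 (.inr (false, i)) = c i * b.repr u.2 (.inr (false, i)) :=
      fun u hu i => hu (.inr (false, i))
    refine ⟨fun s u hu => by simpa [toricCoord] using hu (.inl s), ?_, ?_, ?_⟩
    · rintro x u hu v hv
      have h1 := hu (.inr x)
      have h2 := hv (.inr x)
      rcases toricCoord_ne_zero h0 (.inr x) with h | h
      · refine mul_left_cancel₀ h ?_
        linear_combination b.repr v.1 (.inr x) * h1 - b.repr u.1 (.inr x) * h2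
      · refine mul_left_cancel₀ h ?_
        linear_combination b.repr v.2 (.inr x) * h1 - b.repr u.2 (.inr x) * h2
    · intro i u hu v hv
      have h1 := hx u hu i
      have h2 := hy v hv i
      rcases h0 i with h | h
      · refine mul_left_cancel₀ h ?_
        linear_combination b.repr u.1 (.inr (true, i)) * h2 +
          b.repr v.2 (.inr (false, i)) * h1
      · refine mul_left_cancel₀ h ?_
        linear_combination b.repr v.1 (.inr (false, i)) * h1 +
          b.repr u.2 (.inr (true, i)) * h2
    · intro u hu v hv w hw
      have h1 := hx u hu 0
      have h2 := hx v hv 1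
      have h3 := hx w hw 2
      rw [Fin.prod_univ_three, Fin.prod_univ_three] at hac
      generalize b.repr u.1 (.inr (true, 0)) = u1, b.repr u.2 (.inr (true, 0)) = u2,
        b.repr v.1 (.inr (true, 1)) = v1, b.repr v.2 (.inr (true, 1)) = v2,
        b.repr w.1 (.inr (true, 2)) = w1, b.repr w.2 (.inr (true, 2)) = w2 at h1 h2 h3 ⊢
      by_cases ha : a 0 * a 1 * a 2 = 0
      · have hc : c 0 * c 1 * c 2 = 0 := hac ▸ ha
        have e1 : u1 * v1 * w1 = 0 := by
          rcases mul_eq_zero.1 ha with ha | ha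
          · rcases mul_eq_zero.1 ha with ha | ha
            · have := (h0 0).resolve_left (not_not.2 ha)
              rw [ha, zero_mul] at h1
              rw [(mul_eq_zero.1 h1).resolve_left this]; ring
            · have := (h0 1).resolve_left (not_not.2 ha)
              rw [ha, zero_mul] at h2
              rw [(mul_eq_zero.1 h2).resolve_left this]; ring
          · have := (h0 2).resolve_left (not_not.2 ha)
            rw [ha, zero_mul] at h3
            rw [(mul_eq_zero.1 h3).resolve_left this]; ring
        have e2 : u2 * v2 * w2 = 0 := by
          rcases mul_eq_zero.1 hc with hc | hc
          · rcases mul_eq_zero.1 hc with hc | hc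
            · have := (h0 0).resolve_right (not_not.2 hc)
              rw [hc, zero_mul] at h1
              rw [(mul_eq_zero.1 h1.symm).resolve_left this]; ring
            · have := (h0 1).resolve_right (not_not.2 hc)
              rw [hc, zero_mul] at h2
              rw [(mul_eq_zero.1 h2.symm).resolve_left this]; ring
          · have := (h0 2).resolve_right (not_not.2 hc)
            rw [hc, zero_mul] at h3
            rw [(mul_eq_zero.1 h3.symm).resolve_left this]; ring
        rw [e1, e2]
      · refine mul_left_cancel₀ ha ?_
        have e : (c 0 * u1) * (c 1 * v1) * (c 2 * w1) = (a 0 * u2) * (a 1 * v2) * (a 2 * w2) := by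
          rw [h1, h2, h3]
        linear_combination e + u1 * v1 * w1 * hac
  · rintro ⟨h1, h2, h3, h4⟩
    obtain ⟨α, β, h0, hL⟩ := exists_eq_pairSubmodule (b := b) L (by
      rintro (s | x) u hu v hv
      · rw [h1 s u hu, h1 s v hv]
      · exact h2 x u hu v hv)
    have hmem : ∀ k, (α k • b k, β k • b k) ∈ L.1 := fun k => hL ▸ pair_mem_pairSubmodule k
    have e1 : ∀ s, α (.inl s) = β (.inl s) := fun s => by simpa using h1 s _ (hmem (.inl s))
    have e3 : ∀ i, α (.inr (true, i)) * α (.inr (false, i)) =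
        β (.inr (true, i)) * β (.inr (false, i)) := fun i => by
      simpa using h3 i _ (hmem (.inr (true, i))) _ (hmem (.inr (false, i)))
    have e4 : α (.inr (true, 0)) * α (.inr (true, 1)) * α (.inr (true, 2)) =
        β (.inr (true, 0)) * β (.inr (true, 1)) * β (.inr (true, 2)) := by
      simpa using h4 _ (hmem (.inr (true, 0))) _ (hmem (.inr (true, 1))) _ (hmem (.inr (true, 2)))
    refine ⟨fun i => α (.inr (true, i)), fun i => β (.inr (true, i)), fun i => h0 _, ?_, ?_⟩
    · rw [Fin.prod_univ_three, Fin.prod_univ_three, e4]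
    · rw [hL]
      refine pairSubmodule_congr h0 (toricCoord_ne_zero fun i => h0 _) ?_
      rintro (s | ⟨(_ | _), i⟩)
      · simp [toricCoord, e1]
      · simp only [toricCoord]
        rw [mul_comm, e3, mul_comm]
      · simp only [toricCoord, mul_comm]

theorem isClosed_toricSurface : IsClosed (toricSurface b) := by
  have h : toricSurface b =
      (⋂ s, {L : Gr | ∀ u ∈ L.1, coordFst b (.inl s) u = coordSnd b (.inl s) u}) ∩
      ((⋂ x, {L : Gr | ∀ u ∈ L.1, ∀ v ∈ L.1, coordFst b (.inr x) u * coordSnd b (.inr x) v =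
        coordSnd b (.inr x) u * coordFst b (.inr x) v}) ∩
      ((⋂ i, {L : Gr | ∀ u ∈ L.1, ∀ v ∈ L.1,
        coordFst b (.inr (true, i)) u * coordFst b (.inr (false, i)) v =
        coordSnd b (.inr (true, i)) u * coordSnd b (.inr (false, i)) v}) ∩
      {L : Gr | ∀ u ∈ L.1, ∀ v ∈ L.1, ∀ w ∈ L.1,
        coordFst b (.inr (true, 0)) u * coordFst b (.inr (true, 1)) v *
          coordFst b (.inr (true, 2)) w =
        coordSnd b (.inr (true, 0)) u * coordSnd b (.inr (true, 1)) v *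
          coordSnd b (.inr (true, 2)) w})) := by
    ext L
    rw [mem_toricSurface_iff]
    simp only [Set.mem_inter_iff, Set.mem_iInter, Set.mem_ofPred_eq]
  rw [h]
  exact (isClosed_iInter fun _ => isClosed_linear _ _).inter
    ((isClosed_iInter fun _ => isClosed_bilinear _ _ _ _).inter
    ((isClosed_iInter fun _ => isClosed_bilinear _ _ _ _).inter
    (isClosed_trilinear (fun i => coordFst b (.inr (true, i)))
      fun i => coordSnd b (.inr (true, i)))))

theorem toricDivisor_eq {i j : Fin 3} : toricDivisor b i j =
    toricSurface b ∩ ({L : Gr | ∀ u ∈ L.1, coordSnd b (.inr (true, i)) u = (0 : Dual ℂ _) u} ∩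
      {L : Gr | ∀ u ∈ L.1, coordFst b (.inr (true, j)) u = (0 : Dual ℂ _) u}) := by
  ext L
  constructor
  · rintro ⟨a, c, h0, hc, ha, hL⟩
    refine ⟨⟨a, c, h0, ?_, hL⟩, fun u hu => ?_, fun u hu => ?_⟩
    · rw [Finset.prod_eq_zero (Finset.mem_univ j) ha, Finset.prod_eq_zero (Finset.mem_univ i) hc]
    · rw [hL] at hu
      have h1 := apply_vec_of_mem hu i
      rw [hc, zero_mul] at h1
      exact (mul_eq_zero.1 h1.symm).resolve_left ((h0 i).resolve_right (not_not.2 hc))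
    · rw [hL] at hu
      have h1 := apply_vec_of_mem hu j
      rw [ha, zero_mul] at h1
      exact (mul_eq_zero.1 h1).resolve_left ((h0 j).resolve_left (not_not.2 ha))
  · rintro ⟨⟨a, c, h0, -, hL⟩, h1, h2⟩
    refine ⟨a, c, h0, ?_, ?_, hL⟩
    · have h3 := h1 _ (hL ▸ toric_vec_mem i)
      rw [coordSnd_apply] at h3
      simpa using h3
    · have h3 := h2 _ (hL ▸ toric_vec_mem j)
      rw [coordFst_apply] at h3
      simpa using h3

theorem isClosed_toricDivisor {i j : Fin 3} : IsClosed (toricDivisor b i j) := by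
  rw [toricDivisor_eq]
  exact isClosed_toricSurface.inter ((isClosed_linear _ _).inter (isClosed_linear _ _))

theorem toricDivisor_subset {i j : Fin 3} : toricDivisor b i j ⊆ toricSurface b := by
  rw [toricDivisor_eq]
  exact Set.inter_subset_left

end

/-! ### Torus orbits and their closures -/

theorem exists_third {i j : Fin 3} (hij : i ≠ j) :
    ∃ k, k ≠ i ∧ k ≠ j ∧ ∀ l, l = i ∨ l = j ∨ l = k := by
  revert i j; decide +kernel

/-- A triple of units with product one and prescribed value away from `i` and `j`. -/
theorem exists_prod_eq_one {i j k : Fin 3} (hij : i ≠ j) (hki : k ≠ i) (hkj : k ≠ j) (u : ℂˣ) :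
    ∃ g : Fin 3 → ℂˣ, ∏ l, g l = 1 ∧ g k = u := by
  refine ⟨fun l => if l = i then u⁻¹ else if l = j then 1 else u, ?_, by simp [hki, hkj]⟩
  rw [Fin.prod_univ_three]
  fin_cases i <;> fin_cases j <;> simp at hij ⊢

section

variable {b : Basis ZornIndex ℂ Octonion} {i j : Fin 3}

/-- The first homogeneous coordinates `a` of the point of the divisor `c i = a j = 0` whose
remaining coordinates are `[1 : s]`. -/
def divisorFst (j : Fin 3) : Fin 3 → ℂ := fun l => if l = j then 0 else 1

/-- The second homogeneous coordinates `c` of the point of the divisor `c i = a j = 0` whose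
remaining coordinates are `[1 : s]`. -/
def divisorSnd (i j : Fin 3) (s : ℂ) : Fin 3 → ℂ :=
  fun l => if l = i then 0 else if l = j then 1 else s

theorem divisorFst_ne_zero (hij : i ≠ j) (s : ℂ) (l : Fin 3) :
    divisorFst j l ≠ 0 ∨ divisorSnd i j s l ≠ 0 := by
  by_cases h : l = j
  · right
    simp [divisorSnd, h, hij.symm]
  · left
    simp [divisorFst, h]

/-- The open orbit of the divisor `c i = a j = 0`. -/
def divisorOrbit (b : Basis ZornIndex ℂ Octonion) (i j : Fin 3) : Set Gr :=
  {L | ∃ s : ℂ, s ≠ 0 ∧ L.1 = toricSubmodule b (divisorFst j) (divisorSnd i j s)}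

theorem exists_curve_divisorSnd (b : Basis ZornIndex ℂ Octonion) (hij : i ≠ j) :
    ∃ f : ℂ → Frame 8 (Octonion × Octonion), IsPolynomialCurve f ∧
      ∀ s, (f s).span.1 = toricSubmodule b (divisorFst j) (divisorSnd i j s) := by
  let p : Fin 3 → Polynomial ℂ := fun l => if l = j then 0 else 1
  let q : Fin 3 → Polynomial ℂ := fun l => if l = i then 0 else if l = j then 1 else Polynomial.X
  have hp : ∀ s, (fun l => (p l).eval s) = divisorFst j := fun s => by
    funext l; simp only [p, divisorFst]; split_ifs <;> simp
  have hq : ∀ s, (fun l => (q l).eval s) = divisorSnd i j s := fun s => by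
    funext l; simp only [q, divisorSnd]; split_ifs <;> simp
  have h : ∀ s l, (p l).eval s ≠ 0 ∨ (q l).eval s ≠ 0 := fun s l => by
    rw [congrFun (hp s) l, congrFun (hq s) l]
    exact divisorFst_ne_zero hij s l
  exact ⟨_, isPolynomialCurve_toricFrame (b := b) h, fun s => by rw [span_toricFrame, hp, hq]⟩

theorem isIrreducible_divisorOrbit (hij : i ≠ j) : IsIrreducible (divisorOrbit b i j) := by
  obtain ⟨f, hf, hfs⟩ := exists_curve_divisorSnd b hij
  have h : divisorOrbit b i j = (fun s => (f s).span) '' {0}ᶜ := by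
    ext L
    constructor
    · rintro ⟨s, hs, hL⟩
      exact ⟨s, hs, Subtype.ext ((hfs s).trans hL.symm)⟩
    · rintro ⟨s, hs, rfl⟩
      exact ⟨s, hs, hfs s⟩
  rw [h]
  exact hf.isIrreducible_image (by simp)

theorem divisorOrbit_subset (hij : i ≠ j) : divisorOrbit b i j ⊆ toricDivisor b i j := by
  rintro L ⟨s, -, hL⟩
  exact ⟨_, _, divisorFst_ne_zero hij s, by simp [divisorSnd], by simp [divisorFst], hL⟩

theorem closure_divisorOrbit (hij : i ≠ j) :
    closure (divisorOrbit b i j) = toricDivisor b i j := by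
  refine Set.Subset.antisymm
    (closure_minimal (divisorOrbit_subset hij) isClosed_toricDivisor) ?_
  rintro L ⟨a, c, h0, hc, ha, hL⟩
  obtain ⟨k, hki, hkj, hk⟩ := exists_third hij
  by_cases hak : a k = 0
  · -- the point at infinity of the divisor, in the coordinates `[s : 1]`
    let p : Fin 3 → Polynomial ℂ := fun l => if l = j then 0 else if l = i then 1 else Polynomial.X
    let q : Fin 3 → Polynomial ℂ := fun l => if l = i then 0 else 1
    have h : ∀ s l, (p l).eval s ≠ 0 ∨ (q l).eval s ≠ 0 := fun s l => by
      by_cases hl : l = i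
      · left; simp [p, hl, hij]
      · right; simp [q, hl]
    have hf := isPolynomialCurve_toricFrame (b := b) h
    have hL0 : L = (toricFrame b (h 0)).span := by
      refine Subtype.ext ?_
      rw [hL, span_toricFrame]
      refine toricSubmodule_congr h0 (h 0) fun l => ?_
      rcases hk l with rfl | rfl | rfl
      · simp [p, q, hc]
      · simp [p, q, ha]
      · simp [p, hki, hkj, hak]
    rw [hL0]
    refine hf.span_mem_closure ((Set.finite_singleton 0).subset fun s hs => ?_) 0
    by_contra hs0
    refine hs ⟨s⁻¹, inv_ne_zero hs0, ?_⟩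
    rw [span_toricFrame]
    refine toricSubmodule_congr (h s) (divisorFst_ne_zero hij _) fun l => ?_
    have hs0 : s ≠ 0 := hs0
    rcases hk l with rfl | rfl | rfl
    · simp [p, q, divisorSnd, divisorFst]
    · simp [p, q, divisorSnd, divisorFst]
    · simp [p, q, divisorSnd, divisorFst, hki, hkj, hs0]
  · obtain ⟨f, hf, hfs⟩ := exists_curve_divisorSnd b hij
    have hL0 : L = (f (c k / a k)).span := by
      refine Subtype.ext ?_
      rw [hL, hfs]
      refine toricSubmodule_congr h0 (divisorFst_ne_zero hij _) fun l => ?_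
      rcases hk l with rfl | rfl | rfl
      · simp [divisorSnd, hc]
      · simp [divisorFst, ha]
      · simp only [divisorSnd, divisorFst, hki, hkj, if_false]
        field_simp
    rw [hL0]
    refine hf.span_mem_closure ((Set.finite_singleton 0).subset fun s hs => ?_) _
    by_contra hs0
    exact hs ⟨s, hs0, hfs s⟩

/-- The translates of a point `[1 : g l]` of the open orbit by the one-parameter subgroup of the ray
`ε_i - ε_j` extend to a polynomial curve, whose value at `0` is a point of the open orbit of the
divisor `c i = a j = 0`. -/
theorem exists_curve_limit (b : Basis ZornIndex ℂ Octonion) (hij : i ≠ j) (g : Fin 3 → ℂˣ) :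
    ∃ f : ℂ → Frame 8 (Octonion × Octonion), IsPolynomialCurve f ∧
      (∀ s : ℂˣ, (f s).span.1 = toricSubmodule b 1
        (fun l => ((if l = i then s else if l = j then s⁻¹ else 1 : ℂˣ) : ℂ) * g l)) ∧
      ∀ k, k ≠ i → k ≠ j →
        (f 0).span.1 = toricSubmodule b (divisorFst j) (divisorSnd i j (g k)) := by
  let p : Fin 3 → Polynomial ℂ := fun l => if l = j then Polynomial.X else 1
  let q : Fin 3 → Polynomial ℂ := fun l =>
    if l = i then Polynomial.X * Polynomial.C (g l : ℂ) else Polynomial.C (g l : ℂ)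
  have h : ∀ s l, (p l).eval s ≠ 0 ∨ (q l).eval s ≠ 0 := fun s l => by
    by_cases hl : l = j
    · right; simp [q, hl, hij.symm]
    · left; simp [p, hl]
  refine ⟨_, isPolynomialCurve_toricFrame (b := b) h, fun s => ?_, fun k hki hkj => ?_⟩
  · rw [span_toricFrame]
    refine toricSubmodule_congr (h s) (fun l => .inl one_ne_zero) fun l => ?_
    by_cases hl : l = j
    · subst hl
      simp [p, q, hij.symm]
    · by_cases hli : l = i
      · subst hli
        simp [p, q, hl]; ring
      · simp [p, q, hl, hli]
  · rw [span_toricFrame]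
    refine toricSubmodule_congr (h 0) (divisorFst_ne_zero hij _) fun l => ?_
    obtain ⟨k', -, -, hk'⟩ := exists_third hij
    have hk : l = i ∨ l = j ∨ l = k := by
      rcases hk' k with h | h | h
      · exact absurd h hki
      · exact absurd h hkj
      · rw [h]; exact hk' l
    rcases hk with rfl | rfl | rfl
    · simp [q, divisorSnd]
    · simp [p, divisorFst]
    · simp [p, q, divisorSnd, divisorFst, hki, hkj]

theorem divisorOrbit_subset_closure (hij : i ≠ j) :
    divisorOrbit b i j ⊆ closure (toricOrbit b) := by
  rintro L ⟨z, hz, hL⟩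
  obtain ⟨k, hki, hkj, hk⟩ := exists_third hij
  obtain ⟨g, hg, hgk⟩ := exists_prod_eq_one hij hki hkj (Units.mk0 z hz)
  obtain ⟨f, hf, hfs, hf0⟩ := exists_curve_limit b hij g
  have hL0 : L = (f 0).span := Subtype.ext (by rw [hL, hf0 k hki hkj, hgk]; rfl)
  rw [hL0]
  refine hf.span_mem_closure ((Set.finite_singleton 0).subset fun s hs => ?_) 0
  by_contra hs0
  refine hs ⟨1, _, by simp, fun l => ?_, ?_, hfs (Units.mk0 s hs0)⟩
  · exact mul_ne_zero (Units.ne_zero _) (Units.ne_zero _)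
  · rw [Finset.prod_mul_distrib, ← Units.coe_prod, ← Units.coe_prod, hg]
    have : ∏ l, (if l = i then Units.mk0 s hs0 else if l = j then (Units.mk0 s hs0)⁻¹ else 1) =
        1 := by
      generalize Units.mk0 s hs0 = u
      rw [Fin.prod_univ_three]
      clear * - hij
      fin_cases i <;> fin_cases j <;> simp at hij ⊢
    rw [this]
    simp

theorem toricOrbit_subset : toricOrbit b ⊆ toricSurface b := by
  rintro L ⟨a, c, ha, -, hac, hL⟩
  exact ⟨a, c, fun i => .inl (ha i), hac, hL⟩

theorem disjoint_toricOrbit : Disjoint (toricDivisor b i j) (toricOrbit b) := by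
  refine Set.disjoint_left.2 ?_
  rintro L ⟨a, c, h0, hc, -, hL⟩ ⟨a', c', ha', hc', -, hL'⟩
  have h := toricSubmodule_inj (hL.symm.trans hL') i
  rw [hc, mul_zero] at h
  exact mul_ne_zero (hc' i) ((h0 i).resolve_right (not_not.2 hc)) h

/-- The boundary of the surface is a hexagon of lines. -/
theorem toricSurface_diff : toricSurface b \ toricOrbit b =
    ⋃ x : {x : Fin 3 × Fin 3 // x.1 ≠ x.2}, toricDivisor b x.1.1 x.1.2 := by
  ext L
  simp only [Set.mem_iUnion]
  constructor
  · rintro ⟨⟨a, c, h0, hac, hL⟩, hno⟩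
    have hex : ∃ i j, c i = 0 ∧ a j = 0 := by
      by_contra! hcon
      by_cases hc : ∃ i, c i = 0
      · obtain ⟨i, hi⟩ := hc
        have h1 : ∏ i, a i = 0 := by rw [hac, Finset.prod_eq_zero (Finset.mem_univ i) hi]
        obtain ⟨j, -, hj⟩ := Finset.prod_eq_zero_iff.1 h1
        exact hcon i j hi hj
      · push Not at hc
        refine hno ⟨a, c, fun j hj => ?_, hc, hac, hL⟩
        have h1 : ∏ i, c i = 0 := by rw [← hac, Finset.prod_eq_zero (Finset.mem_univ j) hj]
        obtain ⟨i, -, hi⟩ := Finset.prod_eq_zero_iff.1 h1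
        exact hc i hi
    obtain ⟨i, j, hi, hj⟩ := hex
    refine ⟨⟨(i, j), ?_⟩, a, c, h0, hi, hj, hL⟩
    rintro (rfl : i = j)
    exact (h0 i).elim (fun h => h hj) fun h => h hi
  · rintro ⟨⟨⟨i, j⟩, hij⟩, h⟩
    exact ⟨toricDivisor_subset h, Set.disjoint_left.1 disjoint_toricOrbit h⟩

theorem closure_toricOrbit : closure (toricOrbit b) = toricSurface b := by
  refine Set.Subset.antisymm (closure_minimal toricOrbit_subset isClosed_toricSurface) ?_
  intro L hL
  by_cases h : L ∈ toricOrbit b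
  · exact subset_closure h
  · have h1 : L ∈ toricSurface b \ toricOrbit b := ⟨hL, h⟩
    rw [toricSurface_diff, Set.mem_iUnion] at h1
    obtain ⟨⟨⟨i, j⟩, hij⟩, h1⟩ := h1
    rw [← closure_divisorOrbit hij] at h1
    exact closure_minimal (divisorOrbit_subset_closure hij) isClosed_closure h1

theorem eq_of_toricDivisor_subset {i' j' : Fin 3} (hij : i ≠ j)
    (h : toricDivisor b i j ⊆ toricDivisor b i' j') : i = i' ∧ j = j' := by
  obtain ⟨f, -, hfs⟩ := exists_curve_divisorSnd b hij
  have h1 : (f 1).span ∈ divisorOrbit b i j := ⟨1, one_ne_zero, hfs 1⟩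
  obtain ⟨a, c, h0, hc, ha, hL⟩ := h (divisorOrbit_subset hij h1)
  have h2 := toricSubmodule_inj ((hfs 1).symm.trans hL)
  constructor
  · have h3 := h2 i'
    rw [hc, zero_mul] at h3
    have h4 := (mul_eq_zero.1 h3.symm).resolve_left ((h0 i').resolve_right (not_not.2 hc))
    by_contra hne
    simp [divisorSnd, Ne.symm hne] at h4
  · have h3 := h2 j'
    rw [ha, zero_mul] at h3
    have h4 := (mul_eq_zero.1 h3).resolve_left ((h0 j').resolve_left (not_not.2 ha))
    by_contra hne
    simp [divisorFst, Ne.symm hne] at h4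

/-- The irreducible components of the hexagon are its six lines. -/
theorem maximal_irreducible_iff (D : Set Gr) :
    Maximal (fun Z => Z ⊆ (⋃ x : {x : Fin 3 × Fin 3 // x.1 ≠ x.2}, toricDivisor b x.1.1 x.1.2) ∧
      IsIrreducible Z) D ↔ ∃ i j, i ≠ j ∧ D = toricDivisor b i j := by
  classical
  have hirr : ∀ {i j}, i ≠ j → IsIrreducible (toricDivisor b i j) := fun hij => by
    rw [← closure_divisorOrbit hij]
    exact (isIrreducible_divisorOrbit hij).closure
  have hsub : ∀ {i j}, i ≠ j → toricDivisor b i j ⊆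
      ⋃ x : {x : Fin 3 × Fin 3 // x.1 ≠ x.2}, toricDivisor b x.1.1 x.1.2 := fun {i j} hij =>
    Set.subset_iUnion (fun x : {x : Fin 3 × Fin 3 // x.1 ≠ x.2} => toricDivisor b x.1.1 x.1.2)
      ⟨(i, j), hij⟩
  have hle : ∀ Z : Set Gr, Z ⊆ (⋃ x : {x : Fin 3 × Fin 3 // x.1 ≠ x.2},
      toricDivisor b x.1.1 x.1.2) → IsIrreducible Z → ∃ i j, i ≠ j ∧ Z ⊆ toricDivisor b i j := by
    intro Z hZ hZi
    obtain ⟨_, ht, hZt⟩ := isIrreducible_iff_sUnion_isClosed.1 hZi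
      (Finset.univ.image fun x : {x : Fin 3 × Fin 3 // x.1 ≠ x.2} => toricDivisor b x.1.1 x.1.2)
      (by
        intro z hz
        obtain ⟨x, -, rfl⟩ := Finset.mem_image.1 hz
        exact isClosed_toricDivisor)
      (by simpa [Set.sUnion_range] using hZ)
    obtain ⟨x, -, rfl⟩ := Finset.mem_image.1 ht
    exact ⟨_, _, x.2, hZt⟩
  constructor
  · intro hD
    obtain ⟨i, j, hij, hle⟩ := hle D hD.prop.1 hD.prop.2
    exact ⟨i, j, hij, hD.eq_of_subset ⟨hsub hij, hirr hij⟩ hle⟩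
  · rintro ⟨i, j, hij, rfl⟩
    refine ⟨⟨hsub hij, hirr hij⟩, fun Z hZ hDZ => ?_⟩
    obtain ⟨i', j', hij', hZle⟩ := hle Z hZ.1 hZ.2
    obtain ⟨rfl, rfl⟩ := eq_of_toricDivisor_subset hij (hDZ.trans hZle)
    exact hZle

end

/-! ### The boundary components and the Weyl group -/

namespace TorusFrame

variable {T : Subgroup G2} {ε : Fin 3 → Char T}

theorem smul_pairSubmodule (F : TorusFrame T ε) (x y : T) {L : Gr} {α β : ZornIndex → ℂ}
    (hL : L.1 = pairSubmodule F.basis α β) :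
    (((x : G2), (y : G2)) • L).1 = pairSubmodule F.basis
      (fun k => ((zornWeight ε k x : ℂˣ) : ℂ) * α k)
      (fun k => ((zornWeight ε k y : ℂˣ) : ℂ) * β k) := by
  ext u
  rw [mem_smul_iff, hL, mem_pairSubmodule, mem_pairSubmodule]
  refine forall_congr' fun k => ?_
  have hx := F.repr_apply x⁻¹ u.1 k
  have hy := F.repr_apply y⁻¹ u.2 k
  rw [map_inv, Units.val_inv_eq_inv_val] at hx hy
  change β k * F.basis.repr (((x⁻¹ : T) : G2).1 u.1) k =
    α k * F.basis.repr (((y⁻¹ : T) : G2).1 u.2) k ↔ _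
  rw [hx, hy]
  have hx0 : ((zornWeight ε k x : ℂˣ) : ℂ) ≠ 0 := Units.ne_zero _
  have hy0 : ((zornWeight ε k y : ℂˣ) : ℂ) ≠ 0 := Units.ne_zero _
  field_simp

theorem smul_toricSubmodule (F : TorusFrame T ε) (t : T) {L : Gr} {a c : Fin 3 → ℂ}
    (h0 : ∀ i, a i ≠ 0 ∨ c i ≠ 0) (hL : L.1 = toricSubmodule F.basis a c) :
    (((1 : G2), (t : G2)) • L).1 = toricSubmodule F.basis a (fun i => (ε i t : ℂ) * c i) := by
  refine (F.smul_pairSubmodule 1 t hL).trans (pairSubmodule_congr (fun k => ?_) (fun k => ?_) ?_)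
  · rcases toricCoord_ne_zero h0 k with h | h
    · exact .inl (mul_ne_zero (Units.ne_zero _) h)
    · exact .inr (mul_ne_zero (Units.ne_zero _) h)
  · refine toricCoord_ne_zero (fun i => ?_) k
    rcases h0 i with h | h
    · exact .inl h
    · exact .inr (mul_ne_zero (Units.ne_zero _) h)
  · rintro (s | ⟨(_ | _), i⟩)
    · simp [toricCoord, zornWeight]
    · simp only [toricCoord, zornWeight, map_one, Units.val_one, one_mul, MonoidHom.inv_apply,
        Units.val_inv_eq_inv_val]
      have : (ε i t : ℂ) ≠ 0 := Units.ne_zero _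
      field_simp
    · simp only [toricCoord, zornWeight, map_one, Units.val_one, one_mul]
      ring

/-- The diagonal torus fixes the surface pointwise. -/
theorem diag_smul_eq (F : TorusFrame T ε) (t : T) {L : Gr} (hL : L ∈ toricSurface F.basis) :
    ((t : G2), (t : G2)) • L = L := by
  obtain ⟨a, c, h0, -, hL⟩ := hL
  refine Subtype.ext ((F.smul_pairSubmodule t t hL).trans
    (Eq.trans (pairSubmodule_congr (fun k => ?_) (toricCoord_ne_zero h0) fun k => ?_) hL.symm))
  · rcases toricCoord_ne_zero h0 k with h | h
    · exact .inl (mul_ne_zero (Units.ne_zero _) h)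
    · exact .inr (mul_ne_zero (Units.ne_zero _) h)
  · ring

theorem graphPoint_val (F : TorusFrame T ε) (t : T) :
    (graphPoint t).1 = toricSubmodule F.basis 1 (fun i => (ε i t : ℂ)) := by
  have h1 : (graphPoint 1).1 = toricSubmodule F.basis 1 1 := by
    ext u
    rw [toricSubmodule, mem_pairSubmodule]
    change u.2 = u.1 ↔ _
    have h : ∀ k, toricCoord 1 1 k = 1 := by rintro (_ | ⟨(_ | _), i⟩) <;> rfl
    simp only [h, one_mul]
    rw [eq_comm, ← F.basis.repr.injective.eq_iff, Finsupp.ext_iff]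
  have h2 := F.smul_toricSubmodule t (fun i => .inl one_ne_zero) h1
  rw [smul_graphPoint] at h2
  simpa [Pi.one_def] using h2

/-- The `T`-fixed points of the open orbit are the graphs of the elements of `T`. -/
theorem exists_graphPoint_eq (F : TorusFrame T ε) {o : Gr} (ho : o ∈ Set.range graphPoint)
    (hfix : ∀ t ∈ T, ((t, t) : G2 × G2) • o = o) : ∃ g : T, graphPoint g = o := by
  obtain ⟨g, rfl⟩ := ho
  refine ⟨⟨g, F.mem_of_forall_commute fun t => ?_⟩, rfl⟩
  have h := hfix t t.2
  rw [smul_graphPoint] at h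
  exact mul_inv_eq_iff_eq_mul.1 (graphPoint_injective h)

theorem torusOrbit_graphPoint (F : TorusFrame T ε) (g : T) :
    torusOrbit T (graphPoint g) = toricOrbit F.basis := by
  ext L
  constructor
  · rintro ⟨t, ht, rfl⟩
    refine ⟨1, fun i => (ε i ⟨t, ht⟩ : ℂ) * ε i g, by simp,
      fun i => mul_ne_zero (Units.ne_zero _) (Units.ne_zero _), ?_,
      F.smul_toricSubmodule ⟨t, ht⟩ (fun i => .inl one_ne_zero) (F.graphPoint_val g)⟩
    rw [Finset.prod_mul_distrib, ← Units.coe_prod, ← Units.coe_prod, F.apply_prod, F.apply_prod]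
    simp
  · rintro ⟨a, c, ha, hc, hac, hL⟩
    obtain ⟨t, ht⟩ := F.exists_eq
      (fun i => Units.mk0 (c i) (hc i) / Units.mk0 (a i) (ha i) / ε i g) (by
        rw [Finset.prod_div_distrib, Finset.prod_div_distrib, F.apply_prod, div_one, div_eq_one]
        refine Units.ext ?_
        rw [Units.coe_prod, Units.coe_prod]
        exact hac.symm)
    refine ⟨t, t.2, Subtype.ext ?_⟩
    rw [F.smul_toricSubmodule t (fun i => .inl one_ne_zero) (F.graphPoint_val g), hL]
    refine toricSubmodule_congr (fun i => .inl (ha i)) (fun i => .inl one_ne_zero) fun i => ?_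
    have := ha i
    rw [ht]
    simp only [Units.val_div_eq_div_val, Units.val_mk0]
    field_simp

theorem closure_torusOrbit (F : TorusFrame T ε) (g : T) :
    closure (torusOrbit T (graphPoint g)) = toricSurface F.basis := by
  rw [F.torusOrbit_graphPoint, closure_toricOrbit]

theorem torusBoundary_eq (F : TorusFrame T ε) (g : T) : torusBoundary T (graphPoint g) =
    ⋃ x : {x : Fin 3 × Fin 3 // x.1 ≠ x.2}, toricDivisor F.basis x.1.1 x.1.2 := by
  have h : torusOrbit T (graphPoint g) ⊆ Set.range graphPoint := by
    rintro _ ⟨t, -, rfl⟩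
    rw [smul_graphPoint]
    exact ⟨_, rfl⟩
  rw [torusBoundary, torusClosure, doubleCayley,
    Set.inter_eq_right.2 (closure_mono h), F.closure_torusOrbit, F.torusOrbit_graphPoint,
    toricSurface_diff]

/-- The orbit of a point of the open orbit of a divisor is this open orbit. -/
theorem torusOrbit_divisor (F : TorusFrame T ε) {i j : Fin 3} (hij : i ≠ j) {z : ℂ} (hz : z ≠ 0)
    {p : Gr} (hp : p.1 = toricSubmodule F.basis (divisorFst j) (divisorSnd i j z)) :
    torusOrbit T p = divisorOrbit F.basis i j := by
  obtain ⟨k, hki, hkj, hk⟩ := exists_third hij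
  have key : ∀ t : T, (((1 : G2), (t : G2)) • p).1 =
      toricSubmodule F.basis (divisorFst j) (divisorSnd i j ((ε k t : ℂ) * z)) := fun t => by
    rw [F.smul_toricSubmodule t (divisorFst_ne_zero hij z) hp]
    refine toricSubmodule_congr (fun l => ?_) (divisorFst_ne_zero hij _) fun l => ?_
    · rcases divisorFst_ne_zero hij z l with h | h
      · exact .inl h
      · exact .inr (mul_ne_zero (Units.ne_zero _) h)
    · rcases hk l with rfl | rfl | rfl
      · simp [divisorSnd]
      · simp [divisorFst]
      · simp [divisorSnd, divisorFst, hki, hkj]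
  ext L
  constructor
  · rintro ⟨t, ht, rfl⟩
    exact ⟨_, mul_ne_zero (Units.ne_zero (ε k ⟨t, ht⟩)) hz, key ⟨t, ht⟩⟩
  · rintro ⟨s, hs, hL⟩
    obtain ⟨u, hu, huk⟩ := exists_prod_eq_one hij hki hkj (Units.mk0 (s / z) (div_ne_zero hs hz))
    obtain ⟨t, ht⟩ := F.exists_eq u hu
    refine ⟨t, t.2, Subtype.ext ?_⟩
    rw [key, ht, huk, hL, Units.val_mk0, div_mul_cancel₀ _ hz]

theorem exists_isRayGenerator (F : TorusFrame T ε) {i j : Fin 3} (hij : i ≠ j) :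
    ∃ lam : ℂˣ →* T, IsRayGenerator ε i j lam ∧
      ∀ s l, ε l (lam s) = if l = i then s else if l = j then s⁻¹ else 1 := by
  have hprod : ∀ s : ℂˣ, ∏ l, (if l = i then s else if l = j then s⁻¹ else 1) = 1 := fun s => by
    rw [Fin.prod_univ_three]
    fin_cases i <;> fin_cases j <;> simp at hij ⊢
  choose f hf using fun s => F.exists_eq _ (hprod s)
  have hinj : ∀ t t' : T, (∀ l, ε l t = ε l t') → t = t' := fun t t' h => by
    refine Subtype.ext (G2.ext_basis F.basis fun k => ?_)
    rw [F.apply_basis, F.apply_basis, zornWeight_apply, zornWeight_apply]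
    simp only [h]
  let lam : ℂˣ →* T :=
    { toFun := f
      map_one' := hinj _ _ fun l => by rw [hf, map_one]; simp
      map_mul' := fun s s' => hinj _ _ fun l => by
        rw [map_mul, hf, hf, hf]
        split_ifs <;> simp [mul_comm] }
  refine ⟨lam, fun l => ?_, hf⟩
  have hl : ∀ s, ε l (lam s) = _ := fun s => hf s l
  simp only [hl, epsilonForm]
  by_cases hli : l = i
  · subst hli
    exact ⟨1, by simp [hij]; norm_num, by simp⟩
  · by_cases hlj : l = j
    · subst hlj
      exact ⟨-1, by simp [hli]; norm_num, by simp [hli]⟩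
    · exact ⟨0, by simp [hli, hlj], by simp [hli, hlj]⟩

/-- The limit of the base point along the one-parameter subgroup of `ε_i - ε_j` lies in the open
orbit of the divisor `c i = a j = 0`. -/
theorem isDivisorOfRay (F : TorusFrame T ε) (g : T) {i j : Fin 3} (hij : i ≠ j) :
    IsDivisorOfRay T (graphPoint g) ε i j (toricDivisor F.basis i j) := by
  obtain ⟨lam, hlam, hlam'⟩ := F.exists_isRayGenerator hij
  obtain ⟨f, hf, hfs, hf0⟩ := exists_curve_limit F.basis hij fun l => ε l g
  obtain ⟨k, hki, hkj, -⟩ := exists_third hij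
  refine ⟨lam, hlam, (f 0).span, ⟨f, hf, fun s => Subtype.ext ?_, rfl⟩, ?_⟩
  · rw [hfs, F.smul_toricSubmodule (lam s) (fun i => .inl one_ne_zero) (F.graphPoint_val g)]
    simp only [hlam']
    rfl
  · rw [F.torusOrbit_divisor hij (Units.ne_zero (ε k g)) (hf0 k hki hkj),
      closure_divisorOrbit hij]

end TorusFrame

/-- The part of the closure of an orbit of `T` attached to a character `χ`, without reference to
coordinates: it consists of the subspaces that contain `(u, 0)` and `(0, w)` for weight vectors `u`
and `w` of the octonions whose weights have quotient `χ`. -/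
def weightDivisor (T : Subgroup G2) (o : Gr) (χ : Char T) : Set Gr :=
  {L | L ∈ closure (torusOrbit T o) ∧ ∃ (ψ₁ ψ₂ : Char T) (u w : Octonion), u ≠ 0 ∧ w ≠ 0 ∧
    (∀ t : T, (t : G2).1 u = (ψ₁ t : ℂ) • u) ∧ (∀ t : T, (t : G2).1 w = (ψ₂ t : ℂ) • w) ∧
    ψ₁ / ψ₂ = χ ∧ (u, 0) ∈ L.1 ∧ (0, w) ∈ L.1}

open TorusFrame in
set_option synthInstance.maxSize 1000 in
/-- A long root is a difference of weights of the octonions in two ways. -/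
theorem zornExp_sub_eq_long {i j : Fin 3} (hij : i ≠ j) {k l : ZornIndex}
    (h : zornExp k - zornExp l = epsilonExp i - epsilonExp j) :
    (k = .inr (true, i) ∧ l = .inr (true, j)) ∨ (k = .inr (false, j) ∧ l = .inr (false, i)) := by
  revert i j k l; decide +kernel

namespace TorusFrame

variable {T : Subgroup G2} {ε : Fin 3 → Char T}

/-- The divisor `c i = a j = 0` consists of the subspaces in the closure that contain `(x_i, 0)` and
`(0, x_j)`, and equivalently `(y_j, 0)` and `(0, y_i)`. -/
theorem weightDivisor_eq (F : TorusFrame T ε) (g : T) {i j : Fin 3} (hij : i ≠ j) :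
    weightDivisor T (graphPoint g) (ε i / ε j) = toricDivisor F.basis i j := by
  classical
  ext L
  constructor
  · rintro ⟨hL, ψ₁, ψ₂, u, w, hu, hw, hψ₁, hψ₂, hχ, huL, hwL⟩
    rw [F.closure_torusOrbit] at hL
    obtain ⟨a, c, h0, -, hL⟩ := hL
    obtain ⟨k, hk, rfl⟩ := F.exists_eq_zornWeight hψ₁ hu
    obtain ⟨l, hl, rfl⟩ := F.exists_eq_zornWeight hψ₂ hw
    have hkl : zornExp k - zornExp l = epsilonExp i - epsilonExp j := by
      have h1 : latticeChar ε (.ofAdd (zornExp k - zornExp l)) =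
          latticeChar ε (.ofAdd (epsilonExp i - epsilonExp j)) := by
        rw [latticeChar_ofAdd_sub, latticeChar_ofAdd_sub, F.latticeChar_zornExp,
          F.latticeChar_zornExp, F.latticeChar_epsilonExp, F.latticeChar_epsilonExp]
        exact hχ
      exact congrArg Multiplicative.toAdd (F.latticeChar_injective h1)
    rw [hL] at huL hwL
    have e1 : toricCoord c a k = 0 := by
      have := huL k
      simp only [map_zero, Finsupp.coe_zero, Pi.zero_apply, mul_zero] at this
      exact (mul_eq_zero.1 this).resolve_right hk
    have e2 : toricCoord a c l = 0 := by
      have := hwL l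
      simp only [map_zero, Finsupp.coe_zero, Pi.zero_apply, mul_zero] at this
      exact (mul_eq_zero.1 this.symm).resolve_right hl
    rcases zornExp_sub_eq_long hij hkl with ⟨rfl, rfl⟩ | ⟨rfl, rfl⟩
    · exact ⟨a, c, h0, e1, e2, hL⟩
    · exact ⟨a, c, h0, e2, e1, hL⟩
  · intro hL
    refine ⟨by rw [F.closure_torusOrbit]; exact toricDivisor_subset hL,
      zornWeight ε (.inr (true, i)), zornWeight ε (.inr (true, j)), F.basis (.inr (true, i)),
      F.basis (.inr (true, j)), F.basis.ne_zero _, F.basis.ne_zero _,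
      fun t => F.apply_basis t _, fun t => F.apply_basis t _, rfl, ?_, ?_⟩
    · obtain ⟨a, c, h0, hc, ha, hL⟩ := hL
      rw [hL]
      intro k
      simp only [map_zero, Finsupp.coe_zero, Pi.zero_apply, mul_zero, Basis.repr_self,
        Finsupp.single_apply]
      split_ifs with h
      · subst h
        simp [toricCoord, hc]
      · simp
    · obtain ⟨a, c, h0, hc, ha, hL⟩ := hL
      rw [hL]
      intro k
      simp only [map_zero, Finsupp.coe_zero, Pi.zero_apply, mul_zero, Basis.repr_self,
        Finsupp.single_apply]
      split_ifs with h
      · subst h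
        simp [toricCoord, ha]
      · simp

theorem maximal_iff (F : TorusFrame T ε) (g : T) (D : Set Gr) :
    Maximal (fun Z => Z ⊆ torusBoundary T (graphPoint g) ∧ IsIrreducible Z) D ↔
      ∃ i j, i ≠ j ∧ D = toricDivisor F.basis i j := by
  rw [F.torusBoundary_eq]
  exact maximal_irreducible_iff D

end TorusFrame

section NormalizerAction

variable {T : Subgroup G2} {o : Gr}

/-- The diagonal action of an element of `G₂`. -/
def diagSMul (n : G2) (L : Gr) : Gr := ((n, n) : G2 × G2) • L

theorem diagSMul_mul (n m : G2) (L : Gr) : diagSMul (n * m) L = diagSMul n (diagSMul m L) :=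
  mul_smul ((n, n) : G2 × G2) (m, m) L

theorem diagSMul_one (L : Gr) : diagSMul 1 L = L := one_smul (G2 × G2) L

theorem diagSMul_inv (n : G2) (L : Gr) : diagSMul n⁻¹ (diagSMul n L) = L := by
  rw [← diagSMul_mul, inv_mul_cancel, diagSMul_one]

theorem diagSMul_inv' (n : G2) (L : Gr) : diagSMul n (diagSMul n⁻¹ L) = L := by
  rw [← diagSMul_mul, mul_inv_cancel, diagSMul_one]

theorem continuous_diagSMul (n : G2) : Continuous (diagSMul n) := continuous_smul_gr (n, n)

theorem mem_diagSMul (n : G2) (L : Gr) (u : Octonion × Octonion) :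
    u ∈ (diagSMul n L).1 ↔ ((n⁻¹).1 u.1, (n⁻¹).1 u.2) ∈ L.1 := mem_smul_iff _ _ _

theorem diagSMul_mem_torusOrbit (g : T) (n : torusNormalizer T) {L : Gr}
    (hL : L ∈ torusOrbit T (graphPoint g)) :
    diagSMul n L ∈ torusOrbit T (graphPoint g) := by
  obtain ⟨t, ht, rfl⟩ := hL
  have h1 : (n : G2) * (t * g) * (n : G2)⁻¹ ∈ T :=
    (Subgroup.mem_normalizer_iff.1 n.2 _).1 (mul_mem ht g.2)
  refine ⟨_, mul_mem h1 (inv_mem g.2), ?_⟩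
  rw [diagSMul, smul_graphPoint, smul_graphPoint, smul_graphPoint]
  congr 1
  simp [mul_assoc]

theorem diagSMul_mem_closure (g : T) (n : torusNormalizer T) {L : Gr}
    (hL : L ∈ closure (torusOrbit T (graphPoint g))) :
    diagSMul n L ∈ closure (torusOrbit T (graphPoint g)) :=
  map_mem_closure (continuous_diagSMul n) hL fun _ h => diagSMul_mem_torusOrbit g n h

theorem diagSMul_mem_boundary (g : T) (n : torusNormalizer T) {L : Gr}
    (hL : L ∈ torusBoundary T (graphPoint g)) :
    diagSMul n L ∈ torusBoundary T (graphPoint g) := by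
  refine ⟨⟨?_, diagSMul_mem_closure g n hL.1.2⟩, fun h => hL.2 ?_⟩
  · refine map_mem_closure (continuous_diagSMul n) hL.1.1 ?_
    rintro _ ⟨x, rfl⟩
    rw [diagSMul, smul_graphPoint]
    exact ⟨_, rfl⟩
  · have := diagSMul_mem_torusOrbit g n⁻¹ h
    rwa [Subgroup.coe_inv, diagSMul_inv] at this

/-- The divisor attached to a character is equivariant for the normalizer of the torus. -/
theorem diagSMul_image_weightDivisor (g : T) (n : torusNormalizer T) (χ : Char T) :
    diagSMul n '' weightDivisor T (graphPoint g) χ =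
      weightDivisor T (graphPoint g) (conjChar n χ) := by
  have key : ∀ (n : torusNormalizer T) (χ : Char T) L, L ∈ weightDivisor T (graphPoint g) χ →
      diagSMul n L ∈ weightDivisor T (graphPoint g) (conjChar n χ) := by
    rintro n χ L ⟨hL, ψ₁, ψ₂, u, w, hu, hw, hψ₁, hψ₂, rfl, huL, hwL⟩
    have hwt : ∀ (ψ : Char T) (v : Octonion), (∀ t : T, (t : G2).1 v = (ψ t : ℂ) • v) →
        ∀ t : T, (t : G2).1 ((n : G2).1 v) = (conjChar n ψ t : ℂ) • (n : G2).1 v := by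
      intro ψ v hv t
      rw [conjChar_apply, ← map_smul, ← hv]
      change t.1.1 (n.1.1 _) = n.1.1 (n.1.1.symm (t.1.1 (n.1.1 _)))
      rw [LinearEquiv.apply_symm_apply]
    have hn : ∀ v, ((n : G2)⁻¹).1 ((n : G2).1 v) = v := fun v => n.1.1.symm_apply_apply v
    refine ⟨diagSMul_mem_closure g n hL, conjChar n ψ₁, conjChar n ψ₂, (n : G2).1 u, (n : G2).1 w,
      by simpa using hu, by simpa using hw, hwt _ _ hψ₁, hwt _ _ hψ₂, rfl, ?_, ?_⟩
    · rw [mem_diagSMul]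
      simpa only [hn, map_zero] using huL
    · rw [mem_diagSMul]
      simpa only [hn, map_zero] using hwL
  refine Set.Subset.antisymm ?_ fun L hL => ?_
  · rintro _ ⟨L, hL, rfl⟩
    exact key n χ L hL
  · refine ⟨diagSMul (n : G2)⁻¹ L, ?_, diagSMul_inv' _ _⟩
    have := key n⁻¹ _ L hL
    rwa [← conjChar_mul, inv_mul_cancel, conjChar_one] at this

theorem maximal_image_diagSMul (g : T) (n : torusNormalizer T) {D : Set Gr}
    (hD : Maximal (fun Z => Z ⊆ torusBoundary T (graphPoint g) ∧ IsIrreducible Z) D) :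
    Maximal (fun Z => Z ⊆ torusBoundary T (graphPoint g) ∧ IsIrreducible Z)
      (diagSMul n '' D) := by
  have key : ∀ (n : torusNormalizer T) (Z : Set Gr),
      Z ⊆ torusBoundary T (graphPoint g) ∧ IsIrreducible Z →
      diagSMul n '' Z ⊆ torusBoundary T (graphPoint g) ∧ IsIrreducible (diagSMul n '' Z) := by
    intro n Z hZ
    refine ⟨?_, hZ.2.image _ (continuous_diagSMul n).continuousOn⟩
    rintro _ ⟨L, hL, rfl⟩
    exact diagSMul_mem_boundary g n (hZ.1 hL)
  refine ⟨key n D hD.prop, fun Z hZ hDZ L hL => ?_⟩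
  have h1 : D ⊆ diagSMul (n : G2)⁻¹ '' Z := fun M hM =>
    ⟨_, hDZ ⟨M, hM, rfl⟩, diagSMul_inv _ _⟩
  exact ⟨diagSMul (n : G2)⁻¹ L, hD.le_of_ge (key n⁻¹ Z hZ) h1 ⟨L, hL, rfl⟩, diagSMul_inv' _ _⟩

/-- The action of the normalizer of the torus on the components of the boundary, as a homomorphism
to permutations. -/
def normalizerPerm (g : T) :
    torusNormalizer T →* Equiv.Perm (BoundaryComponent T (graphPoint g)) :=
  letI : MulAction (torusNormalizer T) (BoundaryComponent T (graphPoint g)) :=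
    { smul := fun n D => ⟨diagSMul n '' D.1, maximal_image_diagSMul g n D.2⟩
      one_smul := fun D => Subtype.ext (by
        change diagSMul 1 '' D.1 = D.1
        rw [show diagSMul 1 = id from funext diagSMul_one, Set.image_id])
      mul_smul := fun n m D => Subtype.ext (by
        change diagSMul (n * m) '' D.1 = diagSMul n '' (diagSMul m '' D.1)
        rw [Set.image_image]
        simp only [diagSMul_mul]) }
  MulAction.toPermHom _ _

theorem normalizerPerm_apply (g : T) (n : torusNormalizer T)
    (D : BoundaryComponent T (graphPoint g)) :
    (normalizerPerm g n D).1 = diagSMul n '' D.1 := rfl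

end NormalizerAction

/-- The action of the Weyl group on the components of the boundary: the torus acts trivially as it
fixes the surface pointwise. -/
theorem TorusFrame.exists_weylAction {T : Subgroup G2} {ε : Fin 3 → Char T} (F : TorusFrame T ε)
    (g : T) : ∃ _ : MulAction (WeylGroup T) (BoundaryComponent T (graphPoint g)),
      ∀ (n : torusNormalizer T) (D : BoundaryComponent T (graphPoint g)),
        ((n : WeylGroup T) • D).1 = diagSMul n '' D.1 := by
  let ρ : WeylGroup T →* Equiv.Perm (BoundaryComponent T (graphPoint g)) :=
    QuotientGroup.lift _ (normalizerPerm g) (by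
      intro t ht
      ext D : 1
      refine Subtype.ext ?_
      rw [normalizerPerm_apply]
      have h : ∀ L ∈ D.1, diagSMul t L = L := fun L hL =>
        F.diag_smul_eq ⟨t, Subgroup.mem_subgroupOf.1 ht⟩ (by
          rw [← F.closure_torusOrbit g]
          exact (D.2.prop.1 hL).1.2)
      rw [Set.image_congr h, Set.image_id']
      rfl)
  exact ⟨MulAction.compHom _ ρ, fun n D => rfl⟩

/-- The components of the boundary correspond to the long roots. -/
theorem TorusFrame.exists_component_equiv {T : Subgroup G2} {ε : Fin 3 → Char T}
    (F : TorusFrame T ε) (g : T) :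
    ∃ Φ : BoundaryComponent T (graphPoint g) ≃ weylOrbit (fundamentalWeightTwo ε),
      ∀ D, D.1 = weightDivisor T (graphPoint g) (Φ D) := by
  have hlong : ∀ χ : weylOrbit (fundamentalWeightTwo ε), ∃ i j, i ≠ j ∧ (χ : Char T) = ε i / ε j :=
    fun χ => F.weylOrbit_eq.subset χ.2
  let Ψ : weylOrbit (fundamentalWeightTwo ε) → BoundaryComponent T (graphPoint g) := fun χ =>
    ⟨weightDivisor T (graphPoint g) χ, by
      obtain ⟨i, j, hij, hχ⟩ := hlong χ
      rw [hχ, F.weightDivisor_eq g hij]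
      exact (F.maximal_iff g _).2 ⟨i, j, hij, rfl⟩⟩
  have hΨ : Function.Bijective Ψ := by
    constructor
    · intro χ χ' h
      obtain ⟨i, j, hij, hχ⟩ := hlong χ
      obtain ⟨i', j', hij', hχ'⟩ := hlong χ'
      have h1 : weightDivisor T (graphPoint g) χ = weightDivisor T (graphPoint g) χ' :=
        congrArg Subtype.val h
      rw [hχ, hχ', F.weightDivisor_eq g hij, F.weightDivisor_eq g hij'] at h1
      obtain ⟨rfl, rfl⟩ := eq_of_toricDivisor_subset hij h1.subset
      exact Subtype.ext (hχ.trans hχ'.symm)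
    · intro D
      obtain ⟨i, j, hij, hD⟩ := (F.maximal_iff g _).1 D.2
      refine ⟨⟨ε i / ε j, ?_⟩, Subtype.ext ?_⟩
      · rw [F.weylOrbit_eq]
        exact ⟨i, j, hij, rfl⟩
      · exact (F.weightDivisor_eq g hij).trans hD.symm
  refine ⟨(Equiv.ofBijective Ψ hΨ).symm, fun D => ?_⟩
  exact (congrArg Subtype.val ((Equiv.ofBijective Ψ hΨ).apply_symm_apply D)).symm

theorem conjChar_mem_weylOrbit {T : Subgroup G2} {χ ψ : Char T} (n : torusNormalizer T)
    (h : ψ ∈ weylOrbit χ) : conjChar n ψ ∈ weylOrbit χ := by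
  obtain ⟨m, rfl⟩ := h
  exact ⟨n * m, (conjChar_mul n m χ).symm⟩

end DoubleCayley

end

open DoubleCayley in
theorem lemma3p12 (T : Subgroup G2) (hT : IsTorus 2 T)
    (o : Gr) (ho : o ∈ Set.range graphPoint)
    (hfix : ∀ t ∈ T, ((t, t) : G2 × G2) • o = o) :
    ∃ _ : MulAction (WeylGroup T) (BoundaryComponent T o),
      (∀ (n : torusNormalizer T) (D : BoundaryComponent T o),
        ((n : WeylGroup T) • D).1 = (fun L => (((n : G2), (n : G2)) : G2 × G2) • L) '' D.1) ∧
      MulAction.IsPretransitive (WeylGroup T) (BoundaryComponent T o) ∧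
      (∃ ε : Fin 3 → Char T, IsEpsilonSystem T ε) ∧
      ∀ ε : Fin 3 → Char T, IsEpsilonSystem T ε →
        weylOrbit (fundamentalWeightTwo ε) = {χ | ∃ i j, i ≠ j ∧ χ = ε i / ε j} ∧
        ∃ Φ : BoundaryComponent T o ≃ weylOrbit (fundamentalWeightTwo ε),
          (∀ D i j, i ≠ j → (Φ D : Char T) = ε i / ε j → IsDivisorOfRay T o ε i j D.1) ∧
          ∀ (n : torusNormalizer T) (D : BoundaryComponent T o),
            (Φ ((n : WeylGroup T) • D) : Char T) = conjChar n (Φ D : Char T) := by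
  obtain ⟨ε₀, ⟨F₀⟩⟩ := hT.exists_torusFrame
  obtain ⟨g, rfl⟩ := F₀.exists_graphPoint_eq ho hfix
  obtain ⟨act, hact⟩ := F₀.exists_weylAction g
  have hmain : ∀ ε : Fin 3 → Char T, IsEpsilonSystem T ε →
      weylOrbit (fundamentalWeightTwo ε) = {χ | ∃ i j, i ≠ j ∧ χ = ε i / ε j} ∧
      ∃ Φ : BoundaryComponent T (graphPoint g) ≃ weylOrbit (fundamentalWeightTwo ε),
        (∀ D i j, i ≠ j → (Φ D : Char T) = ε i / ε j →
          IsDivisorOfRay T (graphPoint g) ε i j D.1) ∧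
        ∀ (n : torusNormalizer T) (D : BoundaryComponent T (graphPoint g)),
          (Φ ((n : WeylGroup T) • D) : Char T) = conjChar n (Φ D : Char T) := by
    intro ε hε
    obtain ⟨F⟩ := F₀.ofIsEpsilonSystem hε
    obtain ⟨Φ, hΦ⟩ := F.exists_component_equiv g
    refine ⟨F.weylOrbit_eq, Φ, fun D i j hij hD => ?_, fun n D => ?_⟩
    · rw [hΦ D, hD, F.weightDivisor_eq g hij]
      exact F.isDivisorOfRay g hij
    · let χ : weylOrbit (fundamentalWeightTwo ε) := ⟨_, conjChar_mem_weylOrbit n (Φ D).2⟩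
      have h1 : ((n : WeylGroup T) • D) = Φ.symm χ := by
        refine Subtype.ext ?_
        rw [hact, hΦ (Φ.symm χ), Equiv.apply_symm_apply, hΦ D, diagSMul_image_weightDivisor]
      rw [h1, Equiv.apply_symm_apply]
  refine ⟨act, hact, ⟨fun D D' => ?_⟩, ⟨ε₀, F₀.isEpsilonSystem⟩, hmain⟩
  -- Transitivity carries over from the orbit of the fundamental weight.
  obtain ⟨-, Φ, -, hΦ⟩ := hmain ε₀ F₀.isEpsilonSystem
  obtain ⟨n, hn⟩ := (Φ D).2
  obtain ⟨m, hm⟩ := (Φ D').2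
  refine ⟨((m * n⁻¹ : torusNormalizer T) : WeylGroup T), Φ.injective (Subtype.ext ?_)⟩
  rw [hΦ, hn, hm, ← conjChar_mul, inv_mul_cancel_right]
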